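/- **Setting.** Let $m\ge 2$. The vertices $1,\dots,n$ are divided into $m$ groups; the first has $n_1$ vertices and each of the others $n_2$ vertices, $n_1\ne n_2$. The random matrix $A$ is symmetric with $0/1$ entries; the entries $A_{ij}$, $i\le j$, are independent, and $A_{ij}=1$ with probability $p$ if $i,j$ are in the same group and $q$ otherwise. Let $\delta\in[0,1]$, let $\varepsilon_{ij}$ $(1\le i,j\le n)$ be i.i.d. with a law supported on $[0,1]$, and put $\tilde A_{ij}=(1-\delta)A_{ij}+\delta\varepsilon_{ij}$, $\tilde R=\mathbb E\tilde A$, $\tilde p=(1-\delta)p+\delta\,\mathbb E\varepsilon_{11}$, $\tilde q=(1-\delta)q+\delta\,\mathbb E\varepsilon_{11}$, $d_1=n_1\tilde p+(m-1)n_2\tilde q$, $d_2=n_1\tilde q+n_2\tilde p+(m-2)n_2\tilde q$. Let $\phi(\alpha,d)$ be $C^2$ and positive for $\alpha\in\mathbb R$, $d>0$, with $\phi(0,\cdot)\equiv1$, nondecreasing in $\alpha$ for each $d\ge1$, nondecreasing in $d$ if $\alpha>0$, nonincreasing in $d$ if $\alpha<0$; such that for $d>d'>0$ one has $\frac{d}{d\alpha}\frac{\phi(\alpha,d')}{\phi(\alpha,d)}<0$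 and $\lim_{\alpha\to\infty}\frac{\phi(\alpha,d')}{\phi(\alpha,d)}=\lim_{\alpha\to-\infty}\frac{\phi(\alpha,d)}{\phi(\alpha,d')}=0$; and such that for each $\alpha$ both $\limsup_{d\to\infty}\frac{|\partial_d\phi(\alpha,d)|}{\phi(\alpha,d)/d}<\infty$ and $\limsup_{d\to\infty}\frac{\partial_d^2\phi(\alpha,d)}{\partial_d\phi(\alpha,d)/d}<\infty$. (For example $\phi(\alpha,d)=d^\alpha$.) For an $n\times n$ matrix $M$ with row sums $d_i(M)$ let $T_\alpha(M)_{ij}=\dfrac{M_{ij}\,\phi(\alpha,d_j(M))}{\sum_k M_{ik}\,\phi(\alpha,d_k(M))}$, put $\tilde T(\alpha)=T_\alpha(\tilde A)$, $\tilde T^*(\alpha)=T_\alpha(\tilde R)$, and let $|\lambda_2(\cdot)|$ be the second largest modulus of the complex eigenvalues, counted with algebraic multiplicity. If $\tilde p,\tilde q>0$ and $d_1\neq d_2$, put $g(\alpha)=\phi(\alpha,d_2)/\phi(\alpha,d_1)$, $a=g^{-1}\!\left(\frac{n_1}{n_2}\right)$, $b=g^{-1}\!\left(\frac{n_1}{n_2}\Big(\frac{\tilde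 p}{(m-1)(\tilde p+(m-2)\tilde q)}\Big)^{1/2}\right)$, and $\mathcal D=[a,\infty)$ if $m=2$; $\mathcal D=(-\infty,a]\cup[b,\infty)$ if $m\ge3$, $d_1>d_2$; $\mathcal D=(b,a]$ if $m\ge3$, $d_1<d_2$. **(i)** If $n_1,n_2>0$, $\tilde p,\tilde q>0$ and $d_1\ne d_2$, then $g:\mathbb R\to(0,\infty)$ is a bijection, and $\alpha\mapsto|\lambda_2(\tilde T^*(\alpha))|$ is strictly decreasing on every interval contained in $\mathcal D$ and strictly increasing on every interval contained in the complement of $\mathcal D$. **(ii)** For all $\alpha_0,\alpha_{\max}\in\mathbb R$ and $r>0$ there is a constant $\hat C>0$, depending only on $m,\phi,\alpha_0,\alpha_{\max},r$, such that the following holds for every $\delta$, every law of the noise, and all sequences of networks as above, with $n_1,n_2,p,q$ depending on $n$. Let $\tau_n=\min_i d_i(\tilde R)/n$. Assume $\tau_n\big/\sqrt{\log n/n}\to\infty$ and, for all large $n$, $n_1/n\ge 1/r$, $n_2/n\ge1/r$, $1/r\le\tilde p/\tilde q\le r$ and $|\tilde p/\tilde q-1|\ge1/r$. Then there is $n_0$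 such that for all $n>n_0$ and all $\alpha_1\in(\alpha_0,\alpha_{\max}]$ with $[\alpha_0,\alpha_1]\subseteq\mathcal D$ and $$\alpha_1-\alpha_0>\hat C\,\frac{\sqrt{\log n}}{\tau_n\sqrt n}\,\left|\frac{\partial_\alpha\phi(\alpha,d_1)}{\phi(\alpha,d_1)}-\frac{\partial_\alpha\phi(\alpha,d_2)}{\phi(\alpha,d_2)}\right|^{-1}\qquad\text{for all }\alpha\in[\alpha_0,\alpha_1],$$ one has $$\mathbb P\left\{|\lambda_2(\tilde T(\alpha_0))|-|\lambda_2(\tilde T(\alpha_1))|>0\right\}\ge1-\frac{16}{n^2}.$$ (For $\phi=d^\alpha$ the bracket is $\log(d_1/d_2)$ for every $\alpha$.) -/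

import Mathlib

open Filter Topology MeasureTheory ProbabilityTheory

universe u

noncomputable section

/-- The standing requirements on a degree-weighting function `φ (α, d)`, on `ℝ × (0, ∞)`
(so that both `d ^ α` and functions that are smooth up to `d = 0` are covered). -/
structure IsWeightFunction (φ : ℝ → ℝ → ℝ) : Prop where
  contDiffOn : ContDiffOn ℝ 2 (fun x : ℝ × ℝ => φ x.1 x.2) (Set.univ ×ˢ Set.Ioi 0)
  pos : ∀ α d : ℝ, 0 < d → 0 < φ α d
  zero_eq_one : ∀ d : ℝ, 0 < d → φ 0 d = 1
  mono_param : ∀ d : ℝ, 1 ≤ d → Monotone (fun α => φ α d)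
  mono_degree : ∀ α : ℝ, 0 < α → MonotoneOn (φ α) (Set.Ioi 0)
  anti_degree : ∀ α : ℝ, α < 0 → AntitoneOn (φ α) (Set.Ioi 0)
  ratio_deriv_neg : ∀ d₁ d₂ : ℝ, 0 < d₂ → d₂ < d₁ →
    ∀ α : ℝ, deriv (fun a => φ a d₂ / φ a d₁) α < 0
  ratio_atTop : ∀ d₁ d₂ : ℝ, 0 < d₂ → d₂ < d₁ →
    Tendsto (fun a => φ a d₂ / φ a d₁) atTop (𝓝 0)
  ratio_atBot : ∀ d₁ d₂ : ℝ, 0 < d₂ → d₂ < d₁ →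
    Tendsto (fun a => φ a d₁ / φ a d₂) atBot (𝓝 0)
  growth_first : ∀ α : ℝ, ∃ C : ℝ, ∀ᶠ d in atTop,
    |deriv (φ α) d| / (φ α d / d) ≤ C
  growth_second : ∀ α : ℝ, ∃ C : ℝ, ∀ᶠ d in atTop,
    deriv (deriv (φ α)) d / (deriv (φ α) d / d) ≤ C

/-- The degree of vertex `i`: the `i`-th row sum. -/
def degree {n : ℕ} (M : Matrix (Fin n) (Fin n) ℝ) (i : Fin n) : ℝ := ∑ j, M i j

/-- The degree-weighted learning matrix built from a (weighted, possibly random or expected)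
adjacency matrix `M`. -/
def learningMatrix {n : ℕ} (φ : ℝ → ℝ → ℝ) (α : ℝ) (M : Matrix (Fin n) (Fin n) ℝ) :
    Matrix (Fin n) (Fin n) ℝ :=
  Matrix.of fun i j => M i j * φ α (degree M j) / ∑ k, M i k * φ α (degree M k)

/-- The moduli of the complex eigenvalues of a real matrix, counted with algebraic multiplicity,
in decreasing order. -/
def eigenvalueModuli {n : ℕ} (M : Matrix (Fin n) (Fin n) ℝ) : List ℝ :=
  ((M.map (algebraMap ℝ ℂ)).charpoly.roots.map (fun z => ‖z‖)).sort (· ≥ ·)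

/-- `|λ₂(M)|`: the modulus of the second largest eigenvalue in magnitude (for `n ≥ 2`). -/
def absLambdaTwo {n : ℕ} (M : Matrix (Fin n) (Fin n) ℝ) : ℝ := (eigenvalueModuli M).getD 1 0

/-- The number of vertices in group `k`. -/
def groupSize {n m : ℕ} (grp : Fin n → Fin m) (k : Fin m) : ℕ :=
  (Finset.univ.filter fun i => grp i = k).card

/-- The first group has `n₁` vertices, and each of the other groups has `n₂` vertices. -/
def HasGroupSizes {n m : ℕ} (grp : Fin n → Fin m) (n₁ n₂ : ℕ) : Prop :=
  ∀ k : Fin m, groupSize grp k = if k.val = 0 then n₁ else n₂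

/-- Linking probabilities: `p` within a group, `q` between different groups. -/
def linkProb {m : ℕ} (p q : ℝ) (k l : Fin m) : ℝ := if k = l then p else q

/-- `A` is the adjacency matrix of a stochastic block model with linking probabilities `p` and `q`,
and the entries of `ε`, over all ordered pairs `(i, j)`, are i.i.d. with law `ν`.
Nothing is required of the joint law of `A` and `ε`. -/
structure IsNoisyBlockModel {Ω : Type u} [MeasurableSpace Ω] (μ : Measure Ω) {n m : ℕ}
    (grp : Fin n → Fin m) (p q : ℝ) (ν : Measure ℝ)
    (A ε : Ω → Matrix (Fin n) (Fin n) ℝ) : Prop where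
  adj_measurable : ∀ i j, Measurable (fun ω => A ω i j)
  adj_zero_or_one : ∀ ω i j, A ω i j = 0 ∨ A ω i j = 1
  adj_symm : ∀ ω i j, A ω i j = A ω j i
  adj_prob : ∀ i j, μ.real {ω | A ω i j = 1} = linkProb p q (grp i) (grp j)
  adj_indep : iIndepFun
    (fun (e : {e : Fin n × Fin n // e.1 ≤ e.2}) (ω : Ω) => A ω e.1.1 e.1.2) μ
  noise_measurable : ∀ i j, Measurable (fun ω => ε ω i j)
  noise_law : ∀ i j, μ.map (fun ω => ε ω i j) = ν
  noise_indep : iIndepFun (fun (e : Fin n × Fin n) (ω : Ω) => ε ω e.1 e.2) μ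

/-- The perturbed adjacency matrix `(1 - δ) A + δ ε`. -/
def perturb {Ω : Type u} {n : ℕ} (δ : ℝ) (A ε : Ω → Matrix (Fin n) (Fin n) ℝ) (ω : Ω) :
    Matrix (Fin n) (Fin n) ℝ :=
  Matrix.of fun i j => (1 - δ) * A ω i j + δ * ε ω i j

/-- The entrywise expectation of a random matrix. -/
def expectedMatrix {Ω : Type u} [MeasurableSpace Ω] (μ : Measure Ω) {n : ℕ}
    (M : Ω → Matrix (Fin n) (Fin n) ℝ) : Matrix (Fin n) (Fin n) ℝ :=
  Matrix.of fun i j => ∫ ω, M ω i j ∂μ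

/-- The expected entry of the perturbed matrix where the linking probability is `x`:
`(1 - δ) x + δ 𝔼 ε`. -/
def perturbedProb (δ : ℝ) (ν : Measure ℝ) (x : ℝ) : ℝ := (1 - δ) * x + δ * ∫ y, y ∂ν

/-- Expected degree of a vertex of the first group, for expected entries `p`, `q`. -/
def expDegOne (m n₁ n₂ : ℕ) (p q : ℝ) : ℝ := n₁ * p + ((m : ℝ) - 1) * n₂ * q

/-- Expected degree of a vertex of any other group, for expected entries `p`, `q`. -/
def expDegTwo (m n₁ n₂ : ℕ) (p q : ℝ) : ℝ := n₁ * q + n₂ * p + ((m : ℝ) - 2) * n₂ * q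

/-- `g(α) = φ(α, d₂) / φ(α, d₁)`, for the two expected degrees `d₁`, `d₂`. -/
def gFun (φ : ℝ → ℝ → ℝ) (m n₁ n₂ : ℕ) (p q : ℝ) (α : ℝ) : ℝ :=
  φ α (expDegTwo m n₁ n₂ p q) / φ α (expDegOne m n₁ n₂ p q)

/-- The inverse function of `g`. -/
def gInv (φ : ℝ → ℝ → ℝ) (m n₁ n₂ : ℕ) (p q : ℝ) (y : ℝ) : ℝ :=
  Function.invFun (gFun φ m n₁ n₂ p q) y

/-- `g⁻¹(n₁ / n₂)`. -/
def thresholdOne (φ : ℝ → ℝ → ℝ) (m n₁ n₂ : ℕ) (p q : ℝ) : ℝ :=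
  gInv φ m n₁ n₂ p q ((n₁ : ℝ) / n₂)

/-- `g⁻¹((n₁ / n₂) (p / ((m - 1) (p + (m - 2) q))) ^ (1 / 2))`. -/
def thresholdTwo (φ : ℝ → ℝ → ℝ) (m n₁ n₂ : ℕ) (p q : ℝ) : ℝ :=
  gInv φ m n₁ n₂ p q
    ((n₁ : ℝ) / n₂ * Real.sqrt (p / (((m : ℝ) - 1) * (p + ((m : ℝ) - 2) * q))))

/-- The set `D_α` (used for `d₁ ≠ d₂`). -/
def decreaseRegion (φ : ℝ → ℝ → ℝ) (m n₁ n₂ : ℕ) (p q : ℝ) : Set ℝ :=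
  if m = 2 then Set.Ici (thresholdOne φ m n₁ n₂ p q)
  else if expDegTwo m n₁ n₂ p q < expDegOne m n₁ n₂ p q then
    Set.Iic (thresholdOne φ m n₁ n₂ p q) ∪ Set.Ici (thresholdTwo φ m n₁ n₂ p q)
  else Set.Ioc (thresholdTwo φ m n₁ n₂ p q) (thresholdOne φ m n₁ n₂ p q)

/-- `τ = minᵢ dᵢ(R) / n`. -/
def minDensity {n : ℕ} (R : Matrix (Fin n) (Fin n) ℝ) : ℝ := (⨅ i, degree R i) / n

/-- The error rate `√(log n) / (τ √n)`. -/
def errorRate (n : ℕ) (τ : ℝ) : ℝ := Real.sqrt (Real.log n) / (τ * Real.sqrt n)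

/-- `(∂φ/∂α)(α, d₁) / φ(α, d₁) - (∂φ/∂α)(α, d₂) / φ(α, d₂)`. -/
def logDerivGap (φ : ℝ → ℝ → ℝ) (α d₁ d₂ : ℝ) : ℝ :=
  deriv (fun a => φ a d₁) α / φ α d₁ - deriv (fun a => φ a d₂) α / φ α d₂

end

/-!
The expected perturbed network has two densities `p` and `q`, so after rescaling it is a block
matrix that depends only on `ρ = p / q`, and its learning matrix depends on `α` only through the
ratio `x` (`weightRatio`) of the total weight of the first group and that of any other group. This
matrix is reversible and has, besides `0` and `1`, the eigenvalue `lamA = (ρ - 1) / rowTwo` of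
multiplicity `m - 2` and the eigenvalue `lamB`, which separates the first group from the rest.
Explicit formulas show that `|lamA|` decreases in `x`, that `|lamB|` increases up to `critPoint` and
decreases afterwards, and that `|lamA|` dominates exactly for `x ≤ 1`. Since `x` is strictly
monotone in `α`, with a direction given by the sign of `d₁ - d₂`, the thresholds `x = 1` and
`x = critPoint` become `g⁻¹` of the two values in the definition of `decreaseRegion`. This gives the
monotonicity for the expected network (`monotonicity_absLambdaTwo_linkMatrix`).

For the random network, `|λ₂|` is the spectral radius of the deflated matrix `T - 1 vᵀ`
(`absLambdaTwo_isGreatest`). The deflated block matrix is self-adjoint for the weights `revWeight`,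
so eigenvalues of a perturbation move by at most a multiple of its norm, and cannot disappear
(`BlockData.absLambdaTwo_perturb`). Let `e` be the relative error of the network and of its weights,
and `L` the distance of the two weight ratios. If `lamTwo` drops by at least a multiple of `L` and
`L` is a large multiple of `e`, this suffices. Near `critPoint`, however, `|lamB|` only drops by
about `L * (u₀ + u₁)`, with `u₀` and `u₁` the distances of the weight ratios to `critPoint`. There
the second-order expansion `BlockData.absLambdaTwo_perturb_second_order` is used. Its first-order
term splits into a response to the perturbed weights, which carries a factor `u₀` or `u₁`
(`BlockData.weight_response`), and `firstOrder`, the response to the perturbed matrix at the weights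
of the expected network. The latter involves the same matrix for both parameters and is Lipschitz in
`x`, so the difference of its two values is of order `e * L`. All errors are thus at most
`e * L + e * (u₀ + u₁) + e ^ 2`, up to constants, which is small compared with `L * (u₀ + u₁)`
(`NearBlock.absLambdaTwo_lt`).

It remains to bound `e` by a multiple of the error rate with high probability. Hoeffding's
inequality, applied separately to the network and to the noise, bounds every linear statistic. With
a net of the unit ball it gives an operator norm of order `√n` for the deviation, and with a union
bound, deviations of order `√(n log n)` for the links between a vertex and a group
(`IsNoisyBlockModel.measureReal_not_concentrated_le`). The weights inherit the relative error of the
degrees because `log (φ α d)` is Lipschitz in `log d`, uniformly for `α` in a bounded interval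
(`IsWeightFunction.exists_log_lipschitz`). The lower bound on `α₁ - α₀` says, by the mean value
theorem for the logarithm of the weight ratio, that `L` is a large multiple of the error rate.
-/

/-! ### Eigenvalues and deflation of a stochastic matrix -/

section LinearAlgebra

open Matrix
open scoped Matrix.Norms.L2Operator

variable {ι : Type*} [Fintype ι] [DecidableEq ι]

/-- `z` is an eigenvalue of the complex matrix `M`. -/
def IsEigenvalue (M : Matrix ι ι ℂ) (z : ℂ) : Prop := ∃ u : ι → ℂ, u ≠ 0 ∧ M *ᵥ u = z • u

theorem isEigenvalue_iff_det (M : Matrix ι ι ℂ) (z : ℂ) :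
    IsEigenvalue M z ↔ (scalar ι z - M).det = 0 := by
  rw [← exists_mulVec_eq_zero_iff]
  have key : ∀ u : ι → ℂ, (scalar ι z - M) *ᵥ u = z • u - M *ᵥ u := by
    intro u
    rw [sub_mulVec, scalar_apply, ← smul_one_eq_diagonal, smul_mulVec, one_mulVec]
  constructor
  · rintro ⟨u, hu, h⟩
    exact ⟨u, hu, by rw [key, h, sub_self]⟩
  · rintro ⟨u, hu, h⟩
    rw [key, sub_eq_zero] at h
    exact ⟨u, hu, h.symm⟩

theorem isEigenvalue_iff_mem_roots (M : Matrix ι ι ℂ) (z : ℂ) :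
    IsEigenvalue M z ↔ z ∈ M.charpoly.roots := by
  rw [isEigenvalue_iff_det, Polynomial.mem_roots (charpoly_monic M).ne_zero, Polynomial.IsRoot,
    eval_charpoly]

/-- Wielandt deflation: subtracting `1 vᵀ` from a matrix with constant row sums `1` replaces the
eigenvalue `1` by `0`. -/
theorem charpoly_sub_vecMulVec_one (T : Matrix ι ι ℂ) (v : ι → ℂ) (hT : T *ᵥ 1 = 1)
    (hv : v ⬝ᵥ 1 = 1) :
    (Polynomial.X - 1) * (T - vecMulVec 1 v).charpoly = Polynomial.X * T.charpoly := by
  apply Polynomial.eq_of_infinite_eval_eq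
  refine Set.Infinite.mono (s := {1}ᶜ) ?_ (Set.Finite.infinite_compl (Set.finite_singleton 1))
  intro z hz
  have hz1 : z - 1 ≠ 0 := sub_ne_zero.2 hz
  simp only [Set.mem_ofPred_eq, Polynomial.eval_mul, Polynomial.eval_sub, Polynomial.eval_X,
    Polynomial.eval_one, eval_charpoly]
  have hfac : scalar ι z - (T - vecMulVec 1 v) =
      (scalar ι z - T) * (1 + replicateCol Unit ((z - 1)⁻¹ • (1 : ι → ℂ)) * replicateRow Unit v) := by
    rw [← vecMulVec_eq, mul_add, mul_one, mul_vecMulVec, sub_mulVec, mulVec_smul, mulVec_smul, hT,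
      scalar_apply, ← smul_one_eq_diagonal, smul_mulVec, one_mulVec, ← smul_sub]
    have e : (z - 1)⁻¹ • (z • (1 : ι → ℂ) - 1) = 1 := by
      ext i
      simp [hz1]
    rw [e]
    abel
  rw [hfac, det_mul, det_one_add_replicateCol_mul_replicateRow, dotProduct_smul, hv, smul_eq_mul]
  field_simp
  ring

/-- The eigenvalues of a nonnegative matrix with row sums `1` lie in the unit disc. -/
theorem IsEigenvalue.norm_le_one {T : Matrix ι ι ℝ} (hT0 : ∀ i j, 0 ≤ T i j)
    (hT1 : ∀ i, ∑ j, T i j = 1) {z : ℂ} (hz : IsEigenvalue (T.map (algebraMap ℝ ℂ)) z) :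
    ‖z‖ ≤ 1 := by
  obtain ⟨u, hu, h⟩ := hz
  have hev : Module.End.HasEigenvalue (toLin' (T.map (algebraMap ℝ ℂ))) z :=
    Module.End.hasEigenvalue_of_hasEigenvector
      (x := u) ⟨by rw [Module.End.mem_eigenspace_iff, toLin'_apply, h], hu⟩
  obtain ⟨k, hk⟩ := eigenvalue_mem_ball hev
  rw [Metric.mem_closedBall, dist_eq_norm] at hk
  have h1 : ‖z‖ ≤ ‖z - T k k‖ + ‖((T k k : ℝ) : ℂ)‖ := by
    simpa using norm_add_le (z - T k k) ((T k k : ℝ) : ℂ)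
  have h2 : ∑ j ∈ Finset.univ.erase k, ‖T.map (algebraMap ℝ ℂ) k j‖ =
      ∑ j ∈ Finset.univ.erase k, T k j :=
    Finset.sum_congr rfl fun j _ => by simp [abs_of_nonneg (hT0 k j)]
  have h3 := Finset.add_sum_erase Finset.univ (fun j => T k j) (Finset.mem_univ k)
  rw [h2] at hk
  simp only [map_apply, Complex.coe_algebraMap] at hk
  rw [Complex.norm_real, Real.norm_of_nonneg (hT0 k k)] at h1
  have h4 := hT1 k
  linarith

/-- The deflated matrix `T - 1 vᵀ`, with complex entries. -/
noncomputable def deflate (T : Matrix ι ι ℝ) (v : ι → ℝ) : Matrix ι ι ℂ :=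
  T.map (algebraMap ℝ ℂ) - vecMulVec 1 (fun i => (v i : ℂ))

/-- For a stochastic matrix `T`, `|λ₂(T)|` is the spectral radius of any deflation `T - 1 vᵀ`
with `∑ vᵢ = 1`. -/
theorem absLambdaTwo_isGreatest {n : ℕ} (hn : 2 ≤ n) (T : Matrix (Fin n) (Fin n) ℝ)
    (v : Fin n → ℝ) (hT0 : ∀ i j, 0 ≤ T i j) (hT1 : ∀ i, ∑ j, T i j = 1) (hv : ∑ i, v i = 1) :
    IsGreatest ((fun z : ℂ => ‖z‖) '' {z | IsEigenvalue (deflate T v) z}) (absLambdaTwo T) := by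
  set TC := T.map (algebraMap ℝ ℂ) with hTC
  have h1 : TC *ᵥ 1 = 1 := by
    ext i
    simp only [hTC, mulVec, dotProduct, map_apply, Pi.one_apply, mul_one, Complex.coe_algebraMap]
    rw [← Complex.ofReal_sum, hT1, Complex.ofReal_one]
  have h2 : (fun i => (v i : ℂ)) ⬝ᵥ 1 = 1 := by
    simp only [dotProduct, Pi.one_apply, mul_one]
    rw [← Complex.ofReal_sum, hv, Complex.ofReal_one]
  have hch := charpoly_sub_vecMulVec_one TC _ h1 h2
  change (Polynomial.X - 1) * (deflate T v).charpoly = _ at hch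
  have hmon := charpoly_monic TC
  have hmonW := charpoly_monic (deflate T v)
  have hX1 : (Polynomial.X - 1 : Polynomial ℂ) = Polynomial.X - Polynomial.C 1 := by simp
  have hroots : 1 ::ₘ (deflate T v).charpoly.roots = 0 ::ₘ TC.charpoly.roots := by
    have := congrArg Polynomial.roots hch
    rw [Polynomial.roots_mul, Polynomial.roots_mul, hX1, Polynomial.roots_X_sub_C,
      Polynomial.roots_X] at this
    · simpa using this
    · exact mul_ne_zero Polynomial.X_ne_zero hmon.ne_zero
    · rw [hX1]; exact mul_ne_zero (Polynomial.X_sub_C_ne_zero 1) hmonW.ne_zero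
  obtain ⟨s, hs1, hs2⟩ : ∃ s : Multiset ℂ, TC.charpoly.roots = 1 ::ₘ s ∧
      (deflate T v).charpoly.roots = 0 ::ₘ s := by
    rcases Multiset.cons_eq_cons.1 hroots with h | ⟨_, cs, hc1, hc2⟩
    · exact absurd h.1 one_ne_zero
    · exact ⟨cs, hc2, hc1⟩
  have hcard : Multiset.card TC.charpoly.roots = n := by
    rw [IsAlgClosed.card_roots_eq_natDegree, charpoly_natDegree_eq_dim, Fintype.card_fin]
  have hscard : Multiset.card s = n - 1 := by
    rw [hs1, Multiset.card_cons] at hcard; omega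
  have hle1 : ∀ z ∈ s, ‖z‖ ≤ 1 := fun z hz =>
    IsEigenvalue.norm_le_one hT0 hT1
      ((isEigenvalue_iff_mem_roots _ _).2 (by rw [← hTC, hs1]; exact Multiset.mem_cons_of_mem hz))
  have hsort : eigenvalueModuli T = 1 :: (s.map (fun z => ‖z‖)).sort (· ≥ ·) := by
    unfold eigenvalueModuli
    rw [← hTC, hs1, Multiset.map_cons, norm_one, Multiset.sort_cons]
    intro b hb
    obtain ⟨z, hz, rfl⟩ := Multiset.mem_map.1 hb
    exact hle1 z hz
  set l := (s.map (fun z => ‖z‖)).sort (· ≥ ·) with hl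
  have hmem : ∀ x, x ∈ l ↔ ∃ z ∈ s, ‖z‖ = x := by
    intro x; rw [hl, Multiset.mem_sort, Multiset.mem_map]
  have hlen : l.length = n - 1 := by rw [hl, Multiset.length_sort, Multiset.card_map, hscard]
  have habs : absLambdaTwo T = l.getD 0 0 := by
    unfold absLambdaTwo; rw [hsort]; rfl
  obtain ⟨a, l', hal⟩ : ∃ a l', l = a :: l' := by
    cases hc : l with
    | nil => rw [hc] at hlen; simp at hlen; omega
    | cons a l' => exact ⟨a, l', rfl⟩
  have hpair : l.Pairwise (· ≥ ·) := Multiset.pairwise_sort _ _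
  have hmax : ∀ x ∈ l, x ≤ a := by
    intro x hx
    rw [hal] at hx hpair
    rcases List.mem_cons.1 hx with h | h
    · exact h.le
    · exact (List.pairwise_cons.1 hpair).1 x h
  rw [habs, hal]
  change IsGreatest _ a
  have haml : a ∈ l := by rw [hal]; simp
  obtain ⟨z, hz, hza⟩ := (hmem a).1 haml
  refine ⟨⟨z, (isEigenvalue_iff_mem_roots _ _).2 (by rw [hs2]; exact Multiset.mem_cons_of_mem hz),
    hza⟩, ?_⟩
  rintro _ ⟨w, hw, rfl⟩
  have hw' := (isEigenvalue_iff_mem_roots _ _).1 hw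
  rw [hs2] at hw'
  rcases Multiset.mem_cons.1 hw' with h | h
  · subst h
    simp only [norm_zero]
    rw [← hza]; exact norm_nonneg z
  · exact hmax _ ((hmem _).2 ⟨w, h, rfl⟩)

end LinearAlgebra

/-! ### Perturbation of eigenvalues -/

section Perturbation

open Matrix
open scoped Matrix.Norms.L2Operator

variable {ι : Type*} [Fintype ι] [DecidableEq ι]

theorem norm_mulVec_toLp_le (A : Matrix ι ι ℂ) (u : ι → ℂ) :
    ‖WithLp.toLp 2 (A *ᵥ u)‖ ≤ ‖A‖ * ‖WithLp.toLp 2 u‖ :=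
  l2_opNorm_mulVec A (WithLp.toLp 2 u)

theorem IsEigenvalue.norm_le {M : Matrix ι ι ℂ} {z : ℂ} (h : IsEigenvalue M z) : ‖z‖ ≤ ‖M‖ := by
  obtain ⟨u, hu, h⟩ := h
  have h1 := norm_mulVec_toLp_le M u
  rw [h, WithLp.toLp_smul, norm_smul] at h1
  exact le_of_mul_le_mul_right h1 (norm_pos_iff.2 (by simpa using hu))

/-- For a Hermitian matrix, `‖(z - H) u‖ ≥ dist(z, spec H) ‖u‖`. -/
theorem norm_resolvent_ge {H : Matrix ι ι ℂ} (hH : H.IsHermitian) {z : ℂ} {d : ℝ} (hd : 0 ≤ d)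
    (hz : ∀ h : ℝ, IsEigenvalue H h → d ≤ ‖z - h‖) (u : ι → ℂ) :
    d * ‖WithLp.toLp 2 u‖ ≤ ‖WithLp.toLp 2 (z • u - H *ᵥ u)‖ := by
  set b := hH.eigenvectorBasis with hb
  have hinner : ∀ i, inner ℂ (b i) (WithLp.toLp 2 (z • u - H *ᵥ u)) =
      (z - hH.eigenvalues i) * inner ℂ (b i) (WithLp.toLp 2 u) := by
    intro i
    have h1 : inner ℂ (b i) (WithLp.toLp 2 (H *ᵥ u)) =
        (hH.eigenvalues i : ℂ) * inner ℂ (b i) (WithLp.toLp 2 u) := by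
      have h2 := hH.mulVec_eigenvectorBasis i
      simp only [EuclideanSpace.inner_eq_star_dotProduct]
      rw [dotProduct_comm, dotProduct_mulVec, ← star_star (star (b i).ofLp ᵥ* H), star_vecMul,
        star_star, hH.eq, h2, star_smul, smul_dotProduct, dotProduct_comm, ← hb]
      simp [Complex.real_smul]
    rw [WithLp.toLp_sub, inner_sub_right, h1, WithLp.toLp_smul, inner_smul_right]
    ring
  have hge : ∀ i, d ≤ ‖z - hH.eigenvalues i‖ := by
    intro i
    refine hz _ ⟨(b i).ofLp, ?_, ?_⟩
    · intro h0
      have := b.orthonormal.1 i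
      rw [show b i = 0 from by ext j; exact congrFun h0 j] at this
      simp at this
    · rw [hb, hH.mulVec_eigenvectorBasis i]
      ext j; simp [Complex.real_smul]
  have hsq : (d * ‖WithLp.toLp 2 u‖) ^ 2 ≤ ‖WithLp.toLp 2 (z • u - H *ᵥ u)‖ ^ 2 := by
    rw [mul_pow, ← b.sum_sq_norm_inner_right, ← b.sum_sq_norm_inner_right, Finset.mul_sum]
    refine Finset.sum_le_sum fun i _ => ?_
    rw [hinner, norm_mul, mul_pow]
    gcongr
    exact hge i
  exact le_of_sq_le_sq hsq (norm_nonneg _)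

theorem exists_eigenvalue_near_of_isHermitian {H E : Matrix ι ι ℂ} (hH : H.IsHermitian) {z : ℂ}
    (hz : IsEigenvalue (H + E) z) : ∃ h : ℝ, IsEigenvalue H h ∧ ‖z - h‖ ≤ ‖E‖ := by
  obtain ⟨u, hu, h⟩ := hz
  have hupos : 0 < ‖WithLp.toLp 2 u‖ := norm_pos_iff.2 (by simpa using hu)
  by_contra! hcon
  -- finitely many eigenvalues: the distance exceeds `‖E‖` by a margin
  obtain ⟨d, hd1, hd2⟩ : ∃ d, ‖E‖ < d ∧ ∀ h : ℝ, IsEigenvalue H h → d ≤ ‖z - h‖ := by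
    set F : Finset ℝ := (insert (‖E‖ + 1) (H.charpoly.roots.toFinset.image fun w => ‖z - w‖)).filter
      (fun x => ‖E‖ < x) with hF
    have hne : F.Nonempty := ⟨‖E‖ + 1, by simp [hF]⟩
    refine ⟨F.min' hne, ?_, fun h hh => F.min'_le _ ?_⟩
    · exact (Finset.mem_filter.1 (F.min'_mem hne)).2
    · rw [hF, Finset.mem_filter]
      refine ⟨Finset.mem_insert_of_mem (Finset.mem_image.2 ⟨h, ?_, rfl⟩), hcon h hh⟩
      rw [Multiset.mem_toFinset]
      exact (isEigenvalue_iff_mem_roots _ _).1 hh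
  have h1 := norm_resolvent_ge hH ((norm_nonneg E).trans hd1.le) hd2 u
  have h2 : z • u - H *ᵥ u = E *ᵥ u := by rw [← h, add_mulVec]; abel
  rw [h2] at h1
  have h3 := h1.trans (norm_mulVec_toLp_le E u)
  exact absurd (le_of_mul_le_mul_right h3 hupos) (not_le.2 hd1)

/-- Second-order expansion at a simple eigenvalue `l` of a Hermitian matrix `H` with unit
eigenvector `e`; `H - l e e*` has the other eigenvalues of `H`, from which `z` keeps the
distance `d`. -/
theorem norm_eigenvalue_sub_first_order_le {H E : Matrix ι ι ℂ} (hH : H.IsHermitian) {z : ℂ}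
    (hz : IsEigenvalue (H + E) z) {e : ι → ℂ} {l : ℝ} (he : H *ᵥ e = (l : ℂ) • e)
    (he1 : ‖WithLp.toLp 2 e‖ = 1) {d : ℝ} (hd : 0 < d)
    (hgap : ∀ h : ℝ, IsEigenvalue (H - (l : ℂ) • vecMulVec e (star e)) h → d ≤ ‖z - h‖)
    {g : ℝ} (hEg : ‖E‖ ≤ g) (hg : 4 * g ≤ d) :
    ‖z - l - star e ⬝ᵥ (E *ᵥ e)‖ ≤ 4 * g ^ 2 / d := by
  obtain ⟨u, hu, h⟩ := hz
  have hg0 : 0 ≤ g := (norm_nonneg E).trans hEg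
  have hupos : 0 < ‖WithLp.toLp 2 u‖ := norm_pos_iff.2 (by simpa using hu)
  have hbound : ∀ w : ι → ℂ, ‖star e ⬝ᵥ w‖ ≤ ‖WithLp.toLp 2 w‖ := by
    intro w
    have := norm_inner_le_norm (𝕜 := ℂ) (WithLp.toLp 2 e) (WithLp.toLp 2 w)
    rw [EuclideanSpace.inner_eq_star_dotProduct, he1, one_mul, dotProduct_comm] at this
    exact this
  have hee : star e ⬝ᵥ e = 1 := by
    have := inner_self_eq_norm_sq_to_K (𝕜 := ℂ) (WithLp.toLp 2 e)
    rw [EuclideanSpace.inner_eq_star_dotProduct, he1, dotProduct_comm] at this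
    simpa using this
  have hleft : ∀ w : ι → ℂ, star e ⬝ᵥ (H *ᵥ w) = l * (star e ⬝ᵥ w) := by
    intro w
    rw [dotProduct_mulVec, ← star_star (star e ᵥ* H), star_vecMul, star_star, hH.eq, he,
      star_smul, smul_dotProduct]
    simp
  set c := star e ⬝ᵥ u with hc
  set v := u - c • e with hv
  have hev : star e ⬝ᵥ v = 0 := by
    rw [hv, dotProduct_sub, dotProduct_smul, hee, ← hc]; simp
  have huv : u = c • e + v := by rw [hv]; abel
  have hproj : c * (z - l) = star e ⬝ᵥ (E *ᵥ u) := by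
    have h1 := congrArg (fun w => star e ⬝ᵥ w) h
    simp only [add_mulVec, dotProduct_add, hleft, dotProduct_smul, smul_eq_mul] at h1
    rw [← hc] at h1
    linear_combination -h1
  have hH' : (H - (l : ℂ) • vecMulVec e (star e)).IsHermitian := by
    refine hH.sub ?_
    rw [IsHermitian, conjTranspose_smul, conjTranspose_vecMulVec, star_star]
    simp
  have hH'v : (H - (l : ℂ) • vecMulVec e (star e)) *ᵥ v = H *ᵥ v := by
    rw [sub_mulVec, smul_mulVec, vecMulVec_mulVec, hev]; simp
  have hres := norm_resolvent_ge hH' hd.le hgap v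
  rw [hH'v] at hres
  have hEu : ‖WithLp.toLp 2 (E *ᵥ u)‖ ≤ g * ‖WithLp.toLp 2 u‖ :=
    (norm_mulVec_toLp_le E u).trans (by gcongr)
  have hzv : z • v - H *ᵥ v = E *ᵥ u - (star e ⬝ᵥ (E *ᵥ u)) • e := by
    have h1 : H *ᵥ v = z • u - E *ᵥ u - (c * l) • e := by
      rw [hv, mulVec_sub, mulVec_smul, he, ← h, add_mulVec, smul_smul]; abel
    rw [h1, ← hproj, hv, smul_sub, smul_smul]
    ext i
    simp
    ring
  have hvle : d * ‖WithLp.toLp 2 v‖ ≤ 2 * g * ‖WithLp.toLp 2 u‖ := by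
    refine hres.trans ?_
    rw [hzv, WithLp.toLp_sub, WithLp.toLp_smul]
    refine (norm_sub_le _ _).trans ?_
    rw [norm_smul, he1, mul_one]
    have := hbound (E *ᵥ u)
    linarith
  have hvu : ‖WithLp.toLp 2 v‖ ≤ 2 * g / d * ‖WithLp.toLp 2 u‖ := by
    rw [div_mul_eq_mul_div, le_div_iff₀ hd]; linarith
  have hhalf : 2 * g / d ≤ 1 / 2 := by rw [div_le_iff₀ hd]; linarith
  have hcu : ‖WithLp.toLp 2 u‖ / 2 ≤ ‖c‖ := by
    have h1 : ‖WithLp.toLp 2 u‖ ≤ ‖c‖ + ‖WithLp.toLp 2 v‖ := by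
      conv_lhs => rw [huv, WithLp.toLp_add, WithLp.toLp_smul]
      refine (norm_add_le _ _).trans ?_
      rw [norm_smul, he1, mul_one]
    have h2 : ‖WithLp.toLp 2 v‖ ≤ 1 / 2 * ‖WithLp.toLp 2 u‖ :=
      hvu.trans (by gcongr)
    linarith
  have hmain : c * (z - l - star e ⬝ᵥ (E *ᵥ e)) = star e ⬝ᵥ (E *ᵥ v) := by
    have : E *ᵥ u = c • (E *ᵥ e) + E *ᵥ v := by
      conv_lhs => rw [huv, mulVec_add, mulVec_smul]
    rw [mul_sub, hproj, this, dotProduct_add, dotProduct_smul, smul_eq_mul]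
    ring
  have hfin : ‖c‖ * ‖z - l - star e ⬝ᵥ (E *ᵥ e)‖ ≤ g * (2 * g / d * ‖WithLp.toLp 2 u‖) := by
    rw [← norm_mul, hmain]
    refine (hbound _).trans ((norm_mulVec_toLp_le E v).trans ?_)
    gcongr
  have h5 : ‖WithLp.toLp 2 u‖ / 2 * ‖z - l - star e ⬝ᵥ (E *ᵥ e)‖ ≤
      ‖WithLp.toLp 2 u‖ / 2 * (4 * g ^ 2 / d) := by
    refine (mul_le_mul_of_nonneg_right hcu (norm_nonneg _)).trans (hfin.trans (le_of_eq ?_))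
    field_simp
    ring
  exact le_of_mul_le_mul_left h5 (by positivity)

/-- A complex `n × n` matrix `M` has an eigenvalue within `|det (z - M)|^{1/n}` of `z`. -/
theorem exists_eigenvalue_dist_lt (M : Matrix ι ι ℂ) (z : ℂ) {d : ℝ} (hd : 0 < d)
    (h : ‖(scalar ι z - M).det‖ < d ^ Fintype.card ι) : ∃ w, IsEigenvalue M w ∧ ‖z - w‖ < d := by
  by_contra! hcon
  have hsplit := IsAlgClosed.splits M.charpoly
  have heval : (scalar ι z - M).det = (M.charpoly.roots.map fun w => z - w).prod := by
    rw [← eval_charpoly, hsplit.eval_eq_prod_roots_of_monic (charpoly_monic M)]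
  have hcard : Multiset.card M.charpoly.roots = Fintype.card ι := by
    rw [IsAlgClosed.card_roots_eq_natDegree, charpoly_natDegree_eq_dim]
  have key : ∀ s : Multiset ℂ, (∀ w ∈ s, d ≤ ‖z - w‖) →
      d ^ Multiset.card s ≤ ‖(s.map fun w => z - w).prod‖ := by
    intro s
    induction s using Multiset.induction_on with
    | empty => simp
    | cons a s ih =>
      intro hs
      rw [Multiset.card_cons, Multiset.map_cons, Multiset.prod_cons, norm_mul, pow_succ']
      exact mul_le_mul (hs a (Multiset.mem_cons_self a s))
        (ih fun w hw => hs w (Multiset.mem_cons_of_mem hw)) (by positivity) (norm_nonneg _)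
  have := key M.charpoly.roots fun w hw => hcon w ((isEigenvalue_iff_mem_roots _ _).2 hw)
  rw [hcard, ← heval] at this
  linarith

/-- If no matrix on the segment from `W` to `W + E` has an eigenvalue with modulus in
`[r₁, r₂)`, then eigenvalues of modulus at least `r₂` cannot disappear along the segment. -/
theorem exists_eigenvalue_norm_ge {W E : Matrix ι ι ℂ} {r₁ r₂ : ℝ} (hr : r₁ < r₂)
    (hgap : ∀ t : ℝ, t ∈ Set.Icc (0 : ℝ) 1 → ∀ z, IsEigenvalue (W + (t : ℂ) • E) z →
      r₁ ≤ ‖z‖ → r₂ ≤ ‖z‖)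
    (h0 : ∃ z, IsEigenvalue W z ∧ r₂ ≤ ‖z‖) : ∃ z, IsEigenvalue (W + E) z ∧ r₂ ≤ ‖z‖ := by
  set P : ℝ → ℂ → ℂ := fun t z => (scalar ι z - (W + (t : ℂ) • E)).det with hP
  have hPcont : Continuous fun x : ℝ × ℂ => P x.1 x.2 := by
    simp only [hP]
    apply Continuous.matrix_det
    have h1 : Continuous fun x : ℝ × ℂ => scalar ι x.2 := by
      simp only [scalar_apply]
      exact Continuous.matrix_diagonal (continuous_pi fun _ => continuous_snd)
    exact h1.sub (continuous_const.add
      ((Complex.continuous_ofReal.comp continuous_fst).smul continuous_const))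
  set S : Set ℝ := {t | t ∈ Set.Icc (0 : ℝ) 1 ∧ ∃ z, IsEigenvalue (W + (t : ℂ) • E) z ∧ r₁ ≤ ‖z‖}
    with hS
  have hSimage : S = Prod.fst '' ((Set.Icc (0 : ℝ) 1 ×ˢ Metric.closedBall (0 : ℂ) (‖W‖ + ‖E‖)) ∩
      ({x : ℝ × ℂ | P x.1 x.2 = 0} ∩ {x : ℝ × ℂ | r₁ ≤ ‖x.2‖})) := by
    ext t
    constructor
    · rintro ⟨ht, z, hz, hzr⟩
      refine ⟨(t, z), ⟨⟨ht, ?_⟩, (isEigenvalue_iff_det _ _).1 hz, hzr⟩, rfl⟩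
      rw [mem_closedBall_zero_iff]
      refine hz.norm_le.trans ((norm_add_le _ _).trans ?_)
      rw [norm_smul, Complex.norm_real, Real.norm_of_nonneg ht.1]
      have := mul_le_mul_of_nonneg_right ht.2 (norm_nonneg E)
      linarith
    · rintro ⟨⟨t', z⟩, ⟨⟨ht, -⟩, hz, hzr⟩, rfl⟩
      exact ⟨ht, z, (isEigenvalue_iff_det _ _).2 hz, hzr⟩
  have hSclosed : IsClosed S := by
    rw [hSimage]
    refine (IsCompact.image ?_ continuous_fst).isClosed
    refine (isCompact_Icc.prod (isCompact_closedBall _ _)).inter_right ?_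
    exact (isClosed_eq hPcont continuous_const).inter
      (isClosed_le continuous_const (continuous_norm.comp continuous_snd))
  have hsub : Set.Icc (0 : ℝ) 1 ⊆ S := by
    refine IsClosed.Icc_subset_of_forall_mem_nhdsWithin (by rwa [Set.inter_eq_left.2 fun t h => h.1])
      ?_ ?_
    · obtain ⟨z, hz, hzr⟩ := h0
      exact ⟨by simp, z, by simpa using hz, hr.le.trans hzr⟩
    · rintro t ⟨⟨ht, z, hz, hzr⟩, ht'⟩
      have hz2 := hgap t ht z hz hzr
      have hcont : Continuous fun s => ‖P s z‖ :=
        (hPcont.comp (Continuous.prodMk continuous_id continuous_const)).norm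
      have hlt : ∀ᶠ s in 𝓝 t, ‖P s z‖ < (r₂ - r₁) ^ Fintype.card ι := by
        apply hcont.continuousAt.eventually_lt continuousAt_const
        have : P t z = 0 := (isEigenvalue_iff_det _ _).1 hz
        rw [this, norm_zero]
        exact pow_pos (sub_pos.2 hr) _
      have hIoo : ∀ᶠ s in 𝓝[>] t, s ∈ Set.Ioc t 1 :=
        Ioc_mem_nhdsGT ht'.2
      filter_upwards [hIoo, mem_nhdsWithin_of_mem_nhds hlt] with s hs1 hs2
      obtain ⟨w, hw, hwz⟩ := exists_eigenvalue_dist_lt _ z (sub_pos.2 hr) hs2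
      refine ⟨⟨ht.1.trans hs1.1.le, hs1.2⟩, w, hw, ?_⟩
      have := norm_sub_norm_le z w
      linarith
  obtain ⟨-, z, hz, hzr⟩ := hsub (Set.right_mem_Icc.2 zero_le_one)
  have h2 := hgap 1 (Set.right_mem_Icc.2 zero_le_one) z hz hzr
  exact ⟨z, by simpa using hz, h2⟩

end Perturbation

/-! ### Perturbation of matrices that are self-adjoint for a weighted inner product -/

section Weighted

open Matrix
open scoped Matrix.Norms.L2Operator

variable {ι : Type*} [Fintype ι]

/-- A real matrix, with its entries read as complex numbers. -/
noncomputable abbrev toComplex (M : Matrix ι ι ℝ) : Matrix ι ι ℂ := M.map (algebraMap ℝ ℂ)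

theorem isEigenvalue_toComplex_of_real {M : Matrix ι ι ℝ} {h : ℝ} {v : ι → ℝ} (hv : v ≠ 0)
    (hM : M *ᵥ v = h • v) : IsEigenvalue (toComplex M) h := by
  refine ⟨fun i => (v i : ℂ), ?_, ?_⟩
  · intro h0
    apply hv
    ext i
    simpa using congrFun h0 i
  · ext i
    have := congrFun hM i
    simp only [mulVec, dotProduct, Pi.smul_apply, smul_eq_mul, map_apply,
      Complex.coe_algebraMap] at this ⊢
    rw [← Complex.ofReal_mul, ← this]
    push_cast
    rfl

theorem exists_real_eigenvector {M : Matrix ι ι ℝ} {h : ℝ} (hM : IsEigenvalue (toComplex M) h) :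
    ∃ v : ι → ℝ, v ≠ 0 ∧ M *ᵥ v = h • v := by
  obtain ⟨u, hu, hM⟩ := hM
  have hre : M *ᵥ (fun i => (u i).re) = h • fun i => (u i).re := by
    ext i
    have := congrArg Complex.re (congrFun hM i)
    simpa [mulVec, dotProduct] using this
  have him : M *ᵥ (fun i => (u i).im) = h • fun i => (u i).im := by
    ext i
    have := congrArg Complex.im (congrFun hM i)
    simpa [mulVec, dotProduct] using this
  by_cases h0 : (fun i => (u i).re) = 0
  · refine ⟨_, ?_, him⟩
    intro h1
    apply hu
    ext i
    exact Complex.ext (congrFun h0 i) (congrFun h1 i)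
  · exact ⟨_, h0, hre⟩

variable [DecidableEq ι]

/-- The similarity transform of `M` by the diagonal matrix of the square roots of `ω`. -/
noncomputable def weightConj (ω : ι → ℝ) (M : Matrix ι ι ℂ) : Matrix ι ι ℂ :=
  diagonal (fun i => ((√(ω i) : ℝ) : ℂ)) * M * diagonal (fun i => (((√(ω i))⁻¹ : ℝ) : ℂ))

theorem weightConj_apply (ω : ι → ℝ) (M : Matrix ι ι ℂ) (i j : ι) :
    weightConj ω M i j = ((√(ω i) : ℝ) : ℂ) * M i j * (((√(ω j))⁻¹ : ℝ) : ℂ) := by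
  rw [weightConj, mul_diagonal, diagonal_mul]

theorem weightConj_add (ω : ι → ℝ) (M N : Matrix ι ι ℂ) :
    weightConj ω (M + N) = weightConj ω M + weightConj ω N := by
  simp only [weightConj, mul_add, add_mul]

theorem weightConj_mulVec {ω : ι → ℝ} (hω : ∀ i, 0 < ω i) (M : Matrix ι ι ℂ) (u : ι → ℂ) (i : ι) :
    (weightConj ω M *ᵥ fun j => ((√(ω j) : ℝ) : ℂ) * u j) i = ((√(ω i) : ℝ) : ℂ) * (M *ᵥ u) i := by
  simp only [mulVec, dotProduct, weightConj_apply]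
  rw [Finset.mul_sum]
  refine Finset.sum_congr rfl fun j _ => ?_
  have : ((√(ω j) : ℝ) : ℂ) ≠ 0 := by
    exact_mod_cast (Real.sqrt_pos.2 (hω j)).ne'
  push_cast
  field_simp

theorem IsEigenvalue.weightConj {ω : ι → ℝ} (hω : ∀ i, 0 < ω i) {M : Matrix ι ι ℂ} {z : ℂ}
    (h : IsEigenvalue M z) : IsEigenvalue (weightConj ω M) z := by
  obtain ⟨u, hu, h⟩ := h
  refine ⟨fun j => ((√(ω j) : ℝ) : ℂ) * u j, ?_, ?_⟩
  · intro h0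
    apply hu
    ext i
    have h1 : ((√(ω i) : ℝ) : ℂ) ≠ 0 := by exact_mod_cast (Real.sqrt_pos.2 (hω i)).ne'
    have := congrFun h0 i
    simpa [h1] using this
  · ext i
    rw [weightConj_mulVec hω, h]
    simp
    ring

theorem isEigenvalue_of_weightConj {ω : ι → ℝ} (hω : ∀ i, 0 < ω i) {M : Matrix ι ι ℂ} {z : ℂ}
    (h : IsEigenvalue (weightConj ω M) z) : IsEigenvalue M z := by
  obtain ⟨u, hu, h⟩ := h
  have hs : ∀ i, ((√(ω i) : ℝ) : ℂ) ≠ 0 := fun i => by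
    exact_mod_cast (Real.sqrt_pos.2 (hω i)).ne'
  have hu' : u = fun j => ((√(ω j) : ℝ) : ℂ) * (u j / ((√(ω j) : ℝ) : ℂ)) := by
    ext j; rw [mul_div_cancel₀ _ (hs j)]
  refine ⟨fun j => u j / ((√(ω j) : ℝ) : ℂ), ?_, ?_⟩
  · intro h0
    apply hu
    ext i
    have := congrFun h0 i
    simpa [hs i] using this
  · ext i
    have := congrFun h i
    rw [hu', weightConj_mulVec hω] at this
    apply mul_left_cancel₀ (hs i)
    rw [this]
    simp only [Pi.smul_apply, smul_eq_mul]
    ring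

theorem isHermitian_weightConj {ω : ι → ℝ} (hω : ∀ i, 0 < ω i) {W : Matrix ι ι ℝ}
    (hW : ∀ i j, ω i * W i j = ω j * W j i) : (weightConj ω (toComplex W)).IsHermitian := by
  ext i j
  rw [conjTranspose_apply, weightConj_apply, weightConj_apply]
  have hi := (Real.sqrt_pos.2 (hω i)).ne'
  have hj := (Real.sqrt_pos.2 (hω j)).ne'
  have : √(ω j) * W j i * (√(ω i))⁻¹ = √(ω i) * W i j * (√(ω j))⁻¹ := by
    field_simp
    rw [Real.sq_sqrt (hω i).le, Real.sq_sqrt (hω j).le, hW]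
  simp only [map_apply, Complex.coe_algebraMap, ← Complex.ofReal_mul, Complex.star_def,
    Complex.conj_ofReal, this]

theorem norm_weightConj_le {ω : ι → ℝ} {a κ : ℝ} (ha : 0 < a) (hκ : 0 ≤ κ)
    (hω : ∀ i, a ≤ ω i ∧ ω i ≤ κ ^ 2 * a) (M : Matrix ι ι ℂ) : ‖weightConj ω M‖ ≤ κ * ‖M‖ := by
  have h1 : ‖diagonal (fun i => ((√(ω i) : ℝ) : ℂ))‖ ≤ κ * √a := by
    rw [l2_opNorm_diagonal, pi_norm_le_iff_of_nonneg (by positivity)]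
    intro i
    rw [Complex.norm_real, Real.norm_of_nonneg (Real.sqrt_nonneg _)]
    calc √(ω i) ≤ √(κ ^ 2 * a) := Real.sqrt_le_sqrt (hω i).2
      _ = κ * √a := by rw [Real.sqrt_mul (sq_nonneg κ), Real.sqrt_sq hκ]
  have h2 : ‖diagonal (fun i => (((√(ω i))⁻¹ : ℝ) : ℂ))‖ ≤ (√a)⁻¹ := by
    rw [l2_opNorm_diagonal, pi_norm_le_iff_of_nonneg (by positivity)]
    intro i
    rw [Complex.norm_real, Real.norm_of_nonneg (by positivity)]
    exact inv_anti₀ (Real.sqrt_pos.2 ha) (Real.sqrt_le_sqrt (hω i).1)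
  have hs : 0 < √a := Real.sqrt_pos.2 ha
  calc ‖weightConj ω M‖ ≤ κ * √a * ‖M‖ * (√a)⁻¹ := by
        refine (norm_mul_le _ _).trans ?_
        gcongr
        refine (norm_mul_le _ _).trans ?_
        gcongr
    _ = κ * ‖M‖ := by field_simp

/-- The eigenvalues of a perturbation of a matrix that is self-adjoint for the weights `ω`. -/
theorem exists_eigenvalue_near {W : Matrix ι ι ℝ} {E : Matrix ι ι ℂ} {ω : ι → ℝ} {a κ : ℝ}
    (ha : 0 < a) (hκ : 0 ≤ κ) (hω : ∀ i, a ≤ ω i ∧ ω i ≤ κ ^ 2 * a)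
    (hW : ∀ i j, ω i * W i j = ω j * W j i) {z : ℂ} (hz : IsEigenvalue (toComplex W + E) z) :
    ∃ h : ℝ, (∃ v : ι → ℝ, v ≠ 0 ∧ W *ᵥ v = h • v) ∧ ‖z - h‖ ≤ κ * ‖E‖ := by
  have hpos : ∀ i, 0 < ω i := fun i => ha.trans_le (hω i).1
  have h1 := hz.weightConj hpos
  rw [weightConj_add] at h1
  obtain ⟨h, hh, hle⟩ := exists_eigenvalue_near_of_isHermitian (isHermitian_weightConj hpos hW) h1
  exact ⟨h, exists_real_eigenvector (isEigenvalue_of_weightConj hpos hh),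
    hle.trans (norm_weightConj_le ha hκ hω E)⟩

/-- Second-order expansion of an eigenvalue, for a matrix that is self-adjoint for the weights
`ω`. -/
theorem norm_eigenvalue_sub_weighted_first_order_le {W : Matrix ι ι ℝ} {E : Matrix ι ι ℝ}
    {ω : ι → ℝ} {a κ : ℝ} (ha : 0 < a) (hκ : 0 ≤ κ) (hω : ∀ i, a ≤ ω i ∧ ω i ≤ κ ^ 2 * a)
    (hW : ∀ i j, ω i * W i j = ω j * W j i) {z : ℂ}
    (hz : IsEigenvalue (toComplex W + toComplex E) z)
    {y : ι → ℝ} {l N : ℝ} (hy : W *ᵥ y = l • y) (hN : N = ∑ i, ω i * y i ^ 2) (hNpos : 0 < N)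
    {d : ℝ} (hd : 0 < d)
    (hgap : ∀ (h : ℝ) (v : ι → ℝ), v ≠ 0 →
      (W - (l / N) • vecMulVec y (fun i => ω i * y i)) *ᵥ v = h • v → d ≤ ‖z - h‖)
    {g : ℝ} (hg : κ * ‖toComplex E‖ ≤ g) (hgd : 4 * g ≤ d) :
    ‖z - l - ((∑ i, ω i * y i * (E *ᵥ y) i) / N : ℝ)‖ ≤ 4 * g ^ 2 / d := by
  have hpos : ∀ i, 0 < ω i := fun i => ha.trans_le (hω i).1
  have hs : ∀ i, √(ω i) ≠ 0 := fun i => (Real.sqrt_pos.2 (hpos i)).ne'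
  have hsN : √N ≠ 0 := (Real.sqrt_pos.2 hNpos).ne'
  set e : ι → ℂ := fun i => ((√(ω i) : ℝ) : ℂ) * ((y i / √N : ℝ) : ℂ) with he
  have hW' : (toComplex W) *ᵥ (fun i => ((y i / √N : ℝ) : ℂ)) =
      (l : ℂ) • fun i => ((y i / √N : ℝ) : ℂ) := by
    ext i
    have := congrFun hy i
    simp only [mulVec, dotProduct, Pi.smul_apply, smul_eq_mul] at this
    simp only [mulVec, dotProduct, map_apply, Complex.coe_algebraMap, ← Complex.ofReal_mul,
      ← Complex.ofReal_sum, Pi.smul_apply, smul_eq_mul]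
    congr 1
    rw [← mul_div_assoc, ← this, Finset.sum_div]
    exact Finset.sum_congr rfl fun j _ => by rw [mul_div_assoc]
  have he1 : weightConj ω (toComplex W) *ᵥ e = (l : ℂ) • e := by
    ext i
    rw [he, weightConj_mulVec hpos, hW']
    simp only [Pi.smul_apply, smul_eq_mul]
    ring
  have he2 : ‖WithLp.toLp 2 e‖ = 1 := by
    rw [EuclideanSpace.norm_eq]
    have : ∑ i, ‖(WithLp.toLp 2 e).ofLp i‖ ^ 2 = 1 := by
      have h1 : ∀ i, ‖(WithLp.toLp 2 e).ofLp i‖ ^ 2 = ω i * y i ^ 2 / N := by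
        intro i
        simp only [he, norm_mul, Complex.norm_real, Real.norm_eq_abs, mul_pow, sq_abs, div_pow,
          Real.sq_sqrt (hpos i).le, Real.sq_sqrt hNpos.le]
        ring
      rw [Finset.sum_congr rfl fun i _ => h1 i, ← Finset.sum_div, ← hN, div_self hNpos.ne']
    rw [this, Real.sqrt_one]
  have h1 := hz.weightConj hpos
  rw [weightConj_add] at h1
  have hdefl : weightConj ω (toComplex W) - (l : ℂ) • vecMulVec e (star e) =
      weightConj ω (toComplex (W - (l / N) • vecMulVec y (fun i => ω i * y i))) := by
    ext i j
    rw [Matrix.sub_apply, Matrix.smul_apply, weightConj_apply, weightConj_apply, vecMulVec_apply]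
    simp only [he, Pi.star_apply, Complex.star_def, Complex.conj_ofReal, map_apply,
      Complex.coe_algebraMap, smul_eq_mul, ← Complex.ofReal_mul, ← Complex.ofReal_sub]
    congr 1
    simp only [Matrix.sub_apply, Matrix.smul_apply, vecMulVec_apply, smul_eq_mul]
    have h3 := hs j
    have h4 := Real.sq_sqrt (hpos j).le
    have h5 := Real.sq_sqrt hNpos.le
    have h6 : √(ω i) * (y i / √N) * (√(ω j) * (y j / √N)) =
        √(ω i) * y i * √(ω j) * y j / N := by
      conv_rhs => rw [← h5]
      field_simp
    rw [h6]
    have h7 : ω j * (√(ω j))⁻¹ = √(ω j) := by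
      rw [← div_eq_mul_inv, Real.div_sqrt]
    have h8 : √(ω i) * (W i j - l / N * (y i * (ω j * y j))) * (√(ω j))⁻¹ =
      √(ω i) * W i j * (√(ω j))⁻¹ - √(ω i) * (l / N * (y i * ((ω j * (√(ω j))⁻¹) * y j))) := by ring
    rw [h8, h7]
    ring
  have hfirst : star e ⬝ᵥ (weightConj ω (toComplex E) *ᵥ e) =
      ((∑ i, ω i * y i * (E *ᵥ y) i) / N : ℝ) := by
    simp only [dotProduct]
    rw [Finset.sum_div, Complex.ofReal_sum]
    refine Finset.sum_congr rfl fun i _ => ?_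
    rw [he, weightConj_mulVec hpos]
    simp only [Pi.star_apply, Complex.star_def, Complex.conj_ofReal, mulVec, dotProduct,
      map_apply, Complex.coe_algebraMap, ← Complex.ofReal_mul, ← Complex.ofReal_sum]
    congr 1
    have h4 : ω i = √(ω i) * √(ω i) := (Real.mul_self_sqrt (hpos i).le).symm
    have h5 : N = √N * √N := (Real.mul_self_sqrt hNpos.le).symm
    have h6 : ∑ j, E i j * (y j / √N) = (∑ j, E i j * y j) / √N := by
      rw [Finset.sum_div]
      exact Finset.sum_congr rfl fun j _ => by rw [mul_div_assoc]
    rw [h6]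
    conv_rhs => rw [h4, h5]
    field_simp
  rw [← hfirst]
  refine norm_eigenvalue_sub_first_order_le (isHermitian_weightConj hpos hW) h1 he1 he2 hd ?_
    ((norm_weightConj_le ha hκ hω _).trans hg) hgd
  intro h hh
  rw [hdefl] at hh
  obtain ⟨v, hv, hv'⟩ := exists_real_eigenvector (isEigenvalue_of_weightConj hpos hh)
  exact hgap h v hv hv'

end Weighted

/-! ### The learning matrix of a block matrix -/

section Block

open Matrix

/-- The matrix with entries `M i j * f j`, normalized to have row sums `1`. -/
noncomputable def rowNormalized {n : ℕ} (M : Matrix (Fin n) (Fin n) ℝ) (f : Fin n → ℝ) :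
    Matrix (Fin n) (Fin n) ℝ :=
  Matrix.of fun i j => M i j * f j / ∑ k, M i k * f k

/-- The expected adjacency matrix, rescaled to have entries `ρ` within a group and `1` between
different groups. -/
def blockMatrix {n m : ℕ} (grp : Fin n → Fin m) (ρ : ℝ) : Matrix (Fin n) (Fin n) ℝ :=
  Matrix.of fun i j => linkProb ρ 1 (grp i) (grp j)

/-- The vector with entries `a` on the first group and `b` on all the others. -/
def blockVec {n m : ℕ} (grp : Fin n → Fin m) (a b : ℝ) (i : Fin n) : ℝ :=
  if (grp i).val = 0 then a else b

/-- Degree weights of the expected network, normalized to be `1` outside the first group. They are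
parametrized by the ratio `x` of the total weight of the first group and that of any other group. -/
noncomputable def blockWeight {n m : ℕ} (grp : Fin n → Fin m) (n₁ n₂ : ℕ) (x : ℝ) : Fin n → ℝ :=
  blockVec grp (n₂ * x / n₁) 1

/-- The normalized weighted degree `ρ x + (m - 1)` of a vertex of the first group. -/
def rowOne (m : ℕ) (ρ x : ℝ) : ℝ := ρ * x + (m - 1)

/-- The normalized weighted degree `x + ρ + (m - 2)` of a vertex outside the first group. -/
def rowTwo (m : ℕ) (ρ x : ℝ) : ℝ := x + ρ + (m - 2)

/-- The eigenvalue, of multiplicity `m - 2`, whose eigenvectors live on the groups of equal size. -/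
noncomputable def lamA (m : ℕ) (ρ x : ℝ) : ℝ := (ρ - 1) / rowTwo m ρ x

/-- The eigenvalue that separates the first group from the others. -/
noncomputable def lamB (m : ℕ) (ρ x : ℝ) : ℝ :=
  (ρ - 1) * (ρ + (m - 1)) * x / (rowOne m ρ x * rowTwo m ρ x)

/-- The value on the first group of the eigenvector of `lamB`. -/
def eigOne (m : ℕ) (ρ x : ℝ) : ℝ := (m - 1) * rowTwo m ρ x

/-- The value outside the first group of the eigenvector of `lamB`. -/
def eigTwo (m : ℕ) (ρ x : ℝ) : ℝ := -(x * rowOne m ρ x)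

/-- The reversing measure of the learning matrix of the block matrix, up to a factor. -/
noncomputable def revWeight {n m : ℕ} (grp : Fin n → Fin m) (n₁ n₂ : ℕ) (ρ x : ℝ) : Fin n → ℝ :=
  blockVec grp (n₂ * x / n₁ * (n₂ * rowOne m ρ x)) (n₂ * rowTwo m ρ x)

/-- The stationary distribution of the learning matrix of the block matrix. -/
noncomputable def statDist {n m : ℕ} (grp : Fin n → Fin m) (n₁ n₂ : ℕ) (ρ x : ℝ) : Fin n → ℝ :=
  fun i => revWeight grp n₁ n₂ ρ x i / ∑ j, revWeight grp n₁ n₂ ρ x j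

/-- The learning matrix of the block matrix, with the eigenvalue `1` deflated. -/
noncomputable def blockDeflated {n m : ℕ} (grp : Fin n → Fin m) (n₁ n₂ : ℕ) (ρ x : ℝ) :
    Matrix (Fin n) (Fin n) ℝ :=
  rowNormalized (blockMatrix grp ρ) (blockWeight grp n₁ n₂ x) -
    vecMulVec 1 (statDist grp n₁ n₂ ρ x)

theorem rowNormalized_smul_left {n : ℕ} (M : Matrix (Fin n) (Fin n) ℝ) (f : Fin n → ℝ) {c : ℝ}
    (hc : c ≠ 0) : rowNormalized (c • M) f = rowNormalized M f := by
  ext i j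
  simp only [rowNormalized, of_apply, Matrix.smul_apply, smul_eq_mul, mul_assoc, ← Finset.mul_sum]
  rw [mul_div_mul_left _ _ hc]

theorem rowNormalized_smul_right {n : ℕ} (M : Matrix (Fin n) (Fin n) ℝ) (f : Fin n → ℝ) {c : ℝ}
    (hc : c ≠ 0) : rowNormalized M (fun j => c * f j) = rowNormalized M f := by
  ext i j
  simp only [rowNormalized, of_apply, mul_left_comm _ c, ← Finset.mul_sum]
  rw [mul_div_mul_left _ _ hc]

theorem rowNormalized_row_sum {n : ℕ} {M : Matrix (Fin n) (Fin n) ℝ} {f : Fin n → ℝ} (i : Fin n)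
    (h : ∑ k, M i k * f k ≠ 0) : ∑ j, rowNormalized M f i j = 1 := by
  simp only [rowNormalized, of_apply, ← Finset.sum_div]
  exact div_self h

theorem rowNormalized_nonneg {n : ℕ} {M : Matrix (Fin n) (Fin n) ℝ} {f : Fin n → ℝ}
    (hM : ∀ i j, 0 ≤ M i j) (hf : ∀ j, 0 ≤ f j) (i j : Fin n) : 0 ≤ rowNormalized M f i j := by
  simp only [rowNormalized, of_apply]
  exact div_nonneg (mul_nonneg (hM i j) (hf j))
    (Finset.sum_nonneg fun k _ => mul_nonneg (hM i k) (hf k))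

theorem sum_fin_ite_zero {m : ℕ} (hm : 2 ≤ m) (a b : ℝ) :
    ∑ k : Fin m, (if k.val = 0 then a else b) = a + (m - 1) * b := by
  obtain ⟨k, rfl⟩ : ∃ k, m = k + 1 := ⟨m - 1, by omega⟩
  rw [Fin.sum_univ_succ]
  simp

variable {n m : ℕ} {grp : Fin n → Fin m} {n₁ n₂ : ℕ} {ρ x : ℝ}

theorem blockMatrix_symm (i j : Fin n) : blockMatrix grp ρ i j = blockMatrix grp ρ j i := by
  simp only [blockMatrix, of_apply, linkProb, eq_comm]

theorem blockMatrix_pos (hρ : 0 < ρ) (i j : Fin n) : 0 < blockMatrix grp ρ i j := by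
  simp only [blockMatrix, of_apply, linkProb]
  split_ifs <;> positivity

theorem blockVec_pos {a b : ℝ} (ha : 0 < a) (hb : 0 < b) (i : Fin n) : 0 < blockVec grp a b i := by
  simp only [blockVec]; split_ifs <;> assumption

theorem blockVec_mul (a b c d : ℝ) (i : Fin n) :
    blockVec grp a b i * blockVec grp c d i = blockVec grp (a * c) (b * d) i := by
  simp only [blockVec]; split_ifs <;> rfl

theorem sum_filter_blockVec (hg : HasGroupSizes grp n₁ n₂) (a b : ℝ) (k : Fin m) :
    ∑ j with grp j = k, blockVec grp a b j = if k.val = 0 then n₁ * a else n₂ * b := by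
  have h1 : ∀ j ∈ Finset.univ.filter (fun j => grp j = k), blockVec grp a b j =
      if k.val = 0 then a else b := by
    intro j hj
    rw [← (Finset.mem_filter.1 hj).2]; rfl
  rw [Finset.sum_congr rfl h1, Finset.sum_const, nsmul_eq_mul]
  have h2 := hg k
  unfold groupSize at h2
  rw [h2]
  split_ifs <;> rfl

theorem sum_blockVec (hm : 2 ≤ m) (hg : HasGroupSizes grp n₁ n₂) (a b : ℝ) :
    ∑ j, blockVec grp a b j = n₁ * a + (m - 1) * (n₂ * b) := by
  rw [← Finset.sum_fiberwise Finset.univ grp, Finset.sum_congr rfl fun k _ =>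
    sum_filter_blockVec hg a b k, sum_fin_ite_zero hm]

theorem sum_blockMatrix_mul (v : Fin n → ℝ) (i : Fin n) :
    ∑ j, blockMatrix grp ρ i j * v j = ∑ j, v j + (ρ - 1) * ∑ j with grp j = grp i, v j := by
  rw [Finset.mul_sum, Finset.sum_filter, ← Finset.sum_add_distrib]
  refine Finset.sum_congr rfl fun j _ => ?_
  simp only [blockMatrix, of_apply, linkProb, eq_comm (a := grp i)]
  split_ifs <;> ring

theorem sum_blockMatrix_mul_blockVec (hm : 2 ≤ m) (hg : HasGroupSizes grp n₁ n₂) (a b : ℝ)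
    (i : Fin n) : ∑ j, blockMatrix grp ρ i j * blockVec grp a b j =
      blockVec grp (ρ * (n₁ * a) + (m - 1) * (n₂ * b)) (n₁ * a + (ρ + (m - 2)) * (n₂ * b)) i := by
  rw [sum_blockMatrix_mul, sum_filter_blockVec hg, sum_blockVec hm hg]
  simp only [blockVec]
  split_ifs <;> ring

/-- The standing assumptions on the group sizes, the ratio `ρ` of the densities, and the ratio `x`
of the weights of the groups. -/
structure BlockData {n m : ℕ} (grp : Fin n → Fin m) (n₁ n₂ : ℕ) (ρ x : ℝ) : Prop where
  two_le : 2 ≤ m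
  sizes : HasGroupSizes grp n₁ n₂
  n₁_pos : 0 < n₁
  n₂_pos : 0 < n₂
  ρ_pos : 0 < ρ
  x_pos : 0 < x

namespace BlockData

variable (D : BlockData grp n₁ n₂ ρ x)
include D

theorem one_le_m_sub_one : (1 : ℝ) ≤ m - 1 := by
  have : (2 : ℝ) ≤ m := by exact_mod_cast D.two_le
  linarith

theorem rowOne_pos : 0 < rowOne m ρ x := by
  have := D.one_le_m_sub_one
  have := D.ρ_pos
  have := D.x_pos
  unfold rowOne; positivity

theorem rowTwo_pos : 0 < rowTwo m ρ x := by
  have := D.one_le_m_sub_one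
  have := D.ρ_pos
  have := D.x_pos
  unfold rowTwo; linarith

theorem n₁_pos' : (0 : ℝ) < n₁ := by exact_mod_cast D.n₁_pos

theorem n₂_pos' : (0 : ℝ) < n₂ := by exact_mod_cast D.n₂_pos

theorem weight_mul : (n₁ : ℝ) * (n₂ * x / n₁) = n₂ * x := by
  have := D.n₁_pos'.ne'
  field_simp

theorem blockWeight_pos (i : Fin n) : 0 < blockWeight grp n₁ n₂ x i := by
  have := D.n₁_pos'
  have := D.n₂_pos'
  have := D.x_pos
  exact blockVec_pos (by positivity) one_pos i

theorem row_sum (i : Fin n) : ∑ j, blockMatrix grp ρ i j * blockWeight grp n₁ n₂ x j =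
    blockVec grp (n₂ * rowOne m ρ x) (n₂ * rowTwo m ρ x) i := by
  unfold blockWeight
  rw [sum_blockMatrix_mul_blockVec D.two_le D.sizes, D.weight_mul]
  congr 1
  · unfold rowOne; ring
  · unfold rowTwo; ring

theorem row_sum_pos (i : Fin n) : 0 < ∑ j, blockMatrix grp ρ i j * blockWeight grp n₁ n₂ x j := by
  rw [D.row_sum]
  have := D.n₂_pos'
  have := D.rowOne_pos
  have := D.rowTwo_pos
  exact blockVec_pos (by positivity) (by positivity) i

theorem revWeight_eq (i : Fin n) : revWeight grp n₁ n₂ ρ x i = blockWeight grp n₁ n₂ x i *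
    ∑ j, blockMatrix grp ρ i j * blockWeight grp n₁ n₂ x j := by
  rw [D.row_sum, blockWeight, blockVec_mul, one_mul]; rfl

theorem revWeight_pos (i : Fin n) : 0 < revWeight grp n₁ n₂ ρ x i := by
  rw [D.revWeight_eq]
  exact mul_pos (D.blockWeight_pos i) (D.row_sum_pos i)

theorem n_pos : 0 < n := by
  have h := D.sizes ⟨0, by have := D.two_le; omega⟩
  simp only [groupSize, if_true] at h
  have h1 : 0 < (Finset.univ.filter fun i => grp i = ⟨0, by have := D.two_le; omega⟩).card := by
    rw [h]; exact D.n₁_pos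
  obtain ⟨i, -⟩ := Finset.card_pos.1 h1
  exact i.pos

theorem two_le_n : 2 ≤ n := by
  have hm := D.two_le
  have hn1 := D.n₁_pos
  have hn2 := D.n₂_pos
  have h := sum_blockVec D.two_le D.sizes 1 1
  simp only [blockVec, ite_self, Finset.sum_const, Finset.card_univ, Fintype.card_fin, nsmul_eq_mul,
    mul_one] at h
  have h1 : (1 : ℝ) ≤ n₁ := by exact_mod_cast hn1
  have h2 : (1 : ℝ) ≤ n₂ := by exact_mod_cast hn2
  have h3 := D.one_le_m_sub_one
  have : (2 : ℝ) ≤ n := by nlinarith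
  exact_mod_cast this

theorem sum_revWeight_pos : 0 < ∑ i, revWeight grp n₁ n₂ ρ x i :=
  Finset.sum_pos (fun i _ => D.revWeight_pos i) ⟨⟨0, D.n_pos⟩, Finset.mem_univ _⟩

theorem sum_statDist : ∑ i, statDist grp n₁ n₂ ρ x i = 1 := by
  unfold statDist
  rw [← Finset.sum_div, div_self D.sum_revWeight_pos.ne']

theorem revWeight_mul_rowNormalized (i j : Fin n) : revWeight grp n₁ n₂ ρ x i *
    rowNormalized (blockMatrix grp ρ) (blockWeight grp n₁ n₂ x) i j =
      blockWeight grp n₁ n₂ x i * blockMatrix grp ρ i j * blockWeight grp n₁ n₂ x j := by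
  rw [D.revWeight_eq]
  simp only [rowNormalized, of_apply]
  have := (D.row_sum_pos i).ne'
  field_simp

/-- Reversibility: the deflated matrix is self-adjoint for the weights `revWeight`. -/
theorem reversible (i j : Fin n) : revWeight grp n₁ n₂ ρ x i * blockDeflated grp n₁ n₂ ρ x i j =
    revWeight grp n₁ n₂ ρ x j * blockDeflated grp n₁ n₂ ρ x j i := by
  simp only [blockDeflated, Matrix.sub_apply, mul_sub, D.revWeight_mul_rowNormalized, vecMulVec_apply,
    Pi.one_apply, one_mul, statDist]
  rw [blockMatrix_symm]
  ring

theorem blockDeflated_row_sum (i : Fin n) : ∑ j, blockDeflated grp n₁ n₂ ρ x i j = 0 := by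
  simp only [blockDeflated, Matrix.sub_apply, Finset.sum_sub_distrib, vecMulVec_apply,
    Pi.one_apply, one_mul]
  rw [rowNormalized_row_sum i (D.row_sum_pos i).ne', D.sum_statDist, sub_self]

theorem sum_revWeight_mul_mulVec (y v : Fin n → ℝ) :
    ∑ i, revWeight grp n₁ n₂ ρ x i * y i * (blockDeflated grp n₁ n₂ ρ x *ᵥ v) i =
      ∑ i, revWeight grp n₁ n₂ ρ x i * (blockDeflated grp n₁ n₂ ρ x *ᵥ y) i * v i := by
  simp only [mulVec, dotProduct, Finset.mul_sum, Finset.sum_mul]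
  rw [Finset.sum_comm]
  refine Finset.sum_congr rfl fun i _ => Finset.sum_congr rfl fun j _ => ?_
  linear_combination y j * v i * D.reversible j i

theorem blockDeflated_mulVec (v : Fin n → ℝ) (i : Fin n) :
    (blockDeflated grp n₁ n₂ ρ x *ᵥ v) i =
      (∑ j, blockMatrix grp ρ i j * (blockWeight grp n₁ n₂ x j * v j)) /
        blockVec grp (n₂ * rowOne m ρ x) (n₂ * rowTwo m ρ x) i -
      (∑ j, revWeight grp n₁ n₂ ρ x j * v j) / ∑ j, revWeight grp n₁ n₂ ρ x j := by
  simp only [blockDeflated, sub_mulVec, Pi.sub_apply]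
  congr 1
  · simp only [mulVec, dotProduct, rowNormalized, of_apply, ← D.row_sum, Finset.sum_div]
    exact Finset.sum_congr rfl fun j _ => by ring
  · simp only [vecMulVec_mulVec, dotProduct, statDist]
    simp [Finset.sum_div]
    exact Finset.sum_congr rfl fun j _ => by ring

theorem sum_revWeight_blockVec (a b : ℝ) :
    ∑ i, revWeight grp n₁ n₂ ρ x i * blockVec grp a b i =
      n₂ ^ 2 * (x * rowOne m ρ x * a + (m - 1) * rowTwo m ρ x * b) := by
  simp only [revWeight, blockVec_mul]
  rw [sum_blockVec D.two_le D.sizes]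
  have := D.n₁_pos'.ne'
  field_simp

theorem lamB_mul_rowOne : lamB m ρ x * rowOne m ρ x * eigOne m ρ x =
    ρ * x * eigOne m ρ x + (m - 1) * eigTwo m ρ x := by
  have h1 := D.rowOne_pos.ne'
  have h2 := D.rowTwo_pos.ne'
  rw [lamB, div_mul_eq_mul_div, div_mul_eq_mul_div, div_eq_iff (mul_ne_zero h1 h2)]
  simp only [eigOne, eigTwo, rowOne, rowTwo]
  ring

theorem lamB_mul_rowTwo : lamB m ρ x * rowTwo m ρ x * eigTwo m ρ x =
    x * eigOne m ρ x + (ρ + (m - 2)) * eigTwo m ρ x := by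
  have h1 := D.rowOne_pos.ne'
  have h2 := D.rowTwo_pos.ne'
  rw [lamB, div_mul_eq_mul_div, div_mul_eq_mul_div, div_eq_iff (mul_ne_zero h1 h2)]
  simp only [eigOne, eigTwo, rowOne, rowTwo]
  ring

theorem sum_blockMatrix_mul_eig (i : Fin n) :
    ∑ j, blockMatrix grp ρ i j *
      (blockWeight grp n₁ n₂ x j * blockVec grp (eigOne m ρ x) (eigTwo m ρ x) j) =
    lamB m ρ x * (blockVec grp (n₂ * rowOne m ρ x) (n₂ * rowTwo m ρ x) i *
      blockVec grp (eigOne m ρ x) (eigTwo m ρ x) i) := by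
  simp only [blockWeight, blockVec_mul]
  rw [sum_blockMatrix_mul_blockVec D.two_le D.sizes]
  have h0 : (n₁ : ℝ) * (n₂ * x / n₁ * eigOne m ρ x) = n₂ * x * eigOne m ρ x := by
    rw [← mul_assoc, D.weight_mul]
  have h1 := D.lamB_mul_rowOne
  have h2 := D.lamB_mul_rowTwo
  rw [h0]
  simp only [blockVec]
  split_ifs
  · linear_combination -(n₂ : ℝ) * h1
  · linear_combination -(n₂ : ℝ) * h2

theorem mulVec_eig : blockDeflated grp n₁ n₂ ρ x *ᵥ blockVec grp (eigOne m ρ x) (eigTwo m ρ x) =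
    lamB m ρ x • blockVec grp (eigOne m ρ x) (eigTwo m ρ x) := by
  ext i
  have hpos : blockVec grp (n₂ * rowOne m ρ x) (n₂ * rowTwo m ρ x) i ≠ 0 := by
    rw [← D.row_sum]; exact (D.row_sum_pos i).ne'
  have h0 : x * rowOne m ρ x * eigOne m ρ x + (m - 1) * rowTwo m ρ x * eigTwo m ρ x = 0 := by
    simp only [eigOne, eigTwo]; ring
  rw [D.blockDeflated_mulVec, D.sum_revWeight_blockVec, h0, mul_zero, zero_div, sub_zero,
    D.sum_blockMatrix_mul_eig, Pi.smul_apply, smul_eq_mul, mul_div_assoc,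
    mul_div_cancel_left₀ _ hpos]

theorem eigOne_pos : 0 < eigOne m ρ x := mul_pos (by linarith [D.one_le_m_sub_one]) D.rowTwo_pos

theorem eigTwo_neg : eigTwo m ρ x < 0 := neg_neg_of_pos (mul_pos D.x_pos D.rowOne_pos)

theorem eig_ne_zero (i : Fin n) : blockVec grp (eigOne m ρ x) (eigTwo m ρ x) i ≠ 0 := by
  simp only [blockVec]
  split_ifs
  · exact D.eigOne_pos.ne'
  · exact D.eigTwo_neg.ne

/-- An eigenvector of the deflated matrix for an eigenvalue other than `0` and (if `m ≥ 3`) `lamA`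
is a multiple of the eigenvector of `lamB`. -/
theorem eigenvector_cases {h : ℝ} (h0 : h ≠ 0) {v : Fin n → ℝ}
    (hv : blockDeflated grp n₁ n₂ ρ x *ᵥ v = h • v) :
    (∃ c : ℝ, v = c • blockVec grp (eigOne m ρ x) (eigTwo m ρ x)) ∨ (3 ≤ m ∧ h = lamA m ρ x) := by
  -- the eigenvector is orthogonal to the constants, so that the deflation does not act on it
  have horth : ∑ j, revWeight grp n₁ n₂ ρ x j * v j = 0 := by
    have h1 := D.sum_revWeight_mul_mulVec 1 v
    have h2 : blockDeflated grp n₁ n₂ ρ x *ᵥ 1 = 0 := by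
      ext i
      simp only [mulVec, dotProduct, Pi.one_apply, mul_one, Pi.zero_apply]
      exact D.blockDeflated_row_sum i
    rw [h2, hv] at h1
    simp only [Pi.one_apply, mul_one, Pi.smul_apply, smul_eq_mul, Pi.zero_apply, mul_zero, zero_mul,
      Finset.sum_const_zero] at h1
    have h3 : h * ∑ j, revWeight grp n₁ n₂ ρ x j * v j = 0 := by
      rw [Finset.mul_sum, ← h1]
      exact Finset.sum_congr rfl fun j _ => by ring
    exact (mul_eq_zero.1 h3).resolve_left h0
  set w : Fin n → ℝ := fun j => blockWeight grp n₁ n₂ x j * v j with hw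
  set s := ∑ j, w j with hs
  have heq : ∀ i, h * blockVec grp (n₂ * rowOne m ρ x) (n₂ * rowTwo m ρ x) i * v i =
      s + (ρ - 1) * ∑ j with grp j = grp i, w j := by
    intro i
    have h1 := congrFun hv i
    have hpos : blockVec grp (n₂ * rowOne m ρ x) (n₂ * rowTwo m ρ x) i ≠ 0 := by
      rw [← D.row_sum]; exact (D.row_sum_pos i).ne'
    rw [D.blockDeflated_mulVec, horth, zero_div, sub_zero, div_eq_iff hpos,
      sum_blockMatrix_mul w] at h1
    rw [h1, Pi.smul_apply, smul_eq_mul]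
    ring
  have hR1 := D.rowOne_pos
  have hR2 := D.rowTwo_pos
  have hn2 := D.n₂_pos'
  -- hence it is constant on the groups
  have hconst : ∀ i j, grp i = grp j → v i = v j := by
    intro i j hij
    have h1 := heq i
    have h2 := heq j
    have h3 : blockVec grp (n₂ * rowOne m ρ x) (n₂ * rowTwo m ρ x) i =
      blockVec grp (n₂ * rowOne m ρ x) (n₂ * rowTwo m ρ x) j := by simp only [blockVec, hij]
    have hpos : 0 < blockVec grp (n₂ * rowOne m ρ x) (n₂ * rowTwo m ρ x) j :=
      blockVec_pos (by positivity) (by positivity) j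
    rw [hij, ← h2, h3] at h1
    exact mul_left_cancel₀ (mul_ne_zero h0 hpos.ne') h1
  have htwo : ∀ i, (grp i).val ≠ 0 →
      (h * rowTwo m ρ x - (ρ - 1)) * (n₂ * v i) = s := by
    intro i hi
    have h1 := heq i
    have h2 : ∑ j with grp j = grp i, w j = n₂ * v i := by
      have h3 : ∀ j ∈ Finset.univ.filter (fun j => grp j = grp i), w j = v i := by
        intro j hj
        have hj' := (Finset.mem_filter.1 hj).2
        simp only [hw, blockWeight, blockVec, hj', if_neg hi, one_mul]
        exact hconst j i hj'
      rw [Finset.sum_congr rfl h3, Finset.sum_const, nsmul_eq_mul]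
      have h4 := D.sizes (grp i)
      unfold groupSize at h4
      rw [h4, if_neg hi]
    rw [h2] at h1
    simp only [blockVec, if_neg hi] at h1
    linear_combination h1
  by_cases hA : 3 ≤ m ∧ h = lamA m ρ x
  · exact Or.inr hA
  left
  have hsame : ∀ i j, (grp i).val ≠ 0 → (grp j).val ≠ 0 → v i = v j := by
    intro i j hi hj
    by_cases hm3 : 3 ≤ m
    · have hne : h ≠ lamA m ρ x := fun h' => hA ⟨hm3, h'⟩
      have hne' : h * rowTwo m ρ x - (ρ - 1) ≠ 0 := by
        intro h'
        apply hne
        rw [lamA, eq_div_iff hR2.ne']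
        linarith
      have h1 := (htwo i hi).trans (htwo j hj).symm
      exact mul_left_cancel₀ hn2.ne' (mul_left_cancel₀ hne' h1)
    · apply hconst
      have := (grp i).isLt
      have := (grp j).isLt
      exact Fin.ext (by omega)
  have hm := D.two_le
  have hne_grp : ∀ k : Fin m, ∃ i, grp i = k := by
    intro k
    have h1 := D.sizes k
    unfold groupSize at h1
    have h2 : 0 < (Finset.univ.filter fun i => grp i = k).card := by
      rw [h1]; split_ifs
      · exact D.n₁_pos
      · exact D.n₂_pos
    obtain ⟨i, hi⟩ := Finset.card_pos.1 h2
    exact ⟨i, (Finset.mem_filter.1 hi).2⟩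
  obtain ⟨i0, hi0⟩ := hne_grp ⟨0, by omega⟩
  obtain ⟨i1, hi1⟩ := hne_grp ⟨1, by omega⟩
  have hvb : v = blockVec grp (v i0) (v i1) := by
    ext i
    simp only [blockVec]
    split_ifs with hi
    · exact hconst i i0 (by rw [hi0]; exact Fin.ext hi)
    · exact hsame i i1 hi (by rw [hi1]; simp)
  rw [hvb, D.sum_revWeight_blockVec] at horth
  have hcomb := (mul_eq_zero.1 horth).resolve_left (by positivity)
  have hE1 := D.eigOne_pos
  refine ⟨v i0 / eigOne m ρ x, ?_⟩
  ext i
  rw [show v i = blockVec grp (v i0) (v i1) i from congrFun hvb i]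
  simp only [Pi.smul_apply, smul_eq_mul, blockVec]
  split_ifs
  · field_simp
  · rw [div_mul_eq_mul_div, eq_div_iff hE1.ne']
    simp only [eigOne, eigTwo]
    linear_combination hcomb

theorem eigenvalue_cases {h : ℝ} {v : Fin n → ℝ} (hv0 : v ≠ 0)
    (hv : blockDeflated grp n₁ n₂ ρ x *ᵥ v = h • v) :
    h = 0 ∨ h = lamB m ρ x ∨ (3 ≤ m ∧ h = lamA m ρ x) := by
  by_cases h0 : h = 0
  · exact Or.inl h0
  rcases D.eigenvector_cases h0 hv with ⟨c, rfl⟩ | hA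
  · right; left
    obtain ⟨i, hi⟩ := Function.ne_iff.1 hv0
    rw [mulVec_smul, D.mulVec_eig] at hv
    have h1 := congrFun hv i
    simp only [Pi.smul_apply, smul_eq_mul, Pi.zero_apply] at h1 hi
    have h2 : (lamB m ρ x - h) * (c * blockVec grp (eigOne m ρ x) (eigTwo m ρ x) i) = 0 := by
      linear_combination h1
    have := (mul_eq_zero.1 h2).resolve_right hi
    linarith
  · exact Or.inr (Or.inr hA)

/-- The eigenvalue `lamA` occurs as soon as there are three groups. -/
theorem exists_eigenvector_lamA (hm3 : 3 ≤ m) :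
    ∃ v : Fin n → ℝ, v ≠ 0 ∧ blockDeflated grp n₁ n₂ ρ x *ᵥ v = lamA m ρ x • v := by
  have hn2 := D.n₂_pos'
  have hR2 := D.rowTwo_pos
  set k1 : Fin m := ⟨1, by omega⟩ with hk1
  set k2 : Fin m := ⟨2, by omega⟩ with hk2
  have h12 : k1 ≠ k2 := by simp [hk1, hk2]
  set c : Fin m → ℝ := fun k => if k = k1 then 1 else if k = k2 then -1 else 0 with hc
  have hc0 : ∀ k : Fin m, k.val = 0 → c k = 0 := by
    intro k hk
    have h1 : k ≠ k1 := fun h => by rw [h] at hk; simp [hk1] at hk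
    have h2 : k ≠ k2 := fun h => by rw [h] at hk; simp [hk2] at hk
    simp [hc, h1, h2]
  have hfib : ∀ k : Fin m, ∑ j with grp j = k, c (grp j) = n₂ * c k := by
    intro k
    have h3 : ∀ j ∈ Finset.univ.filter (fun j => grp j = k), c (grp j) = c k := fun j hj => by
      rw [(Finset.mem_filter.1 hj).2]
    have h4 := D.sizes k
    unfold groupSize at h4
    rw [Finset.sum_congr rfl h3, Finset.sum_const, nsmul_eq_mul, h4]
    split_ifs with hk
    · rw [hc0 k hk]; simp
    · rfl
  have hsum : ∑ j, c (grp j) = 0 := by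
    rw [← Finset.sum_fiberwise Finset.univ grp, Finset.sum_congr rfl fun k _ => hfib k,
      ← Finset.mul_sum]
    have : ∑ k, c k = 0 := by
      have h5 : ∀ k, c k = (if k = k1 then 1 else 0) + (if k = k2 then -1 else 0) := by
        intro k
        simp only [hc]
        split_ifs with h6 h7
        · exact absurd (h6.symm.trans h7) h12
        · simp
        · simp
        · simp
      rw [Finset.sum_congr rfl fun k _ => h5 k, Finset.sum_add_distrib]
      simp
    rw [this, mul_zero]
  have hmul : ∀ (a b : ℝ) (j : Fin n), blockVec grp a b j * c (grp j) = b * c (grp j) := by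
    intro a b j
    simp only [blockVec]
    split_ifs with hj
    · rw [hc0 _ hj]; simp
    · rfl
  refine ⟨fun j => c (grp j), ?_, ?_⟩
  · intro h0
    have h1 := D.sizes k1
    unfold groupSize at h1
    have h2 : 0 < (Finset.univ.filter fun i => grp i = k1).card := by
      rw [h1, if_neg (by simp [hk1])]
      exact D.n₂_pos
    obtain ⟨i, hi⟩ := Finset.card_pos.1 h2
    have := congrFun h0 i
    simp [(Finset.mem_filter.1 hi).2, hc] at this
  · ext i
    rw [D.blockDeflated_mulVec]
    have h1 : ∀ j, revWeight grp n₁ n₂ ρ x j * c (grp j) = n₂ * rowTwo m ρ x * c (grp j) :=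
      fun j => hmul _ _ j
    have h2 : ∀ j, blockWeight grp n₁ n₂ x j * c (grp j) = c (grp j) := fun j => by
      rw [blockWeight, hmul, one_mul]
    rw [Finset.sum_congr rfl fun j _ => h1 j, ← Finset.mul_sum, hsum, mul_zero, zero_div, sub_zero]
    simp only [h2]
    rw [sum_blockMatrix_mul, hsum, hfib, zero_add, Pi.smul_apply, smul_eq_mul]
    simp only [blockVec, lamA]
    split_ifs with hi
    · rw [hc0 _ hi]; simp
    · field_simp

/-- Removing also the eigenvalue `lamB` leaves only `0` and `lamA`. -/
theorem eigenvalue_cases_deflated_twice {N : ℝ}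
    (hN : N = ∑ i, revWeight grp n₁ n₂ ρ x i * blockVec grp (eigOne m ρ x) (eigTwo m ρ x) i ^ 2)
    {h : ℝ} {v : Fin n → ℝ} (hv0 : v ≠ 0)
    (hv : (blockDeflated grp n₁ n₂ ρ x - (lamB m ρ x / N) •
      vecMulVec (blockVec grp (eigOne m ρ x) (eigTwo m ρ x))
        (fun i => revWeight grp n₁ n₂ ρ x i * blockVec grp (eigOne m ρ x) (eigTwo m ρ x) i)) *ᵥ v =
          h • v) :
    h = 0 ∨ (3 ≤ m ∧ h = lamA m ρ x) := by
  by_cases h0 : h = 0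
  · exact Or.inl h0
  right
  set y := blockVec grp (eigOne m ρ x) (eigTwo m ρ x) with hy
  set t := ∑ i, revWeight grp n₁ n₂ ρ x i * y i * v i with ht
  have hNpos : 0 < N := by
    rw [hN]
    refine Finset.sum_pos (fun i _ => ?_) ⟨⟨0, D.n_pos⟩, Finset.mem_univ _⟩
    have := D.revWeight_pos i
    have := D.eig_ne_zero i
    positivity
  have hv' : blockDeflated grp n₁ n₂ ρ x *ᵥ v = h • v + (lamB m ρ x / N * t) • y := by
    rw [← hv, sub_mulVec, smul_mulVec, vecMulVec_mulVec]
    ext i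
    simp only [Pi.add_apply, Pi.sub_apply, Pi.smul_apply, smul_eq_mul, dotProduct,
      MulOpposite.smul_eq_mul_unop, MulOpposite.unop_op, ht]
    ring
  have ht0 : t = 0 := by
    have h1 := D.sum_revWeight_mul_mulVec y v
    rw [hv', D.mulVec_eig] at h1
    simp only [Pi.add_apply, Pi.smul_apply, smul_eq_mul] at h1
    have h2 : ∑ i, revWeight grp n₁ n₂ ρ x i * y i * (h * v i + lamB m ρ x / N * t * y i) =
        h * t + lamB m ρ x / N * t * N := by
      conv_rhs => rw [ht, hN, Finset.mul_sum, Finset.mul_sum, ← Finset.sum_add_distrib]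
      exact Finset.sum_congr rfl fun i _ => by rw [ht, hN]; ring
    have h3 : ∑ i, revWeight grp n₁ n₂ ρ x i * (lamB m ρ x * y i) * v i = lamB m ρ x * t := by
      rw [ht, Finset.mul_sum]
      exact Finset.sum_congr rfl fun i _ => by ring
    rw [h2, h3] at h1
    have h4 : lamB m ρ x / N * t * N = lamB m ρ x * t := by
      field_simp
    have h5 : h * t = 0 := by linarith
    exact (mul_eq_zero.1 h5).resolve_left h0
  rw [ht0, mul_zero, zero_smul, add_zero] at hv'
  rcases D.eigenvector_cases h0 hv' with ⟨c, hc⟩ | hA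
  · exfalso
    have h1 : t = c * N := by
      rw [ht, hN, Finset.mul_sum]
      refine Finset.sum_congr rfl fun i _ => ?_
      rw [hc, Pi.smul_apply, smul_eq_mul]; ring
    rw [ht0] at h1
    have hc0 : c = 0 := (mul_eq_zero.1 h1.symm).resolve_right hNpos.ne'
    rw [hc0, zero_smul] at hc
    exact hv0 hc
  · exact hA

end BlockData

end Block

/-! ### The second eigenvalue of the block matrix and of its perturbations -/

section SecondEigenvalue

open Matrix
open scoped Matrix.Norms.L2Operator

/-- `|λ₂|` of the learning matrix of the block matrix. -/
noncomputable def lamTwo (m : ℕ) (ρ x : ℝ) : ℝ :=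
  if m = 2 then |lamB m ρ x| else max |lamA m ρ x| |lamB m ρ x|

theorem abs_lamB_le_lamTwo (m : ℕ) (ρ x : ℝ) : |lamB m ρ x| ≤ lamTwo m ρ x := by
  unfold lamTwo; split_ifs
  · exact le_rfl
  · exact le_max_right _ _

theorem abs_lamA_le_lamTwo {m : ℕ} (hm : 3 ≤ m) (ρ x : ℝ) : |lamA m ρ x| ≤ lamTwo m ρ x := by
  unfold lamTwo
  rw [if_neg (by omega)]
  exact le_max_left _ _

variable {n m : ℕ} {grp : Fin n → Fin m} {n₁ n₂ : ℕ} {ρ x : ℝ}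

theorem deflate_statDist_eq (T : Matrix (Fin n) (Fin n) ℝ) : deflate T (statDist grp n₁ n₂ ρ x) =
    toComplex (blockDeflated grp n₁ n₂ ρ x) +
      toComplex (T - rowNormalized (blockMatrix grp ρ) (blockWeight grp n₁ n₂ x)) := by
  ext i j
  simp only [deflate, blockDeflated, Matrix.sub_apply, Matrix.add_apply, map_apply, vecMulVec_apply,
    Complex.coe_algebraMap, Pi.one_apply]
  push_cast
  ring

namespace BlockData

variable (D : BlockData grp n₁ n₂ ρ x)
include D

theorem exists_eigenvector_lamB :
    ∃ v : Fin n → ℝ, v ≠ 0 ∧ blockDeflated grp n₁ n₂ ρ x *ᵥ v = lamB m ρ x • v := by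
  refine ⟨_, ?_, D.mulVec_eig⟩
  intro h
  exact D.eig_ne_zero ⟨0, D.n_pos⟩ (congrFun h _)

theorem exists_eigenvector_lamTwo : ∃ (h : ℝ) (v : Fin n → ℝ), |h| = lamTwo m ρ x ∧ v ≠ 0 ∧
    blockDeflated grp n₁ n₂ ρ x *ᵥ v = h • v := by
  obtain ⟨v, hv⟩ := D.exists_eigenvector_lamB
  by_cases hm : m = 2
  · exact ⟨_, v, by rw [lamTwo, if_pos hm], hv⟩
  rcases le_total |lamA m ρ x| |lamB m ρ x| with hle | hle
  · exact ⟨_, v, by rw [lamTwo, if_neg hm, max_eq_right hle], hv⟩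
  · obtain ⟨w, hw⟩ := D.exists_eigenvector_lamA (by have := D.two_le; omega)
    exact ⟨_, w, by rw [lamTwo, if_neg hm, max_eq_left hle], hw⟩

theorem abs_eigenvalue_le {h : ℝ} {v : Fin n → ℝ} (hv0 : v ≠ 0)
    (hv : blockDeflated grp n₁ n₂ ρ x *ᵥ v = h • v) : |h| ≤ lamTwo m ρ x := by
  rcases D.eigenvalue_cases hv0 hv with rfl | rfl | ⟨hm, rfl⟩
  · rw [abs_zero]; exact (abs_nonneg _).trans (abs_lamB_le_lamTwo m ρ x)
  · exact abs_lamB_le_lamTwo m ρ x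
  · exact abs_lamA_le_lamTwo hm ρ x

theorem absLambdaTwo_eq :
    absLambdaTwo (rowNormalized (blockMatrix grp ρ) (blockWeight grp n₁ n₂ x)) =
      lamTwo m ρ x := by
  have hgr := absLambdaTwo_isGreatest D.two_le_n
    (rowNormalized (blockMatrix grp ρ) (blockWeight grp n₁ n₂ x)) (statDist grp n₁ n₂ ρ x)
    (rowNormalized_nonneg (fun i j => (blockMatrix_pos D.ρ_pos i j).le)
      fun j => (D.blockWeight_pos j).le)
    (fun i => rowNormalized_row_sum i (D.row_sum_pos i).ne') D.sum_statDist
  refine hgr.unique ?_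
  rw [deflate_statDist_eq, sub_self]
  constructor
  · obtain ⟨h, v, hh, hv0, hv⟩ := D.exists_eigenvector_lamTwo
    refine ⟨h, ?_, by rw [← hh]; simp⟩
    have := isEigenvalue_toComplex_of_real hv0 hv
    simpa using this
  · rintro _ ⟨z, hz, rfl⟩
    obtain ⟨i0, -, hi0⟩ := Finset.exists_min_image Finset.univ (revWeight grp n₁ n₂ ρ x)
      ⟨⟨0, D.n_pos⟩, Finset.mem_univ _⟩
    obtain ⟨i1, -, hi1⟩ := Finset.exists_max_image Finset.univ (revWeight grp n₁ n₂ ρ x)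
      ⟨⟨0, D.n_pos⟩, Finset.mem_univ _⟩
    have h0 := D.revWeight_pos i0
    have h1 := D.revWeight_pos i1
    obtain ⟨h, ⟨v, hv0, hv⟩, hle⟩ := exists_eigenvalue_near (W := blockDeflated grp n₁ n₂ ρ x)
      (E := toComplex 0) (ω := revWeight grp n₁ n₂ ρ x) h0
      (Real.sqrt_nonneg (revWeight grp n₁ n₂ ρ x i1 / revWeight grp n₁ n₂ ρ x i0))
      (fun i => ⟨hi0 i (Finset.mem_univ i), by
        rw [Real.sq_sqrt (by positivity), div_mul_cancel₀ _ h0.ne']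
        exact hi1 i (Finset.mem_univ i)⟩) D.reversible hz
    have hz0 : z = h := by
      have : ‖toComplex (0 : Matrix (Fin n) (Fin n) ℝ)‖ = 0 := by
        rw [norm_eq_zero]; ext; simp
      rw [this, mul_zero] at hle
      exact sub_eq_zero.1 (norm_le_zero_iff.1 hle)
    change ‖z‖ ≤ _
    rw [hz0, Complex.norm_real]
    exact D.abs_eigenvalue_le hv0 hv

/-- First-order control of `|λ₂|` for a stochastic matrix `T` close to the learning matrix of the
block matrix. -/
theorem absLambdaTwo_perturb {a κ η : ℝ} (ha : 0 < a) (hκ : 0 ≤ κ)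
    (hω : ∀ i, a ≤ revWeight grp n₁ n₂ ρ x i ∧ revWeight grp n₁ n₂ ρ x i ≤ κ ^ 2 * a)
    {T : Matrix (Fin n) (Fin n) ℝ} (hT0 : ∀ i j, 0 ≤ T i j) (hT1 : ∀ i, ∑ j, T i j = 1)
    (hη : κ * ‖toComplex (T - rowNormalized (blockMatrix grp ρ) (blockWeight grp n₁ n₂ x))‖ ≤ η)
    (hsmall : 5 * η < lamTwo m ρ x) :
    absLambdaTwo T ≤ lamTwo m ρ x + η ∧ lamTwo m ρ x - 4 * η ≤ absLambdaTwo T := by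
  set E := toComplex (T - rowNormalized (blockMatrix grp ρ) (blockWeight grp n₁ n₂ x)) with hE
  have hgr := absLambdaTwo_isGreatest D.two_le_n T (statDist grp n₁ n₂ ρ x) hT0 hT1 D.sum_statDist
  rw [deflate_statDist_eq] at hgr
  have hη0 : 0 ≤ η := le_trans (by positivity) hη
  have hnear : ∀ t : ℝ, t ∈ Set.Icc (0 : ℝ) 1 → ∀ z,
      IsEigenvalue (toComplex (blockDeflated grp n₁ n₂ ρ x) + (t : ℂ) • E) z →
      ∃ h : ℝ, (∃ v : Fin n → ℝ, v ≠ 0 ∧ blockDeflated grp n₁ n₂ ρ x *ᵥ v = h • v) ∧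
        ‖z‖ ≤ |h| + η ∧ |h| - η ≤ ‖z‖ := by
    intro t ht z hz
    obtain ⟨h, hv, hle⟩ := exists_eigenvalue_near ha hκ hω D.reversible hz
    have hle' : ‖z - h‖ ≤ η := by
      refine hle.trans (le_trans ?_ hη)
      gcongr
      rw [norm_smul, Complex.norm_real, Real.norm_of_nonneg ht.1]
      exact mul_le_of_le_one_left (norm_nonneg _) ht.2
    have h1 := abs_le.1 ((abs_norm_sub_norm_le z (h : ℂ)).trans hle')
    rw [Complex.norm_real, Real.norm_eq_abs] at h1
    exact ⟨h, hv, by linarith [h1.2], by linarith [h1.1]⟩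
  constructor
  · obtain ⟨z, hz, hzn⟩ := hgr.1
    have hz' : IsEigenvalue (toComplex (blockDeflated grp n₁ n₂ ρ x) + ((1 : ℝ) : ℂ) • E) z := by
      simpa using hz
    obtain ⟨h, ⟨v, hv0, hv⟩, h1, -⟩ := hnear 1 (Set.right_mem_Icc.2 zero_le_one) z hz'
    have := D.abs_eigenvalue_le hv0 hv
    rw [← hzn]
    change ‖z‖ ≤ _
    linarith
  · suffices h : ∃ z, IsEigenvalue (toComplex (blockDeflated grp n₁ n₂ ρ x) + E) z ∧
        lamTwo m ρ x - 4 * η ≤ ‖z‖ by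
      obtain ⟨z, hz, hzn⟩ := h
      exact hzn.trans (hgr.2 ⟨z, hz, rfl⟩)
    obtain ⟨h1, v1, hh1, hv10, hv1⟩ := D.exists_eigenvector_lamTwo
    have hstart : IsEigenvalue (toComplex (blockDeflated grp n₁ n₂ ρ x)) h1 :=
      isEigenvalue_toComplex_of_real hv10 hv1
    have hstart' : ‖(h1 : ℂ)‖ = lamTwo m ρ x := by rw [Complex.norm_real]; exact hh1
    -- the moduli of the eigenvalues are `0`, `lamTwo` and `b`
    obtain ⟨b, hb⟩ : ∃ b : ℝ, ∀ (h : ℝ) (v : Fin n → ℝ), v ≠ 0 →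
        blockDeflated grp n₁ n₂ ρ x *ᵥ v = h • v → |h| = 0 ∨ |h| = lamTwo m ρ x ∨ |h| = b := by
      by_cases hm : m = 2
      · refine ⟨0, fun h v hv0 hv => ?_⟩
        rcases D.eigenvalue_cases hv0 hv with rfl | rfl | ⟨hm', rfl⟩
        · simp
        · right; left; rw [lamTwo, if_pos hm]
        · omega
      · refine ⟨min |lamA m ρ x| |lamB m ρ x|, fun h v hv0 hv => ?_⟩
        rw [lamTwo, if_neg hm]
        rcases D.eigenvalue_cases hv0 hv with rfl | rfl | ⟨hm', rfl⟩
        · simp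
        · rcases le_total |lamA m ρ x| |lamB m ρ x| with h | h
          · right; left; rw [max_eq_right h]
          · right; right; rw [min_eq_right h]
        · rcases le_total |lamA m ρ x| |lamB m ρ x| with h | h
          · right; right; rw [min_eq_left h]
          · right; left; rw [max_eq_left h]
    by_cases hbcase : b < lamTwo m ρ x - 3 * η
    · obtain ⟨z, hz, hzn⟩ := exists_eigenvalue_norm_ge (E := E)
        (r₁ := (max η (b + η) + (lamTwo m ρ x - η)) / 2) (r₂ := lamTwo m ρ x - η) (by
          have : max η (b + η) < lamTwo m ρ x - η := by
            rw [max_lt_iff]; constructor <;> linarith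
          linarith) (by
          intro t ht z hz hzr
          obtain ⟨h, ⟨v, hv0, hv⟩, hu, hl⟩ := hnear t ht z hz
          have h3 : max η (b + η) < lamTwo m ρ x - η := by
            rw [max_lt_iff]; constructor <;> linarith
          have h4 := le_max_left η (b + η)
          have h5 := le_max_right η (b + η)
          rcases hb h v hv0 hv with h' | h' | h' <;> rw [h'] at hu hl <;> linarith)
        ⟨h1, hstart, by rw [hstart']; linarith⟩
      exact ⟨z, hz, by linarith⟩
    · rw [not_lt] at hbcase
      exact exists_eigenvalue_norm_ge (E := E)
        (r₁ := (η + (lamTwo m ρ x - 4 * η)) / 2) (r₂ := lamTwo m ρ x - 4 * η) (by linarith) (by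
          intro t ht z hz hzr
          obtain ⟨h, ⟨v, hv0, hv⟩, hu, hl⟩ := hnear t ht z hz
          rcases hb h v hv0 hv with h' | h' | h' <;> rw [h'] at hu hl <;> linarith)
        ⟨h1, hstart, by rw [hstart']; linarith⟩

/-- Second-order control of `|λ₂|`, where `lamB` dominates. -/
theorem absLambdaTwo_perturb_second_order {a κ η gap N : ℝ} (ha : 0 < a) (hκ : 0 ≤ κ)
    (hω : ∀ i, a ≤ revWeight grp n₁ n₂ ρ x i ∧ revWeight grp n₁ n₂ ρ x i ≤ κ ^ 2 * a)
    {T : Matrix (Fin n) (Fin n) ℝ} (hT0 : ∀ i j, 0 ≤ T i j) (hT1 : ∀ i, ∑ j, T i j = 1)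
    (hη : κ * ‖toComplex (T - rowNormalized (blockMatrix grp ρ) (blockWeight grp n₁ n₂ x))‖ ≤ η)
    (hgap : 0 < gap) (hsmall : 8 * η ≤ gap) (hgapB : gap ≤ |lamB m ρ x|)
    (hgapA : 3 ≤ m → |lamA m ρ x| + gap ≤ |lamB m ρ x|)
    (hN : N = ∑ i, revWeight grp n₁ n₂ ρ x i * blockVec grp (eigOne m ρ x) (eigTwo m ρ x) i ^ 2) :
    |absLambdaTwo T - (|lamB m ρ x| + SignType.sign (lamB m ρ x) *
      ((∑ i, revWeight grp n₁ n₂ ρ x i * blockVec grp (eigOne m ρ x) (eigTwo m ρ x) i *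
        ((T - rowNormalized (blockMatrix grp ρ) (blockWeight grp n₁ n₂ x)) *ᵥ
          blockVec grp (eigOne m ρ x) (eigTwo m ρ x)) i) / N))| ≤ 8 * η ^ 2 / gap := by
  set E := T - rowNormalized (blockMatrix grp ρ) (blockWeight grp n₁ n₂ x) with hE
  set q := (∑ i, revWeight grp n₁ n₂ ρ x i * blockVec grp (eigOne m ρ x) (eigTwo m ρ x) i *
        (E *ᵥ blockVec grp (eigOne m ρ x) (eigTwo m ρ x)) i) / N with hq
  have hη0 : 0 ≤ η := le_trans (by positivity) hη
  have hlam : lamTwo m ρ x = |lamB m ρ x| := by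
    unfold lamTwo
    split_ifs with hm
    · rfl
    · have := hgapA (by have := D.two_le; omega)
      exact max_eq_right (by linarith)
  have hNpos : 0 < N := by
    rw [hN]
    refine Finset.sum_pos (fun i _ => ?_) ⟨⟨0, D.n_pos⟩, Finset.mem_univ _⟩
    have := D.revWeight_pos i
    have := D.eig_ne_zero i
    positivity
  have hcrude := D.absLambdaTwo_perturb ha hκ hω hT0 hT1 hη (by rw [hlam]; linarith)
  have hgr := absLambdaTwo_isGreatest D.two_le_n T (statDist grp n₁ n₂ ρ x) hT0 hT1 D.sum_statDist
  rw [deflate_statDist_eq] at hgr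
  obtain ⟨z, hz, hzn⟩ := hgr.1
  change ‖z‖ = _ at hzn
  rw [← hzn, hlam] at hcrude
  obtain ⟨h, ⟨v, hv0, hv⟩, hle⟩ := exists_eigenvalue_near ha hκ hω D.reversible hz
  have hle' : ‖z - h‖ ≤ η := hle.trans hη
  have h1 := abs_le.1 ((abs_norm_sub_norm_le z (h : ℂ)).trans hle')
  rw [Complex.norm_real, Real.norm_eq_abs] at h1
  have hhB : h = lamB m ρ x := by
    rcases D.eigenvalue_cases hv0 hv with h' | h' | ⟨hm', h'⟩
    · rw [h', abs_zero] at h1; linarith [h1.2, hcrude.2]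
    · exact h'
    · have := hgapA hm'
      rw [h'] at h1; linarith [h1.2, hcrude.2]
  rw [hhB] at hle' h1
  have hsecond := norm_eigenvalue_sub_weighted_first_order_le ha hκ hω D.reversible hz D.mulVec_eig
    hN hNpos (d := gap / 2) (by linarith) (by
      intro k w hw0 hw
      have h2 := abs_norm_sub_norm_le z (k : ℂ)
      rw [Complex.norm_real, Real.norm_eq_abs] at h2
      have h3 := (abs_le.1 h2).2
      rcases D.eigenvalue_cases_deflated_twice hN hw0 hw with h' | ⟨hm', h'⟩
      · rw [h', abs_zero] at h3; rw [h']; linarith [h1.1]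
      · have := hgapA hm'
        rw [h'] at h3; rw [h']; linarith [h1.1])
    hη (by linarith)
  rw [← hq, show 4 * η ^ 2 / (gap / 2) = 8 * η ^ 2 / gap by ring] at hsecond
  have hqη : |q| ≤ 2 * η := by
    have h3 : 8 * η ^ 2 / gap ≤ η := by
      rw [div_le_iff₀ hgap]; nlinarith
    have h4 : ‖(q : ℂ)‖ ≤ ‖z - lamB m ρ x‖ + ‖z - lamB m ρ x - (q : ℝ)‖ := by
      have := norm_sub_le (z - lamB m ρ x : ℂ) (z - lamB m ρ x - (q : ℝ))
      rwa [sub_sub_cancel] at this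
    rw [Complex.norm_real, Real.norm_eq_abs] at h4
    linarith
  have habs : |lamB m ρ x + q| = |lamB m ρ x| + SignType.sign (lamB m ρ x) * q := by
    have hq' := abs_le.1 hqη
    rcases lt_trichotomy (lamB m ρ x) 0 with hneg | h0 | hpos
    · rw [abs_of_neg hneg] at hgapB ⊢
      rw [sign_neg hneg, abs_of_neg (by linarith)]
      simp; ring
    · rw [h0, abs_zero] at hgapB; linarith
    · rw [abs_of_pos hpos] at hgapB ⊢
      rw [sign_pos hpos, abs_of_pos (by linarith)]
      simp
  rw [← habs, ← hzn]
  have h5 := abs_norm_sub_norm_le z ((lamB m ρ x + q : ℝ) : ℂ)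
  rw [Complex.norm_real, Real.norm_eq_abs] at h5
  refine h5.trans (le_trans (le_of_eq ?_) hsecond)
  push_cast
  rw [sub_sub]

end BlockData

end SecondEigenvalue

/-! ### Monotonicity of the second eigenvalue of the block matrix -/

section Monotone

/-- The critical point of `x ↦ |lamB m ρ x|`. -/
noncomputable def critPoint (m : ℕ) (ρ : ℝ) : ℝ := √((m - 1) * (ρ + (m - 2)) / ρ)

/-- The pairs `x₀`, `x₁` such that `lamTwo` strictly decreases on the segment from `x₀` to `x₁`
(in either direction) because `|lamB|` does. -/
def IsDescentB (m : ℕ) (ρ x₀ x₁ : ℝ) : Prop :=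
  (critPoint m ρ ≤ x₀ ∧ x₀ < x₁) ∨ (x₁ < x₀ ∧ x₀ ≤ critPoint m ρ ∧ (m = 2 ∨ 1 ≤ x₁))

/-- The pairs `x₀`, `x₁` such that `lamTwo` strictly decreases on the segment from `x₀` to `x₁`. -/
def IsDescent (m : ℕ) (ρ x₀ x₁ : ℝ) : Prop :=
  (3 ≤ m ∧ x₀ < x₁ ∧ x₁ ≤ 1) ∨ IsDescentB m ρ x₀ x₁

variable {m : ℕ} {ρ : ℝ}

theorem critPoint_sq (hm : 2 ≤ m) (hρ : 0 < ρ) :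
    critPoint m ρ ^ 2 * ρ = (m - 1) * (ρ + (m - 2)) := by
  have hm' : (2 : ℝ) ≤ m := by exact_mod_cast hm
  have h1 : (0 : ℝ) ≤ (m - 1) * (ρ + (m - 2)) :=
    mul_nonneg (by linarith) (by linarith)
  rw [critPoint, Real.sq_sqrt (by positivity)]
  field_simp

theorem critPoint_two (hρ : 0 < ρ) : critPoint 2 ρ = 1 := by
  rw [critPoint]
  norm_num
  exact hρ.ne'

theorem critPoint_sq_ge (hm : 3 ≤ m) (hρ : 0 < ρ) : 2 ≤ critPoint m ρ ^ 2 := by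
  have h := critPoint_sq (by omega : 2 ≤ m) hρ
  have hm' : (3 : ℝ) ≤ m := by exact_mod_cast hm
  have : 2 * ρ ≤ critPoint m ρ ^ 2 * ρ := by rw [h]; nlinarith
  exact le_of_mul_le_mul_right this hρ

theorem one_le_critPoint (hm : 2 ≤ m) (hρ : 0 < ρ) : 1 ≤ critPoint m ρ := by
  have h0 : 0 ≤ critPoint m ρ := Real.sqrt_nonneg _
  rcases eq_or_lt_of_le hm with h | h
  · rw [← h, critPoint_two hρ]
  · nlinarith [critPoint_sq_ge h hρ]

theorem one_lt_critPoint (hm : 3 ≤ m) (hρ : 0 < ρ) : 1 < critPoint m ρ := by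
  have h0 : 0 ≤ critPoint m ρ := Real.sqrt_nonneg _
  nlinarith [critPoint_sq_ge hm hρ]

theorem rowOne_pos_of (hm : 2 ≤ m) (hρ : 0 < ρ) {x : ℝ} (hx : 0 < x) : 0 < rowOne m ρ x := by
  have hm' : (2 : ℝ) ≤ m := by exact_mod_cast hm
  have := mul_pos hρ hx
  unfold rowOne; linarith

theorem rowTwo_pos_of (hm : 2 ≤ m) (hρ : 0 < ρ) {x : ℝ} (hx : 0 < x) : 0 < rowTwo m ρ x := by
  have hm' : (2 : ℝ) ≤ m := by exact_mod_cast hm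
  unfold rowTwo; linarith

theorem abs_lamA_eq (hm : 2 ≤ m) (hρ : 0 < ρ) {x : ℝ} (hx : 0 < x) :
    |lamA m ρ x| = |ρ - 1| / rowTwo m ρ x := by
  rw [lamA, abs_div, abs_of_pos (rowTwo_pos_of hm hρ hx)]

theorem abs_lamB_eq (hm : 2 ≤ m) (hρ : 0 < ρ) {x : ℝ} (hx : 0 < x) :
    |lamB m ρ x| = |ρ - 1| * ((ρ + (m - 1)) * x) / (rowOne m ρ x * rowTwo m ρ x) := by
  have hm' : (2 : ℝ) ≤ m := by exact_mod_cast hm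
  have h1 : 0 < (ρ + (m - 1)) * x := mul_pos (by linarith) hx
  rw [lamB, mul_assoc, abs_div, abs_mul, abs_of_pos h1,
    abs_of_pos (mul_pos (rowOne_pos_of hm hρ hx) (rowTwo_pos_of hm hρ hx))]

theorem abs_lamB_sub_abs_lamA (hm : 2 ≤ m) (hρ : 0 < ρ) {x : ℝ} (hx : 0 < x) :
    |lamB m ρ x| - |lamA m ρ x| =
      |ρ - 1| * ((m - 1) * (x - 1)) / (rowOne m ρ x * rowTwo m ρ x) := by
  have h1 := (rowOne_pos_of hm hρ hx).ne'
  have h2 := (rowTwo_pos_of hm hρ hx).ne'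
  rw [abs_lamA_eq hm hρ hx, abs_lamB_eq hm hρ hx]
  field_simp
  unfold rowOne
  ring

theorem abs_lamA_sub (hm : 2 ≤ m) (hρ : 0 < ρ) {x₀ x₁ : ℝ} (h₀ : 0 < x₀) (h₁ : 0 < x₁) :
    |lamA m ρ x₀| - |lamA m ρ x₁| = |ρ - 1| * (x₁ - x₀) / (rowTwo m ρ x₀ * rowTwo m ρ x₁) := by
  have h2 := (rowTwo_pos_of hm hρ h₀).ne'
  have h3 := (rowTwo_pos_of hm hρ h₁).ne'
  rw [abs_lamA_eq hm hρ h₀, abs_lamA_eq hm hρ h₁]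
  field_simp
  unfold rowTwo
  ring

theorem abs_lamB_sub (hm : 2 ≤ m) (hρ : 0 < ρ) {x₀ x₁ : ℝ} (h₀ : 0 < x₀) (h₁ : 0 < x₁) :
    |lamB m ρ x₀| - |lamB m ρ x₁| =
      |ρ - 1| * (ρ + (m - 1)) * ρ * ((x₁ - x₀) * (x₀ * x₁ - critPoint m ρ ^ 2)) /
        (rowOne m ρ x₀ * rowTwo m ρ x₀ * (rowOne m ρ x₁ * rowTwo m ρ x₁)) := by
  have h2 := (rowTwo_pos_of hm hρ h₀).ne'
  have h3 := (rowTwo_pos_of hm hρ h₁).ne'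
  have h4 := (rowOne_pos_of hm hρ h₀).ne'
  have h5 := (rowOne_pos_of hm hρ h₁).ne'
  have hc := critPoint_sq hm hρ
  rw [abs_lamB_eq hm hρ h₀, abs_lamB_eq hm hρ h₁, div_sub_div _ _ (mul_ne_zero h4 h2)
    (mul_ne_zero h5 h3)]
  congr 1
  have : ρ * ((x₁ - x₀) * (x₀ * x₁ - critPoint m ρ ^ 2)) =
      (x₁ - x₀) * (ρ * (x₀ * x₁) - (m - 1) * (ρ + (m - 2))) := by rw [← hc]; ring
  rw [mul_assoc (|ρ - 1| * (ρ + (m - 1))) ρ, this]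
  unfold rowOne rowTwo
  ring

theorem lamTwo_eq_lamA (hm : 3 ≤ m) (hρ : 0 < ρ) {x : ℝ} (hx : 0 < x) (hx1 : x ≤ 1) :
    lamTwo m ρ x = |lamA m ρ x| := by
  rw [lamTwo, if_neg (by omega), max_eq_left]
  have h := abs_lamB_sub_abs_lamA (by omega : 2 ≤ m) hρ hx
  have h1 := rowOne_pos_of (by omega : 2 ≤ m) hρ hx
  have h2 := rowTwo_pos_of (by omega : 2 ≤ m) hρ hx
  have hm' : (3 : ℝ) ≤ m := by exact_mod_cast hm
  have h3 : |ρ - 1| * ((m - 1) * (x - 1)) / (rowOne m ρ x * rowTwo m ρ x) ≤ 0 := by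
    apply div_nonpos_of_nonpos_of_nonneg _ (by positivity)
    exact mul_nonpos_of_nonneg_of_nonpos (abs_nonneg _)
      (mul_nonpos_of_nonneg_of_nonpos (by linarith) (by linarith))
  linarith

theorem lamTwo_eq_lamB (hm : 2 ≤ m) (hρ : 0 < ρ) {x : ℝ} (hx : 0 < x) (hx1 : m = 2 ∨ 1 ≤ x) :
    lamTwo m ρ x = |lamB m ρ x| := by
  rw [lamTwo]
  split_ifs with hm2
  · rfl
  rw [max_eq_right]
  have hx1' := hx1.resolve_left hm2
  have h := abs_lamB_sub_abs_lamA hm hρ hx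
  have h1 := rowOne_pos_of hm hρ hx
  have h2 := rowTwo_pos_of hm hρ hx
  have hm' : (2 : ℝ) ≤ m := by exact_mod_cast hm
  have h3 : 0 ≤ |ρ - 1| * ((m - 1) * (x - 1)) / (rowOne m ρ x * rowTwo m ρ x) := by
    apply div_nonneg _ (by positivity)
    exact mul_nonneg (abs_nonneg _) (mul_nonneg (by linarith) (by linarith))
  linarith

theorem IsDescentB.lamTwo_eq {x₀ x₁ : ℝ} (h : IsDescentB m ρ x₀ x₁) (hm : 2 ≤ m) (hρ : 0 < ρ)
    (h₀ : 0 < x₀) (h₁ : 0 < x₁) :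
    lamTwo m ρ x₀ = |lamB m ρ x₀| ∧ lamTwo m ρ x₁ = |lamB m ρ x₁| := by
  have hc := one_le_critPoint hm hρ
  rcases h with ⟨h1, h2⟩ | ⟨h1, h2, h3⟩
  · exact ⟨lamTwo_eq_lamB hm hρ h₀ (Or.inr (by linarith)),
      lamTwo_eq_lamB hm hρ h₁ (Or.inr (by linarith))⟩
  · exact ⟨lamTwo_eq_lamB hm hρ h₀ (h3.imp_right fun h => by linarith),
      lamTwo_eq_lamB hm hρ h₁ h3⟩

/-- Both factors of the numerator of `|lamB x₀| - |lamB x₁|` have the same sign along a descent. -/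
theorem IsDescentB.mul_ge {x₀ x₁ b : ℝ} (h : IsDescentB m ρ x₀ x₁)
    (hx : b ≤ x₀) (hc : b ≤ critPoint m ρ) :
    b * (|x₁ - x₀| * (|x₀ - critPoint m ρ| + |x₁ - critPoint m ρ|)) ≤
      (x₁ - x₀) * (x₀ * x₁ - critPoint m ρ ^ 2) := by
  have key : x₀ * x₁ - critPoint m ρ ^ 2 =
    x₀ * (x₁ - critPoint m ρ) + critPoint m ρ * (x₀ - critPoint m ρ) := by ring
  rw [key]
  rcases h with ⟨h1, h2⟩ | ⟨h1, h2, -⟩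
  · rw [abs_of_pos (sub_pos.2 h2), abs_of_nonneg (sub_nonneg.2 h1),
      abs_of_nonneg (sub_nonneg.2 (h1.trans h2.le))]
    have h3 := mul_le_mul_of_nonneg_right hx (sub_nonneg.2 (h1.trans h2.le))
    have h4 := mul_le_mul_of_nonneg_right hc (sub_nonneg.2 h1)
    have h5 := mul_le_mul_of_nonneg_left (add_le_add h3 h4) (sub_pos.2 h2).le
    linarith
  · rw [abs_of_neg (sub_neg.2 h1), abs_of_nonpos (sub_nonpos.2 h2),
      abs_of_nonpos (sub_nonpos.2 (h1.le.trans h2))]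
    have h3 := mul_le_mul_of_nonneg_right hx (sub_nonneg.2 (h1.le.trans h2))
    have h4 := mul_le_mul_of_nonneg_right hc (sub_nonneg.2 h2)
    have h5 := mul_le_mul_of_nonneg_left (add_le_add h3 h4) (sub_pos.2 h1).le
    linarith

theorem IsDescent.lamTwo_lt {x₀ x₁ : ℝ} (h : IsDescent m ρ x₀ x₁) (hm : 2 ≤ m) (hρ : 0 < ρ)
    (hρ1 : ρ ≠ 1) (h₀ : 0 < x₀) (h₁ : 0 < x₁) : lamTwo m ρ x₁ < lamTwo m ρ x₀ := by
  have hρ' : 0 < |ρ - 1| := abs_pos.2 (sub_ne_zero.2 hρ1)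
  have hm' : (2 : ℝ) ≤ m := by exact_mod_cast hm
  rcases h with ⟨hm3, h1, h2⟩ | h
  · rw [lamTwo_eq_lamA hm3 hρ h₀ (by linarith), lamTwo_eq_lamA hm3 hρ h₁ h2]
    have h3 := abs_lamA_sub hm hρ h₀ h₁
    have h4 : 0 < |ρ - 1| * (x₁ - x₀) / (rowTwo m ρ x₀ * rowTwo m ρ x₁) :=
      div_pos (mul_pos hρ' (sub_pos.2 h1))
        (mul_pos (rowTwo_pos_of hm hρ h₀) (rowTwo_pos_of hm hρ h₁))
    linarith
  · obtain ⟨e1, e2⟩ := h.lamTwo_eq hm hρ h₀ h₁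
    rw [e1, e2]
    have h3 := abs_lamB_sub hm hρ h₀ h₁
    have hc := one_le_critPoint hm hρ
    have h5 := h.mul_ge (b := min x₀ 1) (min_le_left _ _)
      ((min_le_right _ _).trans hc)
    have h6 : 0 < min x₀ 1 * (|x₁ - x₀| * (|x₀ - critPoint m ρ| + |x₁ - critPoint m ρ|)) := by
      have hne : x₀ ≠ x₁ := by
        rcases h with ⟨-, h2⟩ | ⟨h1, -, -⟩
        · exact h2.ne
        · exact h1.ne'
      have h7 : 0 < |x₁ - x₀| := abs_pos.2 (sub_ne_zero.2 hne.symm)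
      have h8 : |x₁ - x₀| ≤ |x₀ - critPoint m ρ| + |x₁ - critPoint m ρ| := by
        have := abs_sub_le x₁ (critPoint m ρ) x₀
        rw [abs_sub_comm (critPoint m ρ) x₀] at this
        linarith
      have h9 : 0 < min x₀ 1 := lt_min h₀ one_pos
      exact mul_pos h9 (mul_pos h7 (by linarith))
    have h4 : 0 < |ρ - 1| * (ρ + (m - 1)) * ρ * ((x₁ - x₀) * (x₀ * x₁ - critPoint m ρ ^ 2)) /
        (rowOne m ρ x₀ * rowTwo m ρ x₀ * (rowOne m ρ x₁ * rowTwo m ρ x₁)) := by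
      apply div_pos
      · exact mul_pos (mul_pos (mul_pos hρ' (by linarith)) hρ) (h6.trans_le h5)
      · exact mul_pos (mul_pos (rowOne_pos_of hm hρ h₀) (rowTwo_pos_of hm hρ h₀))
          (mul_pos (rowOne_pos_of hm hρ h₁) (rowTwo_pos_of hm hρ h₁))
    linarith

end Monotone

/-! ### The degree weights as functions of the parameter -/

section WeightFunction

variable {φ : ℝ → ℝ → ℝ}

namespace IsWeightFunction

variable (hφ : IsWeightFunction φ)
include hφ

theorem contDiffAt {α d : ℝ} (hd : 0 < d) :
    ContDiffAt ℝ 2 (fun x : ℝ × ℝ => φ x.1 x.2) (α, d) := by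
  refine hφ.contDiffOn.contDiffAt ?_
  exact (isOpen_univ.prod isOpen_Ioi).mem_nhds ⟨Set.mem_univ _, hd⟩

theorem differentiable_param {d : ℝ} (hd : 0 < d) : Differentiable ℝ (fun a => φ a d) := by
  intro α
  have h1 : DifferentiableAt ℝ (fun x : ℝ × ℝ => φ x.1 x.2) (α, d) :=
    (hφ.contDiffAt hd).differentiableAt (by norm_num)
  exact DifferentiableAt.comp (f := fun a : ℝ => (a, d)) α h1
    (differentiableAt_id.prodMk (differentiableAt_const d))

theorem differentiableAt_degree (α : ℝ) {d : ℝ} (hd : 0 < d) : DifferentiableAt ℝ (φ α) d := by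
  have h1 : DifferentiableAt ℝ (fun x : ℝ × ℝ => φ x.1 x.2) (α, d) :=
    (hφ.contDiffAt hd).differentiableAt (by norm_num)
  exact DifferentiableAt.comp (f := fun d : ℝ => (α, d)) d h1
    ((differentiableAt_const α).prodMk differentiableAt_id)

theorem strictAnti_ratio {d₁ d₂ : ℝ} (hd₂ : 0 < d₂) (h : d₂ < d₁) :
    StrictAnti (fun a => φ a d₂ / φ a d₁) :=
  strictAnti_of_deriv_neg (hφ.ratio_deriv_neg d₁ d₂ hd₂ h)

theorem continuous_ratio {d₁ d₂ : ℝ} (hd₁ : 0 < d₁) (hd₂ : 0 < d₂) :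
    Continuous (fun a => φ a d₂ / φ a d₁) :=
  (hφ.differentiable_param hd₂).continuous.div (hφ.differentiable_param hd₁).continuous
    fun a => (hφ.pos a d₁ hd₁).ne'

theorem strictMono_ratio {d₁ d₂ : ℝ} (hd₁ : 0 < d₁) (h : d₁ < d₂) :
    StrictMono (fun a => φ a d₂ / φ a d₁) := by
  intro a b hab
  have h1 := hφ.strictAnti_ratio hd₁ h hab
  have hd₂ := hd₁.trans h
  have p1 := hφ.pos a d₁ hd₁
  have p2 := hφ.pos a d₂ hd₂
  have p3 := hφ.pos b d₁ hd₁
  have p4 := hφ.pos b d₂ hd₂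
  simp only at h1 ⊢
  rw [div_lt_div_iff₀ p4 p2] at h1
  rw [div_lt_div_iff₀ p1 p3]
  linarith

theorem ratio_surj_aux {d₁ d₂ : ℝ} (hd₂ : 0 < d₂) (h : d₂ < d₁) {y : ℝ} (hy : 0 < y) :
    ∃ a, φ a d₂ / φ a d₁ = y := by
  have hd₁ := hd₂.trans h
  refine mem_range_of_exists_le_of_exists_ge (hφ.continuous_ratio hd₁ hd₂) ?_ ?_
  · obtain ⟨a, ha⟩ := ((hφ.ratio_atTop d₁ d₂ hd₂ h).eventually (gt_mem_nhds hy)).exists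
    exact ⟨a, ha.le⟩
  · obtain ⟨a, ha⟩ :=
      ((hφ.ratio_atBot d₁ d₂ hd₂ h).eventually (gt_mem_nhds (inv_pos.2 hy))).exists
    refine ⟨a, ?_⟩
    have p1 := hφ.pos a d₁ hd₁
    have p2 := hφ.pos a d₂ hd₂
    rw [← inv_div, inv_lt_inv₀ (by positivity) hy] at ha
    exact ha.le

theorem ratio_surj {d₁ d₂ : ℝ} (hd₁ : 0 < d₁) (hd₂ : 0 < d₂) (hne : d₁ ≠ d₂) {y : ℝ}
    (hy : 0 < y) : ∃ a, φ a d₂ / φ a d₁ = y := by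
  rcases lt_or_gt_of_ne hne with h | h
  · obtain ⟨a, ha⟩ := hφ.ratio_surj_aux hd₁ h (inv_pos.2 hy)
    exact ⟨a, by rw [← inv_div, ha, inv_inv]⟩
  · exact hφ.ratio_surj_aux hd₂ h hy

theorem ratio_injective {d₁ d₂ : ℝ} (hd₁ : 0 < d₁) (hd₂ : 0 < d₂) (hne : d₁ ≠ d₂) :
    Function.Injective (fun a => φ a d₂ / φ a d₁) := by
  rcases lt_or_gt_of_ne hne with h | h
  · exact (hφ.strictMono_ratio hd₁ h).injective
  · exact (hφ.strictAnti_ratio hd₂ h).injective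

end IsWeightFunction

/-- The ratio of the total weight of the first group and that of any other group. -/
noncomputable def weightRatio (φ : ℝ → ℝ → ℝ) (m n₁ n₂ : ℕ) (p q α : ℝ) : ℝ :=
  n₁ / n₂ * (φ α (expDegOne m n₁ n₂ p q) / φ α (expDegTwo m n₁ n₂ p q))

variable {m n₁ n₂ : ℕ} {p q : ℝ}

theorem expDegOne_pos (hm : 2 ≤ m) (h₁ : 0 < n₁) (hp : 0 < p) (hq : 0 < q) :
    0 < expDegOne m n₁ n₂ p q := by
  have hm' : (2 : ℝ) ≤ m := by exact_mod_cast hm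
  have h₁' : (0 : ℝ) < n₁ := by exact_mod_cast h₁
  have : 0 ≤ ((m : ℝ) - 1) * n₂ * q := by
    have : (0 : ℝ) ≤ m - 1 := by linarith
    positivity
  unfold expDegOne
  have := mul_pos h₁' hp
  linarith

theorem expDegTwo_pos (hm : 2 ≤ m) (h₁ : 0 < n₁) (hp : 0 < p) (hq : 0 < q) :
    0 < expDegTwo m n₁ n₂ p q := by
  have hm' : (2 : ℝ) ≤ m := by exact_mod_cast hm
  have h₁' : (0 : ℝ) < n₁ := by exact_mod_cast h₁
  have : 0 ≤ ((m : ℝ) - 2) * n₂ * q := by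
    have : (0 : ℝ) ≤ m - 2 := by linarith
    positivity
  have h2 : 0 ≤ n₂ * p := by positivity
  unfold expDegTwo
  have := mul_pos h₁' hq
  linarith

theorem weightRatio_mul_gFun (hφ : IsWeightFunction φ) (hm : 2 ≤ m) (h₁ : 0 < n₁)
    (hp : 0 < p) (hq : 0 < q) (α : ℝ) :
    weightRatio φ m n₁ n₂ p q α * gFun φ m n₁ n₂ p q α = n₁ / n₂ := by
  have p1 := (hφ.pos α _ (expDegOne_pos (n₂ := n₂) hm h₁ hp hq)).ne'
  have p2 := (hφ.pos α _ (expDegTwo_pos (n₂ := n₂) hm h₁ hp hq)).ne'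
  unfold weightRatio gFun
  field_simp

theorem gFun_pos (hφ : IsWeightFunction φ) (hm : 2 ≤ m) (h₁ : 0 < n₁)
    (hp : 0 < p) (hq : 0 < q) (α : ℝ) : 0 < gFun φ m n₁ n₂ p q α :=
  div_pos (hφ.pos α _ (expDegTwo_pos (n₂ := n₂) hm h₁ hp hq))
    (hφ.pos α _ (expDegOne_pos (n₂ := n₂) hm h₁ hp hq))

theorem weightRatio_pos (hφ : IsWeightFunction φ) (hm : 2 ≤ m) (h₁ : 0 < n₁) (h₂ : 0 < n₂)
    (hp : 0 < p) (hq : 0 < q) (α : ℝ) : 0 < weightRatio φ m n₁ n₂ p q α := by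
  have p1 := hφ.pos α _ (expDegOne_pos (n₂ := n₂) hm h₁ hp hq)
  have p2 := hφ.pos α _ (expDegTwo_pos (n₂ := n₂) hm h₁ hp hq)
  unfold weightRatio
  positivity

theorem bijOn_gFun (hφ : IsWeightFunction φ) (hm : 2 ≤ m) (h₁ : 0 < n₁)
    (hp : 0 < p) (hq : 0 < q) (hne : expDegOne m n₁ n₂ p q ≠ expDegTwo m n₁ n₂ p q) :
    Set.BijOn (gFun φ m n₁ n₂ p q) Set.univ (Set.Ioi 0) := by
  have d1 := expDegOne_pos (n₂ := n₂) hm h₁ hp hq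
  have d2 := expDegTwo_pos (n₂ := n₂) hm h₁ hp hq
  refine ⟨fun α _ => gFun_pos hφ hm h₁ hp hq α, (hφ.ratio_injective d1 d2 hne).injOn, ?_⟩
  intro y hy
  obtain ⟨a, ha⟩ := hφ.ratio_surj d1 d2 hne hy
  exact ⟨a, Set.mem_univ _, ha⟩

theorem gFun_gInv (hφ : IsWeightFunction φ) (hm : 2 ≤ m) (h₁ : 0 < n₁)
    (hp : 0 < p) (hq : 0 < q) (hne : expDegOne m n₁ n₂ p q ≠ expDegTwo m n₁ n₂ p q) {y : ℝ}
    (hy : 0 < y) : gFun φ m n₁ n₂ p q (gInv φ m n₁ n₂ p q y) = y := by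
  obtain ⟨a, -, ha⟩ := (bijOn_gFun hφ hm h₁ hp hq hne).surjOn hy
  exact Function.invFun_eq ⟨a, ha⟩

theorem weightRatio_thresholdOne (hφ : IsWeightFunction φ) (hm : 2 ≤ m) (h₁ : 0 < n₁) (h₂ : 0 < n₂)
    (hp : 0 < p) (hq : 0 < q) (hne : expDegOne m n₁ n₂ p q ≠ expDegTwo m n₁ n₂ p q) :
    weightRatio φ m n₁ n₂ p q (thresholdOne φ m n₁ n₂ p q) = 1 := by
  have h₁' : (0 : ℝ) < n₁ := by exact_mod_cast h₁
  have h₂' : (0 : ℝ) < n₂ := by exact_mod_cast h₂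
  have h := weightRatio_mul_gFun (n₂ := n₂) hφ hm h₁ hp hq (thresholdOne φ m n₁ n₂ p q)
  rw [thresholdOne, gFun_gInv hφ hm h₁ hp hq hne (by positivity)] at h
  rw [thresholdOne]
  exact mul_right_cancel₀ (b := (n₁ : ℝ) / n₂) (by positivity) (by rw [h, one_mul])

theorem weightRatio_thresholdTwo (hφ : IsWeightFunction φ) (hm : 2 ≤ m) (h₁ : 0 < n₁) (h₂ : 0 < n₂)
    (hp : 0 < p) (hq : 0 < q) (hne : expDegOne m n₁ n₂ p q ≠ expDegTwo m n₁ n₂ p q) :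
    weightRatio φ m n₁ n₂ p q (thresholdTwo φ m n₁ n₂ p q) = critPoint m (p / q) := by
  have h₁' : (0 : ℝ) < n₁ := by exact_mod_cast h₁
  have h₂' : (0 : ℝ) < n₂ := by exact_mod_cast h₂
  have hm' : (2 : ℝ) ≤ m := by exact_mod_cast hm
  have hc := one_le_critPoint hm (div_pos hp hq)
  have hsq : √(p / (((m : ℝ) - 1) * (p + ((m : ℝ) - 2) * q))) = (critPoint m (p / q))⁻¹ := by
    rw [critPoint, ← Real.sqrt_inv]
    congr 1
    have : (m : ℝ) - 1 ≠ 0 := by linarith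
    have : p + ((m : ℝ) - 2) * q ≠ 0 := by
      have := mul_nonneg (show (0 : ℝ) ≤ m - 2 by linarith) hq.le
      linarith
    field_simp
  have h := weightRatio_mul_gFun (n₂ := n₂) hφ hm h₁ hp hq (thresholdTwo φ m n₁ n₂ p q)
  rw [thresholdTwo, hsq, gFun_gInv hφ hm h₁ hp hq hne (by positivity)] at h
  rw [thresholdTwo, hsq]
  have hc0 : critPoint m (p / q) ≠ 0 := by linarith
  exact mul_right_cancel₀ (b := (n₁ : ℝ) / n₂ * (critPoint m (p / q))⁻¹) (by positivity)
    (h.trans (by field_simp))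

theorem strictMono_weightRatio (hφ : IsWeightFunction φ) (hm : 2 ≤ m) (h₁ : 0 < n₁) (h₂ : 0 < n₂)
    (hp : 0 < p) (hq : 0 < q) (h : expDegTwo m n₁ n₂ p q < expDegOne m n₁ n₂ p q) :
    StrictMono (weightRatio φ m n₁ n₂ p q) := by
  have h₁' : (0 : ℝ) < n₁ := by exact_mod_cast h₁
  have h₂' : (0 : ℝ) < n₂ := by exact_mod_cast h₂
  intro a b hab
  exact mul_lt_mul_of_pos_left
    (hφ.strictMono_ratio (expDegTwo_pos (n₂ := n₂) hm h₁ hp hq) h hab) (by positivity)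

theorem strictAnti_weightRatio (hφ : IsWeightFunction φ) (hm : 2 ≤ m) (h₁ : 0 < n₁) (h₂ : 0 < n₂)
    (hp : 0 < p) (hq : 0 < q) (h : expDegOne m n₁ n₂ p q < expDegTwo m n₁ n₂ p q) :
    StrictAnti (weightRatio φ m n₁ n₂ p q) := by
  have h₁' : (0 : ℝ) < n₁ := by exact_mod_cast h₁
  have h₂' : (0 : ℝ) < n₂ := by exact_mod_cast h₂
  intro a b hab
  exact mul_lt_mul_of_pos_left
    (hφ.strictAnti_ratio (expDegOne_pos (n₂ := n₂) hm h₁ hp hq) h hab) (by positivity)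

/-- On an interval inside `decreaseRegion`, the weight ratio moves along a descent of `lamTwo`. -/
theorem isDescent_of_subset (hφ : IsWeightFunction φ) (hm : 2 ≤ m) (h₁ : 0 < n₁) (h₂ : 0 < n₂)
    (hp : 0 < p) (hq : 0 < q) (hne : expDegOne m n₁ n₂ p q ≠ expDegTwo m n₁ n₂ p q) {α β : ℝ}
    (hαβ : α < β) (hsub : Set.Icc α β ⊆ decreaseRegion φ m n₁ n₂ p q) :
    IsDescent m (p / q) (weightRatio φ m n₁ n₂ p q α) (weightRatio φ m n₁ n₂ p q β) := by
  have hα := hsub (Set.left_mem_Icc.2 hαβ.le)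
  have hβ := hsub (Set.right_mem_Icc.2 hαβ.le)
  have e1 := weightRatio_thresholdOne hφ hm h₁ h₂ hp hq hne
  have e2 := weightRatio_thresholdTwo hφ hm h₁ h₂ hp hq hne
  have hρ := div_pos hp hq
  unfold decreaseRegion at hα hβ hsub
  split_ifs at hα hβ hsub with hm2 hd
  · subst hm2
    have hc : critPoint 2 (p / q) = 1 := critPoint_two hρ
    right
    rcases lt_or_gt_of_ne hne with h | h
    · have hx := strictAnti_weightRatio hφ hm h₁ h₂ hp hq h
      right
      refine ⟨hx hαβ, ?_, Or.inl rfl⟩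
      rw [hc, ← e1]
      exact hx.antitone hα
    · have hx := strictMono_weightRatio hφ hm h₁ h₂ hp hq h
      left
      refine ⟨?_, hx hαβ⟩
      rw [hc, ← e1]
      exact hx.monotone hα
  · have hx := strictMono_weightRatio hφ hm h₁ h₂ hp hq hd
    have hm3 : 3 ≤ m := by omega
    have hab : thresholdOne φ m n₁ n₂ p q < thresholdTwo φ m n₁ n₂ p q := by
      rw [← hx.lt_iff_lt, e1, e2]
      exact one_lt_critPoint hm3 hρ
    by_cases hβa : β ≤ thresholdOne φ m n₁ n₂ p q
    · left
      refine ⟨hm3, hx hαβ, ?_⟩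
      rw [← e1]
      exact hx.monotone hβa
    · right; left
      refine ⟨?_, hx hαβ⟩
      rw [← e2]
      apply hx.monotone
      rcases hα with hα | hα
      · exfalso
        have hβb : thresholdTwo φ m n₁ n₂ p q ≤ β := hβ.resolve_left hβa
        have hα' : α ≤ thresholdOne φ m n₁ n₂ p q := hα
        obtain ⟨c, hc1, hc2⟩ := exists_between hab
        rcases hsub (show c ∈ Set.Icc α β from ⟨by linarith, by linarith⟩) with hc | hc
        · exact absurd (show c ≤ _ from hc) (not_le.2 hc1)
        · exact absurd (show _ ≤ c from hc) (not_le.2 hc2)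
      · exact hα
  · have hd' : expDegOne m n₁ n₂ p q < expDegTwo m n₁ n₂ p q := lt_of_le_of_ne (not_lt.1 hd) hne
    have hx := strictAnti_weightRatio hφ hm h₁ h₂ hp hq hd'
    right; right
    refine ⟨hx hαβ, ?_, Or.inr ?_⟩
    · rw [← e2]; exact hx.antitone hα.1.le
    · rw [← e1]; exact hx.antitone hβ.2

/-- On an interval outside `decreaseRegion`, the weight ratio moves against a descent of
`lamTwo`. -/
theorem isDescent_of_subset_compl (hφ : IsWeightFunction φ) (hm : 2 ≤ m) (h₁ : 0 < n₁)
    (h₂ : 0 < n₂) (hp : 0 < p) (hq : 0 < q)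
    (hne : expDegOne m n₁ n₂ p q ≠ expDegTwo m n₁ n₂ p q) {α β : ℝ}
    (hαβ : α < β) (hsub : Set.Icc α β ⊆ (decreaseRegion φ m n₁ n₂ p q)ᶜ) :
    IsDescent m (p / q) (weightRatio φ m n₁ n₂ p q β) (weightRatio φ m n₁ n₂ p q α) := by
  have hα := hsub (Set.left_mem_Icc.2 hαβ.le)
  have hβ := hsub (Set.right_mem_Icc.2 hαβ.le)
  have e1 := weightRatio_thresholdOne hφ hm h₁ h₂ hp hq hne
  have e2 := weightRatio_thresholdTwo hφ hm h₁ h₂ hp hq hne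
  have hρ := div_pos hp hq
  unfold decreaseRegion at hα hβ hsub
  split_ifs at hα hβ hsub with hm2 hd
  · subst hm2
    have hc : critPoint 2 (p / q) = 1 := critPoint_two hρ
    right
    simp only [Set.mem_compl_iff, Set.mem_Ici, not_le] at hα hβ
    rcases lt_or_gt_of_ne hne with h | h
    · have hx := strictAnti_weightRatio hφ hm h₁ h₂ hp hq h
      left
      refine ⟨?_, hx hαβ⟩
      rw [hc, ← e1]
      exact hx.antitone hβ.le
    · have hx := strictMono_weightRatio hφ hm h₁ h₂ hp hq h
      right
      refine ⟨hx hαβ, ?_, Or.inl rfl⟩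
      rw [hc, ← e1]
      exact hx.monotone hβ.le
  · have hx := strictMono_weightRatio hφ hm h₁ h₂ hp hq hd
    simp only [Set.mem_compl_iff, Set.mem_union, Set.mem_Iic, Set.mem_Ici, not_or, not_le] at hα hβ
    right; right
    refine ⟨hx hαβ, ?_, Or.inr ?_⟩
    · rw [← e2]; exact hx.monotone hβ.2.le
    · rw [← e1]; exact hx.monotone hα.1.le
  · have hd' : expDegOne m n₁ n₂ p q < expDegTwo m n₁ n₂ p q := lt_of_le_of_ne (not_lt.1 hd) hne
    have hx := strictAnti_weightRatio hφ hm h₁ h₂ hp hq hd'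
    have hm3 : 3 ≤ m := by omega
    have hab : thresholdTwo φ m n₁ n₂ p q < thresholdOne φ m n₁ n₂ p q := by
      rw [← hx.lt_iff_gt, e1, e2]
      exact one_lt_critPoint hm3 hρ
    simp only [Set.mem_compl_iff, Set.mem_Ioc, not_and, not_le] at hα hβ
    by_cases hβb : β ≤ thresholdTwo φ m n₁ n₂ p q
    · right; left
      refine ⟨?_, hx hαβ⟩
      rw [← e2]
      exact hx.antitone hβb
    · left
      have hβa := hβ (not_le.1 hβb)
      refine ⟨hm3, hx hαβ, ?_⟩
      rw [← e1]
      apply hx.antitone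
      by_contra hαa
      rw [not_le] at hαa
      exact hsub (show thresholdOne φ m n₁ n₂ p q ∈ Set.Icc α β from ⟨hαa.le, hβa.le⟩)
        ⟨hab, le_rfl⟩

end WeightFunction

/-! ### The expected perturbed network -/

section Expected

theorem learningMatrix_eq_rowNormalized {n : ℕ} (φ : ℝ → ℝ → ℝ) (α : ℝ)
    (M : Matrix (Fin n) (Fin n) ℝ) :
    learningMatrix φ α M = rowNormalized M (fun j => φ α (degree M j)) := rfl

/-- The expected perturbed adjacency matrix: `p` within a group, `q` between different groups. -/
def linkMatrix {n m : ℕ} (grp : Fin n → Fin m) (p q : ℝ) : Matrix (Fin n) (Fin n) ℝ :=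
  Matrix.of fun i j => linkProb p q (grp i) (grp j)

section Deterministic

variable {n m : ℕ} {grp : Fin n → Fin m} {n₁ n₂ : ℕ} {p q : ℝ}

theorem linkMatrix_eq_smul (hq : 0 < q) : linkMatrix grp p q = q • blockMatrix grp (p / q) := by
  ext i j
  simp only [linkMatrix, blockMatrix, Matrix.of_apply, Matrix.smul_apply, smul_eq_mul, linkProb]
  split_ifs
  · field_simp
  · rw [mul_one]

theorem degree_linkMatrix (hm : 2 ≤ m) (hg : HasGroupSizes grp n₁ n₂) (hq : 0 < q) (i : Fin n) :
    degree (linkMatrix grp p q) i =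
      blockVec grp (expDegOne m n₁ n₂ p q) (expDegTwo m n₁ n₂ p q) i := by
  have h := sum_blockMatrix_mul_blockVec (ρ := p / q) hm hg 1 1 i
  have h1 : ∀ j, blockVec grp 1 1 j = 1 := fun j => by simp [blockVec]
  simp only [h1, mul_one] at h
  simp only [degree, linkMatrix_eq_smul hq, Matrix.smul_apply, smul_eq_mul, ← Finset.mul_sum]
  rw [h]
  simp only [blockVec, expDegOne, expDegTwo]
  split_ifs
  · field_simp
  · field_simp
    ring

theorem learningMatrix_linkMatrix {φ : ℝ → ℝ → ℝ} (hφ : IsWeightFunction φ) (hm : 2 ≤ m)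
    (hg : HasGroupSizes grp n₁ n₂) (h₁ : 0 < n₁) (h₂ : 0 < n₂) (hp : 0 < p) (hq : 0 < q) (α : ℝ) :
    learningMatrix φ α (linkMatrix grp p q) = rowNormalized (blockMatrix grp (p / q))
      (blockWeight grp n₁ n₂ (weightRatio φ m n₁ n₂ p q α)) := by
  have p2 := hφ.pos α _ (expDegTwo_pos (n₂ := n₂) hm h₁ hp hq)
  have h₁' : (n₁ : ℝ) ≠ 0 := by exact_mod_cast h₁.ne'
  have h₂' : (n₂ : ℝ) ≠ 0 := by exact_mod_cast h₂.ne'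
  rw [learningMatrix_eq_rowNormalized, ← rowNormalized_smul_right _ (blockWeight _ _ _ _) p2.ne',
    linkMatrix_eq_smul hq, rowNormalized_smul_left _ _ hq.ne']
  congr 1
  ext j
  rw [← linkMatrix_eq_smul hq, degree_linkMatrix hm hg hq]
  simp only [blockWeight, blockVec, weightRatio]
  split_ifs
  · field_simp
  · rw [mul_one]

end Deterministic

section Random

variable {Ω : Type u} [MeasurableSpace Ω] {μ : Measure Ω} {n m : ℕ}
  {grp : Fin n → Fin m} {p q δ : ℝ} {ν : Measure ℝ} {A ε : Ω → Matrix (Fin n) (Fin n) ℝ}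

namespace IsNoisyBlockModel

variable (hM : IsNoisyBlockModel μ grp p q ν A ε)
include hM

theorem adj_mem_Icc (ω : Ω) (i j : Fin n) : A ω i j ∈ Set.Icc (0 : ℝ) 1 := by
  rcases hM.adj_zero_or_one ω i j with h | h <;> rw [h] <;> simp

theorem integrable_adj [IsFiniteMeasure μ] (i j : Fin n) : Integrable (fun ω => A ω i j) μ :=
  Integrable.of_bound (hM.adj_measurable i j).aestronglyMeasurable 1
    (ae_of_all _ fun ω => by
      rw [Real.norm_of_nonneg (hM.adj_mem_Icc ω i j).1]; exact (hM.adj_mem_Icc ω i j).2)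

theorem integral_adj (i j : Fin n) : ∫ ω, A ω i j ∂μ = linkProb p q (grp i) (grp j) := by
  rw [← hM.adj_prob i j]
  have hs : MeasurableSet {ω | A ω i j = 1} :=
    (hM.adj_measurable i j) (measurableSet_singleton 1)
  rw [← integral_indicator_one hs]
  congr 1
  ext ω
  by_cases h : A ω i j = 1
  · rw [Set.indicator_of_mem (show ω ∈ {ω | A ω i j = 1} from h), h]; rfl
  · rw [Set.indicator_of_notMem (show ω ∉ {ω | A ω i j = 1} from h)]
    exact (hM.adj_zero_or_one ω i j).resolve_right h

theorem ae_noise_mem_Icc (hν : ∀ᵐ y ∂ν, y ∈ Set.Icc (0 : ℝ) 1) (i j : Fin n) :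
    ∀ᵐ ω ∂μ, ε ω i j ∈ Set.Icc (0 : ℝ) 1 := by
  rw [← hM.noise_law i j] at hν
  exact ae_of_ae_map (hM.noise_measurable i j).aemeasurable hν

theorem integrable_noise [IsFiniteMeasure μ] (hν : ∀ᵐ y ∂ν, y ∈ Set.Icc (0 : ℝ) 1) (i j : Fin n) :
    Integrable (fun ω => ε ω i j) μ := by
  refine Integrable.of_bound (hM.noise_measurable i j).aestronglyMeasurable 1 ?_
  filter_upwards [hM.ae_noise_mem_Icc hν i j] with ω h
  rw [Real.norm_of_nonneg h.1]; exact h.2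

theorem integral_noise (i j : Fin n) : ∫ ω, ε ω i j ∂μ = ∫ y, y ∂ν := by
  rw [← hM.noise_law i j]
  exact (integral_map (hM.noise_measurable i j).aemeasurable aestronglyMeasurable_id).symm

theorem expectedMatrix_perturb [IsFiniteMeasure μ]
    (hν : ∀ᵐ y ∂ν, y ∈ Set.Icc (0 : ℝ) 1) :
    expectedMatrix μ (perturb δ A ε) =
      linkMatrix grp (perturbedProb δ ν p) (perturbedProb δ ν q) := by
  ext i j
  simp only [expectedMatrix, perturb, linkMatrix, Matrix.of_apply]
  rw [integral_add ((hM.integrable_adj i j).const_mul _) ((hM.integrable_noise hν i j).const_mul _),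
    integral_const_mul, integral_const_mul, hM.integral_adj, hM.integral_noise]
  simp only [linkProb, perturbedProb]
  split_ifs <;> rfl

end IsNoisyBlockModel

end Random

theorem ae_mem_Icc_of_measure_eq_one {ν : Measure ℝ} [IsProbabilityMeasure ν]
    (hν : ν (Set.Icc 0 1) = 1) : ∀ᵐ y ∂ν, y ∈ Set.Icc (0 : ℝ) 1 :=
  mem_ae_iff_prob_eq_one measurableSet_Icc |>.2 hν

/-- For the expected network, `|λ₂|` is the function `lamTwo` of the weight ratio. -/
theorem absLambdaTwo_linkMatrix {n m : ℕ} {grp : Fin n → Fin m} {n₁ n₂ : ℕ} {p q : ℝ}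
    {φ : ℝ → ℝ → ℝ} (hφ : IsWeightFunction φ) (hm : 2 ≤ m)
    (hg : HasGroupSizes grp n₁ n₂) (h₁ : 0 < n₁) (h₂ : 0 < n₂) (hp : 0 < p) (hq : 0 < q) (α : ℝ) :
    absLambdaTwo (learningMatrix φ α (linkMatrix grp p q)) =
      lamTwo m (p / q) (weightRatio φ m n₁ n₂ p q α) := by
  rw [learningMatrix_linkMatrix hφ hm hg h₁ h₂ hp hq]
  exact BlockData.absLambdaTwo_eq ⟨hm, hg, h₁, h₂, div_pos hp hq,
    weightRatio_pos hφ hm h₁ h₂ hp hq α⟩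

theorem monotonicity_absLambdaTwo_linkMatrix {n m : ℕ} {grp : Fin n → Fin m} {n₁ n₂ : ℕ} {p q : ℝ}
    {φ : ℝ → ℝ → ℝ} (hφ : IsWeightFunction φ) (hm : 2 ≤ m)
    (hg : HasGroupSizes grp n₁ n₂) (h₁ : 0 < n₁) (h₂ : 0 < n₂) (hp : 0 < p) (hq : 0 < q)
    (hne : expDegOne m n₁ n₂ p q ≠ expDegTwo m n₁ n₂ p q) {I : Set ℝ} (hI : I.OrdConnected) :
    (I ⊆ decreaseRegion φ m n₁ n₂ p q → StrictAntiOn (fun α =>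
      absLambdaTwo (learningMatrix φ α (linkMatrix grp p q))) I) ∧
    (I ⊆ (decreaseRegion φ m n₁ n₂ p q)ᶜ → StrictMonoOn (fun α =>
      absLambdaTwo (learningMatrix φ α (linkMatrix grp p q))) I) := by
  have hρ1 : p / q ≠ 1 := by
    intro h
    rw [div_eq_one_iff_eq hq.ne'] at h
    apply hne
    rw [h, expDegOne, expDegTwo]
    ring
  simp only [absLambdaTwo_linkMatrix hφ hm hg h₁ h₂ hp hq]
  constructor
  · intro hsub α hα β hβ hαβ
    exact (isDescent_of_subset hφ hm h₁ h₂ hp hq hne hαβ ((hI.out hα hβ).trans hsub)).lamTwo_lt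
      hm (div_pos hp hq) hρ1 (weightRatio_pos hφ hm h₁ h₂ hp hq α)
      (weightRatio_pos hφ hm h₁ h₂ hp hq β)
  · intro hsub α hα β hβ hαβ
    exact (isDescent_of_subset_compl hφ hm h₁ h₂ hp hq hne hαβ
      ((hI.out hα hβ).trans hsub)).lamTwo_lt hm (div_pos hp hq) hρ1
      (weightRatio_pos hφ hm h₁ h₂ hp hq β) (weightRatio_pos hφ hm h₁ h₂ hp hq α)

end Expected

/-! ### Networks close to a block matrix -/

section NearBlock

open Matrix
open scoped Matrix.Norms.L2Operator

/-- The squared norm of the eigenvector of `lamB` for the weights `revWeight`, divided by `n₂²`. -/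
def eigNormSq (m : ℕ) (ρ x : ℝ) : ℝ :=
  x * rowOne m ρ x * eigOne m ρ x ^ 2 + (m - 1) * rowTwo m ρ x * eigTwo m ρ x ^ 2

/-- All the data of the block matrix are bounded by `C`, and bounded below by `1 / C` where this is
needed. -/
structure BlockBounds {n m : ℕ} (grp : Fin n → Fin m) (n₁ n₂ : ℕ) (ρ x C : ℝ) : Prop
    extends BlockData grp n₁ n₂ ρ x where
  one_le : 1 ≤ C
  m_le : (m : ℝ) ≤ C
  ρ_le : ρ ≤ C
  x_le : x ≤ C
  n_le : (n : ℝ) ≤ C * n₂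
  weight_le : n₂ * x / n₁ ≤ C
  weight_ge : 1 ≤ C * (n₂ * x / n₁)
  rowOne_le : rowOne m ρ x ≤ C
  rowTwo_le : rowTwo m ρ x ≤ C
  rowOne_ge : 1 ≤ C * rowOne m ρ x
  rowTwo_ge : 1 ≤ C * rowTwo m ρ x
  eigOne_le : eigOne m ρ x ≤ C
  eigTwo_ge : -C ≤ eigTwo m ρ x
  lamB_le : |lamB m ρ x| ≤ C
  critPoint_le : critPoint m ρ ≤ C
  eigNormSq_ge : 1 ≤ C * eigNormSq m ρ x

/-- The matrix `X` with weights `f` is close, up to the relative error `e`, to the block matrix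
with its weights. The bound `e_small` keeps the perturbed row sums comparable to `n`. -/
structure NearBlock {n m : ℕ} (grp : Fin n → Fin m) (n₁ n₂ : ℕ) (ρ x C e : ℝ)
    (X : Matrix (Fin n) (Fin n) ℝ) (f : Fin n → ℝ) : Prop
    extends BlockBounds grp n₁ n₂ ρ x C where
  e_nonneg : 0 ≤ e
  e_small : 6 * C ^ 4 * e ≤ 1
  nonneg : ∀ i j, 0 ≤ X i j
  norm_le : ‖toComplex (X - blockMatrix grp ρ)‖ ≤ e * n
  row_le : ∀ i k, |∑ j with grp j = k, (X - blockMatrix grp ρ) i j| ≤ e * n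
  weights : ∀ j, |f j - blockWeight grp n₁ n₂ x j| ≤ e * blockWeight grp n₁ n₂ x j

theorem abs_blockVec_le {n m : ℕ} {grp : Fin n → Fin m} {a b c : ℝ} (ha : |a| ≤ c) (hb : |b| ≤ c)
    (i : Fin n) : |blockVec grp a b i| ≤ c := by
  simp only [blockVec]; split_ifs <;> assumption

theorem norm_toLp_ofReal_le {n : ℕ} (v : Fin n → ℝ) {c : ℝ} (hc : 0 ≤ c) (h : ∀ i, |v i| ≤ c) :
    ‖WithLp.toLp 2 (fun i => (v i : ℂ))‖ ≤ √n * c := by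
  rw [EuclideanSpace.norm_eq]
  have h1 : ∑ i, ‖(WithLp.toLp 2 fun i => (v i : ℂ)).ofLp i‖ ^ 2 ≤ n * c ^ 2 := by
    have : ∀ i ∈ Finset.univ, ‖(WithLp.toLp 2 fun i => (v i : ℂ)).ofLp i‖ ^ 2 ≤ c ^ 2 := by
      intro i _
      simp only [Complex.norm_real, Real.norm_eq_abs]
      exact pow_le_pow_left₀ (abs_nonneg _) (h i) 2
    refine (Finset.sum_le_sum this).trans ?_
    simp
  calc _ ≤ √(n * c ^ 2) := Real.sqrt_le_sqrt h1
    _ = √n * c := by rw [Real.sqrt_mul (Nat.cast_nonneg n), Real.sqrt_sq hc]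

/-- A bilinear form in vectors with bounded entries is controlled by the operator norm. -/
theorem abs_bilin_le {n : ℕ} (Z : Matrix (Fin n) (Fin n) ℝ) (u v : Fin n → ℝ) {a b : ℝ}
    (ha : 0 ≤ a) (hb : 0 ≤ b) (hu : ∀ i, |u i| ≤ a) (hv : ∀ i, |v i| ≤ b) :
    |∑ i, ∑ j, u i * Z i j * v j| ≤ ‖toComplex Z‖ * n * (a * b) := by
  have h1 : ((∑ i, ∑ j, u i * Z i j * v j : ℝ) : ℂ) =
      inner ℂ (WithLp.toLp 2 (fun i => (u i : ℂ)))
        (WithLp.toLp 2 (toComplex Z *ᵥ fun i => (v i : ℂ))) := by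
    rw [EuclideanSpace.inner_eq_star_dotProduct]
    simp only [dotProduct, mulVec, Finset.sum_mul]
    push_cast
    refine Finset.sum_congr rfl fun i _ => Finset.sum_congr rfl fun j _ => ?_
    simp
    ring
  have h2 := norm_inner_le_norm (𝕜 := ℂ) (WithLp.toLp 2 (fun i => (u i : ℂ)))
    (WithLp.toLp 2 (toComplex Z *ᵥ fun i => (v i : ℂ)))
  rw [← h1, Complex.norm_real, Real.norm_eq_abs] at h2
  have h3 := norm_mulVec_toLp_le (toComplex Z) (fun i => (v i : ℂ))
  have h4 := norm_toLp_ofReal_le u ha hu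
  have h5 := norm_toLp_ofReal_le v hb hv
  calc _ ≤ (√n * a) * (‖toComplex Z‖ * (√n * b)) := by
        refine h2.trans ?_
        gcongr
        exact h3.trans (by gcongr)
    _ = (√n * √n) * (‖toComplex Z‖ * (a * b)) := by ring
    _ = _ := by rw [Real.mul_self_sqrt (Nat.cast_nonneg n)]; ring

/-- A matrix with entries bounded by `c` has operator norm at most `n c`. -/
theorem norm_toComplex_le {n : ℕ} (M : Matrix (Fin n) (Fin n) ℝ) {c : ℝ} (hc : 0 ≤ c)
    (h : ∀ i j, |M i j| ≤ c) : ‖toComplex M‖ ≤ c * n := by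
  rw [cstar_norm_def]
  refine ContinuousLinearMap.opNorm_le_bound _ (by positivity) fun u => ?_
  have h1 : ∀ i, ‖(toComplex M *ᵥ u.ofLp) i‖ ≤ c * (√n * ‖u‖) := by
    intro i
    simp only [mulVec, dotProduct]
    refine (norm_sum_le _ _).trans ?_
    have h2 : ∀ j ∈ Finset.univ, ‖toComplex M i j * u.ofLp j‖ ≤ c * ‖u.ofLp j‖ := by
      intro j _
      rw [norm_mul]
      gcongr
      simpa using h i j
    refine (Finset.sum_le_sum h2).trans ?_
    rw [← Finset.mul_sum]
    gcongr
    rw [EuclideanSpace.norm_eq, ← Real.sqrt_mul (Nat.cast_nonneg n)]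
    apply Real.le_sqrt_of_sq_le
    have := sq_sum_le_card_mul_sum_sq (s := Finset.univ) (f := fun j => ‖u.ofLp j‖)
    simpa using this
  have h3 : ‖toEuclideanCLM (n := Fin n) (𝕜 := ℂ) (toComplex M) u‖ ^ 2 ≤ (c * n * ‖u‖) ^ 2 := by
    rw [EuclideanSpace.norm_sq_eq]
    have h4 : ∀ i ∈ Finset.univ, ‖(toEuclideanCLM (n := Fin n) (𝕜 := ℂ) (toComplex M) u).ofLp i‖ ^ 2
        ≤ (c * (√n * ‖u‖)) ^ 2 := by
      intro i _
      rw [ofLp_toEuclideanCLM]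
      exact pow_le_pow_left₀ (norm_nonneg _) (h1 i) 2
    refine (Finset.sum_le_sum h4).trans (le_of_eq ?_)
    rw [Finset.sum_const, Finset.card_univ, Fintype.card_fin, nsmul_eq_mul, mul_pow, mul_pow,
      Real.sq_sqrt (Nat.cast_nonneg n)]
    ring
  exact le_of_sq_le_sq h3 (by positivity)

variable {n m : ℕ} {grp : Fin n → Fin m} {n₁ n₂ : ℕ} {ρ x C : ℝ}

namespace BlockBounds

variable (H : BlockBounds grp n₁ n₂ ρ x C)
include H

theorem n_pos' : (0 : ℝ) < n := by exact_mod_cast H.n_pos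

theorem n₂_le_n : (n₂ : ℝ) ≤ n := by
  have h := sum_blockVec H.two_le H.sizes 1 1
  simp only [blockVec, ite_self, Finset.sum_const, Finset.card_univ, Fintype.card_fin, nsmul_eq_mul,
    mul_one] at h
  have h1 := H.one_le_m_sub_one
  have h2 := H.n₁_pos'
  have h3 := H.n₂_pos'
  nlinarith

theorem blockWeight_le (i : Fin n) : blockWeight grp n₁ n₂ x i ≤ C := by
  unfold blockWeight blockVec
  split_ifs
  · exact H.weight_le
  · exact H.one_le

theorem blockWeight_ge (i : Fin n) : 1 ≤ C * blockWeight grp n₁ n₂ x i := by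
  unfold blockWeight blockVec
  split_ifs
  · exact H.weight_ge
  · rw [mul_one]; exact H.one_le

theorem blockMatrix_le (i j : Fin n) : blockMatrix grp ρ i j ≤ C := by
  simp only [blockMatrix, of_apply, linkProb]
  split_ifs
  · exact H.ρ_le
  · exact H.one_le

theorem row_sum_le (i : Fin n) :
    ∑ j, blockMatrix grp ρ i j * blockWeight grp n₁ n₂ x j ≤ C * n := by
  have h1 := H.n₂_le_n
  have h2 := H.one_le
  have h3 := H.n₂_pos'
  rw [H.row_sum]
  unfold blockVec
  split_ifs
  · nlinarith [H.rowOne_le, H.rowOne_pos]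
  · nlinarith [H.rowTwo_le, H.rowTwo_pos]

theorem row_sum_ge (i : Fin n) :
    n ≤ C ^ 2 * ∑ j, blockMatrix grp ρ i j * blockWeight grp n₁ n₂ x j := by
  have h0 := H.n_le
  have h2 := H.one_le
  have h3 := H.n₂_pos'
  have h4 : 0 < C * n₂ := by positivity
  rw [H.row_sum]
  unfold blockVec
  split_ifs
  · have := mul_le_mul_of_nonneg_left H.rowOne_ge h4.le
    nlinarith
  · have := mul_le_mul_of_nonneg_left H.rowTwo_ge h4.le
    nlinarith

theorem revWeight_bounds (i : Fin n) : n / C ^ 3 ≤ revWeight grp n₁ n₂ ρ x i ∧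
    revWeight grp n₁ n₂ ρ x i ≤ (C ^ 3) ^ 2 * (n / C ^ 3) := by
  have hC : 0 < C := one_pos.trans_le H.one_le
  have hn := H.n_pos'
  have hw := H.blockWeight_pos i
  have hs := H.row_sum_pos i
  rw [H.revWeight_eq]
  constructor
  · rw [div_le_iff₀ (by positivity)]
    calc (n : ℝ) ≤ 1 * (C ^ 2 * ∑ j, blockMatrix grp ρ i j * blockWeight grp n₁ n₂ x j) := by
          rw [one_mul]; exact H.row_sum_ge i
      _ ≤ (C * blockWeight grp n₁ n₂ x i) *
          (C ^ 2 * ∑ j, blockMatrix grp ρ i j * blockWeight grp n₁ n₂ x j) := by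
          gcongr; exact H.blockWeight_ge i
      _ = _ := by ring
  · have h1 : (C ^ 3) ^ 2 * (n / C ^ 3) = C * (C * (C * n)) := by field_simp
    rw [h1]
    have h2 := H.row_sum_le i
    have h3 := H.blockWeight_le i
    calc _ ≤ C * (C * n) := by gcongr
      _ = 1 * (C * (C * n)) := by ring
      _ ≤ C * (C * (C * n)) := by gcongr; exact H.one_le

theorem abs_eig_le (i : Fin n) : |blockVec grp (eigOne m ρ x) (eigTwo m ρ x) i| ≤ C := by
  have hC : 0 < C := one_pos.trans_le H.one_le
  apply abs_blockVec_le
  · rw [abs_of_pos H.eigOne_pos]; exact H.eigOne_le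
  · rw [abs_le]; exact ⟨H.eigTwo_ge, by linarith [H.eigTwo_neg]⟩

theorem eigNorm_eq : ∑ i, revWeight grp n₁ n₂ ρ x i *
    blockVec grp (eigOne m ρ x) (eigTwo m ρ x) i ^ 2 = n₂ ^ 2 * eigNormSq m ρ x := by
  simp only [pow_two (blockVec grp _ _ _), blockVec_mul]
  rw [H.sum_revWeight_blockVec, eigNormSq]
  ring

theorem eigNorm_ge : n ^ 2 ≤ C ^ 3 * (n₂ ^ 2 * eigNormSq m ρ x) := by
  have hC : 0 < C := one_pos.trans_le H.one_le
  have h1 : (n : ℝ) ^ 2 ≤ (C * n₂) ^ 2 := pow_le_pow_left₀ (Nat.cast_nonneg n) H.n_le 2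
  have h2 := mul_le_mul_of_nonneg_left H.eigNormSq_ge (show 0 ≤ (C * n₂) ^ 2 by positivity)
  nlinarith

end BlockBounds

variable {e : ℝ} {X : Matrix (Fin n) (Fin n) ℝ} {f : Fin n → ℝ}

namespace NearBlock

variable (H : NearBlock grp n₁ n₂ ρ x C e X f)
include H

theorem C_pos : 0 < C := one_pos.trans_le H.one_le

theorem one_le_pow (k : ℕ) : 1 ≤ C ^ k := one_le_pow₀ H.one_le

theorem e_le : e ≤ 1 / 6 := by
  have h1 := H.one_le_pow 4
  have h2 := H.e_small
  have h3 := H.e_nonneg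
  nlinarith

theorem abs_row_blockVec_le (a b : ℝ) {c : ℝ} (hc : 0 ≤ c) (ha : |a| ≤ c) (hb : |b| ≤ c)
    (i : Fin n) :
    |∑ j, (X - blockMatrix grp ρ) i j * blockVec grp a b j| ≤ C * c * e * n := by
  have he := H.e_nonneg
  rw [← Finset.sum_fiberwise Finset.univ grp]
  have h1 : ∀ k ∈ Finset.univ, |∑ j with grp j = k, (X - blockMatrix grp ρ) i j * blockVec grp a b j|
      ≤ c * (e * n) := by
    intro k _
    have h2 : ∑ j with grp j = k, (X - blockMatrix grp ρ) i j * blockVec grp a b j =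
        (if k.val = 0 then a else b) * ∑ j with grp j = k, (X - blockMatrix grp ρ) i j := by
      rw [Finset.mul_sum]
      refine Finset.sum_congr rfl fun j hj => ?_
      rw [blockVec, (Finset.mem_filter.1 hj).2, mul_comm]
    rw [h2, abs_mul]
    refine mul_le_mul ?_ (H.row_le i k) (abs_nonneg _) hc
    split_ifs <;> assumption
  refine (Finset.abs_sum_le_sum_abs _ _).trans ((Finset.sum_le_sum h1).trans ?_)
  rw [Finset.sum_const, Finset.card_univ, Fintype.card_fin, nsmul_eq_mul]
  have := H.m_le
  calc (m : ℝ) * (c * (e * n)) ≤ C * (c * (e * n)) := by gcongr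
    _ = _ := by ring

theorem row_total_le (i : Fin n) : ∑ j, X i j ≤ 2 * C * n := by
  have h1 := H.abs_row_blockVec_le 1 1 zero_le_one (by simp) (by simp) i
  have h2 : ∑ j, (X - blockMatrix grp ρ) i j * blockVec grp 1 1 j =
      ∑ j, X i j - ∑ j, blockMatrix grp ρ i j := by
    simp [blockVec]
  have h3 : ∑ j, blockMatrix grp ρ i j ≤ C * n := by
    refine (Finset.sum_le_sum fun j _ => H.blockMatrix_le i j).trans (le_of_eq ?_)
    simp [mul_comm]
  rw [h2] at h1
  have h4 := (abs_le.1 h1).2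
  have h5 := H.e_le
  have h6 := H.n_pos'
  have h7 := H.C_pos
  have h8 : C * 1 * e * n ≤ C * n := by
    have := mul_pos h7 h6
    nlinarith
  linarith

theorem abs_row_sum_sub_le (i : Fin n) :
    |∑ j, X i j * f j - ∑ j, blockMatrix grp ρ i j * blockWeight grp n₁ n₂ x j| ≤
      3 * C ^ 2 * e * n := by
  have hC := H.C_pos
  have he := H.e_nonneg
  have h0 : ∑ j, X i j * f j - ∑ j, blockMatrix grp ρ i j * blockWeight grp n₁ n₂ x j =
      ∑ j, (X - blockMatrix grp ρ) i j * blockWeight grp n₁ n₂ x j +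
        ∑ j, X i j * (f j - blockWeight grp n₁ n₂ x j) := by
    rw [← Finset.sum_add_distrib, ← Finset.sum_sub_distrib]
    refine Finset.sum_congr rfl fun j _ => ?_
    rw [Matrix.sub_apply]; ring
  have h1 := H.abs_row_blockVec_le (n₂ * x / n₁) 1 hC.le (by
    rw [abs_of_nonneg (by have := H.x_pos; positivity)]; exact H.weight_le)
    (by rw [abs_one]; exact H.one_le) i
  have h2 : |∑ j, X i j * (f j - blockWeight grp n₁ n₂ x j)| ≤ 2 * C * n * (e * C) := by
    refine (Finset.abs_sum_le_sum_abs _ _).trans ?_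
    have : ∀ j ∈ Finset.univ, |X i j * (f j - blockWeight grp n₁ n₂ x j)| ≤ X i j * (e * C) := by
      intro j _
      rw [abs_mul, abs_of_nonneg (H.nonneg i j)]
      refine mul_le_mul_of_nonneg_left ((H.weights j).trans ?_) (H.nonneg i j)
      exact mul_le_mul_of_nonneg_left (H.blockWeight_le j) he
    refine (Finset.sum_le_sum this).trans ?_
    rw [← Finset.sum_mul]
    exact mul_le_mul_of_nonneg_right (H.row_total_le i) (by positivity)
  rw [h0]
  refine (abs_add_le _ _).trans ((add_le_add h1 h2).trans (le_of_eq ?_))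
  ring

theorem row_sum_ge' (i : Fin n) : n ≤ 2 * C ^ 2 * ∑ j, X i j * f j := by
  have h1 := (abs_le.1 (H.abs_row_sum_sub_le i)).1
  have h2 := H.row_sum_ge i
  have h3 := H.e_small
  have h4 := H.n_pos'
  have h5 : 0 < C ^ 2 := by have := H.C_pos; positivity
  have h6 := mul_le_mul_of_nonneg_left h1 (show 0 ≤ 2 * C ^ 2 by positivity)
  have h7 := mul_le_mul_of_nonneg_right h3 h4.le
  nlinarith

theorem row_sum_pos' (i : Fin n) : 0 < ∑ j, X i j * f j := by
  have h1 := H.row_sum_ge' i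
  have h2 := H.n_pos'
  have h3 : 0 < 2 * C ^ 2 := by have := H.C_pos; positivity
  by_contra h
  rw [not_lt] at h
  nlinarith [mul_nonneg h3.le (neg_nonneg.2 h)]

theorem weight_pos' (j : Fin n) : 0 < f j := by
  have h1 := (abs_le.1 (H.weights j)).1
  have h2 := H.e_le
  have h3 := H.blockWeight_pos j
  nlinarith

theorem weight_le' (j : Fin n) : f j ≤ 2 * C := by
  have h1 := (abs_le.1 (H.weights j)).2
  have h2 := H.e_le
  have h3 := H.blockWeight_pos j
  have h4 := H.blockWeight_le j
  nlinarith

theorem inv_row_sum_le (i : Fin n) : (∑ j, X i j * f j)⁻¹ ≤ 2 * C ^ 2 / n := by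
  have h1 := H.row_sum_ge' i
  have h2 := H.n_pos'
  rw [inv_le_comm₀ (H.row_sum_pos' i) (by have := H.C_pos; positivity), inv_div,
    div_le_iff₀ (by have := H.C_pos; positivity)]
  linarith

theorem norm_rowNormalized_sub_le :
    ‖toComplex (rowNormalized X f - rowNormalized (blockMatrix grp ρ) (blockWeight grp n₁ n₂ x))‖ ≤
      12 * C ^ 8 * e := by
  have hC := H.C_pos
  have he := H.e_nonneg
  have hn := H.n_pos'
  set w := blockWeight grp n₁ n₂ x with hw
  set B := blockMatrix grp ρ with hB
  set s : Fin n → ℝ := fun i => ∑ j, X i j * f j with hs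
  set s' : Fin n → ℝ := fun i => ∑ j, B i j * w j with hs'
  set dg : (Fin n → ℝ) → Matrix (Fin n) (Fin n) ℂ := fun v => diagonal fun i => (v i : ℂ) with hdg
  have hdec : toComplex (rowNormalized X f - rowNormalized B w) =
      dg (fun i => (s i)⁻¹) * toComplex (X - B) * dg f +
      dg (fun i => (s i)⁻¹) * toComplex B * dg (fun j => f j - w j) +
      dg (fun i => (s i)⁻¹ - (s' i)⁻¹) * toComplex B * dg w := by
    ext i j
    simp only [hdg, Matrix.add_apply, mul_diagonal, diagonal_mul, map_apply, Matrix.sub_apply,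
      rowNormalized, of_apply, Complex.coe_algebraMap, hs, hs']
    push_cast
    ring
  have hnorm : ∀ (v : Fin n → ℝ) (c : ℝ), 0 ≤ c → (∀ i, |v i| ≤ c) → ‖dg v‖ ≤ c := by
    intro v c hc hv
    rw [hdg, l2_opNorm_diagonal, pi_norm_le_iff_of_nonneg hc]
    intro i
    rw [Complex.norm_real, Real.norm_eq_abs]; exact hv i
  have h1 : ‖dg (fun i => (s i)⁻¹)‖ ≤ 2 * C ^ 2 / n := by
    refine hnorm _ _ (by positivity) fun i => ?_
    rw [abs_of_pos (inv_pos.2 (H.row_sum_pos' i))]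
    exact H.inv_row_sum_le i
  have h2 : ‖dg f‖ ≤ 2 * C := hnorm _ _ (by positivity) fun i => by
    rw [abs_of_pos (H.weight_pos' i)]; exact H.weight_le' i
  have h3 : ‖dg (fun j => f j - w j)‖ ≤ e * C := hnorm _ _ (by positivity) fun i =>
    (H.weights i).trans (mul_le_mul_of_nonneg_left (H.blockWeight_le i) he)
  have h4 : ‖dg w‖ ≤ C := hnorm _ _ hC.le fun i => by
    rw [abs_of_pos (H.blockWeight_pos i)]; exact H.blockWeight_le i
  have h5 : ‖toComplex B‖ ≤ C * n := norm_toComplex_le _ hC.le fun i j => by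
    rw [abs_of_pos (blockMatrix_pos H.ρ_pos i j)]; exact H.blockMatrix_le i j
  have h6 : ‖dg (fun i => (s i)⁻¹ - (s' i)⁻¹)‖ ≤ 6 * C ^ 6 * e / n := by
    refine hnorm _ _ (by positivity) fun i => ?_
    have p1 := H.row_sum_pos' i
    have p2 := H.row_sum_pos i
    have p3 := H.inv_row_sum_le i
    have p4 : (s' i)⁻¹ ≤ C ^ 2 / n := by
      rw [inv_le_comm₀ p2 (by positivity), inv_div, div_le_iff₀ (by positivity), mul_comm]
      exact H.row_sum_ge i
    have p5 := H.abs_row_sum_sub_le i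
    have p6 : (s i)⁻¹ - (s' i)⁻¹ = -((s i - s' i) * ((s i)⁻¹ * (s' i)⁻¹)) := by
      have q1 : s i ≠ 0 := p1.ne'
      have q2 : s' i ≠ 0 := p2.ne'
      field_simp
      ring
    rw [p6, abs_neg, abs_mul, abs_mul, abs_of_pos (inv_pos.2 p1), abs_of_pos (inv_pos.2 p2)]
    calc _ ≤ 3 * C ^ 2 * e * n * (2 * C ^ 2 / n * (C ^ 2 / n)) := by
          have := inv_pos.2 p1
          have := inv_pos.2 p2
          gcongr
      _ = 6 * C ^ 6 * e / n := by field_simp; ring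
  have h7 : ‖toComplex (X - B)‖ ≤ e * n := H.norm_le
  rw [hdec]
  calc _ ≤ 2 * C ^ 2 / n * (e * n) * (2 * C) + 2 * C ^ 2 / n * (C * n) * (e * C) +
        6 * C ^ 6 * e / n * (C * n) * C := by
        refine (norm_add_le _ _).trans (add_le_add ((norm_add_le _ _).trans (add_le_add ?_ ?_)) ?_)
        · exact (norm_mul_le _ _).trans (mul_le_mul ((norm_mul_le _ _).trans
            (mul_le_mul h1 h7 (norm_nonneg _) (by positivity))) h2 (norm_nonneg _) (by positivity))
        · exact (norm_mul_le _ _).trans (mul_le_mul ((norm_mul_le _ _).trans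
            (mul_le_mul h1 h5 (norm_nonneg _) (by positivity))) h3 (norm_nonneg _) (by positivity))
        · exact (norm_mul_le _ _).trans (mul_le_mul ((norm_mul_le _ _).trans
            (mul_le_mul h6 h5 (norm_nonneg _) (by positivity))) h4 (norm_nonneg _) (by positivity))
    _ = (4 * C ^ 3 + 2 * C ^ 4 + 6 * C ^ 8) * e := by field_simp; ring
    _ ≤ 12 * C ^ 8 * e := by
        have q1 : C ^ 3 ≤ C ^ 8 := pow_le_pow_right₀ H.one_le (by norm_num)
        have q2 : C ^ 4 ≤ C ^ 8 := pow_le_pow_right₀ H.one_le (by norm_num)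
        gcongr
        linarith

end NearBlock

end NearBlock

/-! ### First-order term of the second eigenvalue -/

section FirstOrder

open Matrix
open scoped Matrix.Norms.L2Operator

variable {n m : ℕ} {grp : Fin n → Fin m} {n₁ n₂ : ℕ} {ρ x C : ℝ}

/-- The first-order change of `lamB` when the block matrix is perturbed by `Z` and the weights are
kept. -/
noncomputable def firstOrder (grp : Fin n → Fin m) (n₁ n₂ : ℕ) (ρ : ℝ)
    (Z : Matrix (Fin n) (Fin n) ℝ) (x : ℝ) : ℝ :=
  (∑ i, ∑ j, blockWeight grp n₁ n₂ x i * blockVec grp (eigOne m ρ x) (eigTwo m ρ x) i * Z i j *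
    (blockWeight grp n₁ n₂ x j * (blockVec grp (eigOne m ρ x) (eigTwo m ρ x) j -
      lamB m ρ x * blockVec grp (eigOne m ρ x) (eigTwo m ρ x) i))) / (n₂ ^ 2 * eigNormSq m ρ x)

namespace BlockData

variable (D : BlockData grp n₁ n₂ ρ x)
include D

theorem rowNormalized_mulVec_eig : rowNormalized (blockMatrix grp ρ) (blockWeight grp n₁ n₂ x) *ᵥ
    blockVec grp (eigOne m ρ x) (eigTwo m ρ x) =
      lamB m ρ x • blockVec grp (eigOne m ρ x) (eigTwo m ρ x) := by
  have h := D.mulVec_eig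
  have h0 : x * rowOne m ρ x * eigOne m ρ x + (m - 1) * rowTwo m ρ x * eigTwo m ρ x = 0 := by
    simp only [eigOne, eigTwo]; ring
  have h1 : statDist grp n₁ n₂ ρ x ⬝ᵥ blockVec grp (eigOne m ρ x) (eigTwo m ρ x) = 0 := by
    have h2 := D.sum_revWeight_blockVec (eigOne m ρ x) (eigTwo m ρ x)
    rw [h0, mul_zero] at h2
    simp only [dotProduct, statDist, div_mul_eq_mul_div, ← Finset.sum_div, h2, zero_div]
  rw [blockDeflated, sub_mulVec, vecMulVec_mulVec, h1] at h
  simpa using h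

theorem eigOne_add_eigTwo : eigOne m ρ x + eigTwo m ρ x = ρ * (critPoint m ρ ^ 2 - x ^ 2) := by
  have h := critPoint_sq D.two_le D.ρ_pos
  have h1 : ρ * (critPoint m ρ ^ 2 - x ^ 2) = (m - 1) * (ρ + (m - 2)) - ρ * x ^ 2 := by
    rw [← h]; ring
  rw [h1]
  simp only [eigOne, eigTwo, rowOne, rowTwo]
  ring

/-- The response of `lamB` to a change of the weight of vertex `j`. It vanishes at the critical
point, where the two values of the eigenvector are opposite. -/
theorem weight_response (j : Fin n) :
    ∑ i, blockWeight grp n₁ n₂ x i * blockVec grp (eigOne m ρ x) (eigTwo m ρ x) i *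
      (blockMatrix grp ρ i j * (blockVec grp (eigOne m ρ x) (eigTwo m ρ x) j -
        lamB m ρ x * blockVec grp (eigOne m ρ x) (eigTwo m ρ x) i)) =
    lamB m ρ x * (eigOne m ρ x ^ 2 - eigTwo m ρ x ^ 2) *
      blockVec grp ((m - 1) * n₂) (-(n₂ * x)) j := by
  have h1 := D.sum_blockMatrix_mul_eig j
  have h2 : ∑ i, blockMatrix grp ρ j i * (blockWeight grp n₁ n₂ x i *
      blockVec grp (eigOne m ρ x) (eigTwo m ρ x) i ^ 2) =
      blockVec grp (ρ * (n₂ * x * eigOne m ρ x ^ 2) + (m - 1) * (n₂ * (eigTwo m ρ x ^ 2)))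
        (n₂ * x * eigOne m ρ x ^ 2 + (ρ + (m - 2)) * (n₂ * (eigTwo m ρ x ^ 2))) j := by
    simp only [pow_two (blockVec grp _ _ _), blockWeight, blockVec_mul]
    rw [sum_blockMatrix_mul_blockVec D.two_le D.sizes]
    have h3 : (n₁ : ℝ) * (n₂ * x / n₁ * (eigOne m ρ x * eigOne m ρ x)) =
        n₂ * x * (eigOne m ρ x * eigOne m ρ x) := by
      rw [← mul_assoc, D.weight_mul]
    rw [h3]
    congr 1 <;> ring
  have h4 : ∑ i, blockWeight grp n₁ n₂ x i * blockVec grp (eigOne m ρ x) (eigTwo m ρ x) i *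
      (blockMatrix grp ρ i j * (blockVec grp (eigOne m ρ x) (eigTwo m ρ x) j -
        lamB m ρ x * blockVec grp (eigOne m ρ x) (eigTwo m ρ x) i)) =
      blockVec grp (eigOne m ρ x) (eigTwo m ρ x) j * (∑ i, blockMatrix grp ρ j i *
        (blockWeight grp n₁ n₂ x i * blockVec grp (eigOne m ρ x) (eigTwo m ρ x) i)) -
      lamB m ρ x * ∑ i, blockMatrix grp ρ j i * (blockWeight grp n₁ n₂ x i *
        blockVec grp (eigOne m ρ x) (eigTwo m ρ x) i ^ 2) := by
    rw [Finset.mul_sum, Finset.mul_sum, ← Finset.sum_sub_distrib]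
    refine Finset.sum_congr rfl fun i _ => ?_
    rw [blockMatrix_symm i j]; ring
  rw [h4, h1, h2]
  simp only [blockVec]
  split_ifs
  · simp only [rowOne]; ring
  · simp only [rowTwo]; ring

end BlockData

variable {e : ℝ} {X : Matrix (Fin n) (Fin n) ℝ} {f : Fin n → ℝ}

namespace NearBlock

variable (H : NearBlock grp n₁ n₂ ρ x C e X f)
include H

theorem eta_le : C ^ 3 * ‖toComplex (rowNormalized X f -
    rowNormalized (blockMatrix grp ρ) (blockWeight grp n₁ n₂ x))‖ ≤ 12 * C ^ 11 * e := by
  have hC := H.C_pos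
  calc _ ≤ C ^ 3 * (12 * C ^ 8 * e) := by gcongr; exact H.norm_rowNormalized_sub_le
    _ = _ := by ring

theorem absLambdaTwo_near (hsmall : 60 * C ^ 11 * e < lamTwo m ρ x) :
    absLambdaTwo (rowNormalized X f) ≤ lamTwo m ρ x + 12 * C ^ 11 * e ∧
      lamTwo m ρ x - 48 * C ^ 11 * e ≤ absLambdaTwo (rowNormalized X f) := by
  have hC := H.C_pos
  have hn := H.n_pos'
  have h := H.toBlockData.absLambdaTwo_perturb (a := n / C ^ 3) (κ := C ^ 3) (by positivity)
    (by positivity) H.revWeight_bounds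
    (T := rowNormalized X f) (rowNormalized_nonneg H.nonneg fun j => (H.weight_pos' j).le)
    (fun i => rowNormalized_row_sum i (H.row_sum_pos' i).ne') H.eta_le (by linarith)
  exact ⟨h.1, by linarith [h.2]⟩

theorem abs_eig_sub_le (i j : Fin n) : |blockVec grp (eigOne m ρ x) (eigTwo m ρ x) j -
    lamB m ρ x * blockVec grp (eigOne m ρ x) (eigTwo m ρ x) i| ≤ 2 * C ^ 2 := by
  have hC := H.C_pos
  have h1 := H.abs_eig_le j
  have h2 : |lamB m ρ x * blockVec grp (eigOne m ρ x) (eigTwo m ρ x) i| ≤ C * C := by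
    rw [abs_mul]
    exact mul_le_mul H.lamB_le (H.abs_eig_le i) (abs_nonneg _) hC.le
  have h3 := H.one_le
  refine (abs_sub _ _).trans ?_
  nlinarith

theorem abs_residual_le (i : Fin n) :
    |∑ j, X i j * f j * (blockVec grp (eigOne m ρ x) (eigTwo m ρ x) j -
      lamB m ρ x * blockVec grp (eigOne m ρ x) (eigTwo m ρ x) i)| ≤ 6 * C ^ 4 * e * n := by
  have hC := H.C_pos
  have he := H.e_nonneg
  set y := blockVec grp (eigOne m ρ x) (eigTwo m ρ x) with hy
  set w := blockWeight grp n₁ n₂ x with hw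
  have hzero : ∑ j, blockMatrix grp ρ i j * (w j * (y j - lamB m ρ x * y i)) = 0 := by
    have h1 := H.sum_blockMatrix_mul_eig i
    have h2 := H.row_sum i
    rw [← h2] at h1
    have h3 : ∑ j, blockMatrix grp ρ i j * (w j * (y j - lamB m ρ x * y i)) =
      ∑ j, blockMatrix grp ρ i j * (w j * y j) -
        lamB m ρ x * ((∑ j, blockMatrix grp ρ i j * w j) * y i) := by
      rw [Finset.sum_mul, Finset.mul_sum, ← Finset.sum_sub_distrib]
      exact Finset.sum_congr rfl fun j _ => by ring
    rw [h3, h1, sub_self]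
  have hdec : ∑ j, X i j * f j * (y j - lamB m ρ x * y i) =
      ∑ j, (X - blockMatrix grp ρ) i j * (w j * (y j - lamB m ρ x * y i)) +
        ∑ j, X i j * ((f j - w j) * (y j - lamB m ρ x * y i)) := by
    rw [← sub_zero (∑ j, X i j * f j * (y j - lamB m ρ x * y i)), ← hzero,
      ← Finset.sum_add_distrib, ← Finset.sum_sub_distrib]
    refine Finset.sum_congr rfl fun j _ => ?_
    rw [Matrix.sub_apply]; ring
  have hb : ∀ j, w j * (y j - lamB m ρ x * y i) =
      blockVec grp (n₂ * x / n₁ * (eigOne m ρ x - lamB m ρ x * y i))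
        (1 * (eigTwo m ρ x - lamB m ρ x * y i)) j := by
    intro j
    simp only [hw, hy, blockWeight, blockVec]
    split_ifs <;> rfl
  have hlamy : |lamB m ρ x * y i| ≤ C * C := by
    rw [abs_mul]
    exact mul_le_mul H.lamB_le (H.abs_eig_le i) (abs_nonneg _) hC.le
  have hCC : C ≤ C * C := by nlinarith [H.one_le]
  have h1 : |∑ j, (X - blockMatrix grp ρ) i j * (w j * (y j - lamB m ρ x * y i))| ≤
      C * (C * (2 * C ^ 2)) * e * n := by
    rw [Finset.sum_congr rfl fun j _ => by rw [hb j]]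
    have hw1 : |(n₂ * x / n₁ : ℝ)| ≤ C := by
      rw [abs_of_nonneg (by have := H.x_pos; positivity)]; exact H.weight_le
    have e1 : |eigOne m ρ x| ≤ C := by rw [abs_of_pos H.eigOne_pos]; exact H.eigOne_le
    have e2 : |eigTwo m ρ x| ≤ C := by
      rw [abs_le]; exact ⟨H.eigTwo_ge, by linarith [H.eigTwo_neg]⟩
    apply H.abs_row_blockVec_le _ _ (by positivity)
    · rw [abs_mul]
      refine mul_le_mul hw1 ?_ (abs_nonneg _) hC.le
      refine (abs_sub _ _).trans ?_
      nlinarith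
    · rw [abs_mul, abs_one]
      refine mul_le_mul H.one_le ?_ (abs_nonneg _) hC.le
      refine (abs_sub _ _).trans ?_
      nlinarith
  have h2 : |∑ j, X i j * ((f j - w j) * (y j - lamB m ρ x * y i))| ≤
      2 * C * n * (e * C * (2 * C ^ 2)) := by
    refine (Finset.abs_sum_le_sum_abs _ _).trans ?_
    have h3 : ∀ j ∈ Finset.univ, |X i j * ((f j - w j) * (y j - lamB m ρ x * y i))| ≤
        X i j * (e * C * (2 * C ^ 2)) := by
      intro j _
      rw [abs_mul, abs_mul, abs_of_nonneg (H.nonneg i j)]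
      refine mul_le_mul_of_nonneg_left ?_ (H.nonneg i j)
      refine mul_le_mul ((H.weights j).trans ?_) (H.abs_eig_sub_le i j) (abs_nonneg _)
        (by positivity)
      exact mul_le_mul_of_nonneg_left (H.blockWeight_le j) he
    refine (Finset.sum_le_sum h3).trans ?_
    rw [← Finset.sum_mul]
    exact mul_le_mul_of_nonneg_right (H.row_total_le i) (by positivity)
  rw [hdec]
  refine (abs_add_le _ _).trans ((add_le_add h1 h2).trans (le_of_eq ?_))
  ring

/-- Up to terms of second order, only the perturbation of the matrix at fixed weights and the
deviation from the critical point contribute to the change of `lamB`. -/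
theorem abs_firstOrder_sub_le :
    |(∑ i, revWeight grp n₁ n₂ ρ x i * blockVec grp (eigOne m ρ x) (eigTwo m ρ x) i *
        ((rowNormalized X f - rowNormalized (blockMatrix grp ρ) (blockWeight grp n₁ n₂ x)) *ᵥ
          blockVec grp (eigOne m ρ x) (eigTwo m ρ x)) i) / (n₂ ^ 2 * eigNormSq m ρ x) -
      firstOrder grp n₁ n₂ ρ (X - blockMatrix grp ρ) x| ≤
    40 * C ^ 13 * e ^ 2 + 4 * C ^ 10 * e * |x - critPoint m ρ| := by
  have hC := H.C_pos
  have he := H.e_nonneg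
  have hn := H.n_pos'
  have hN : 0 < n₂ ^ 2 * eigNormSq m ρ x := by
    have h1 := H.eigNorm_ge
    have h2 : 0 < C ^ 3 := by positivity
    by_contra h
    rw [not_lt] at h
    nlinarith [mul_nonneg h2.le (neg_nonneg.2 h), pow_pos hn 2]
  rw [firstOrder, ← sub_div, abs_div, abs_of_pos hN, div_le_iff₀ hN]
  set y := blockVec grp (eigOne m ρ x) (eigTwo m ρ x) with hy
  set w := blockWeight grp n₁ n₂ x with hw
  set Z := X - blockMatrix grp ρ with hZ
  set l := lamB m ρ x with hl
  set s : Fin n → ℝ := fun i => ∑ j, X i j * f j with hs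
  set s' : Fin n → ℝ := fun i => ∑ j, blockMatrix grp ρ i j * w j with hs'
  set I : Fin n → ℝ := fun i => ∑ j, X i j * f j * (y j - l * y i) with hI
  -- the contribution of each row is its residual, divided by the perturbed row sum
  have hterm : ∀ i, revWeight grp n₁ n₂ ρ x i * y i *
      ((rowNormalized X f - rowNormalized (blockMatrix grp ρ) w) *ᵥ y) i =
      w i * y i * I i + w i * y i * ((s' i - s i) * (s i)⁻¹ * I i) := by
    intro i
    have h1 : (rowNormalized (blockMatrix grp ρ) w *ᵥ y) i = l * y i := by
      rw [H.rowNormalized_mulVec_eig]; rfl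
    have p1 : s i ≠ 0 := (H.row_sum_pos' i).ne'
    have h2 : (rowNormalized X f *ᵥ y) i - l * y i = I i * (s i)⁻¹ := by
      have h3 : (rowNormalized X f *ᵥ y) i = (∑ j, X i j * f j * y j) * (s i)⁻¹ := by
        simp only [mulVec, dotProduct, rowNormalized, of_apply, Finset.sum_mul, hs]
        exact Finset.sum_congr rfl fun j _ => by ring
      have h4 : I i = ∑ j, X i j * f j * y j - l * y i * s i := by
        simp only [hI, hs, Finset.mul_sum, ← Finset.sum_sub_distrib]
        exact Finset.sum_congr rfl fun j _ => by ring
      rw [h3, h4]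
      field_simp
    rw [sub_mulVec, Pi.sub_apply, h1, h2, H.revWeight_eq i]
    change w i * s' i * y i * (I i * (s i)⁻¹) = _
    have h5 : (s i)⁻¹ * s i = 1 := inv_mul_cancel₀ p1
    linear_combination (w i * y i * I i) * h5
  have hwb : ∀ i, |w i| ≤ C := fun i => by
    rw [abs_of_pos (H.blockWeight_pos i)]; exact H.blockWeight_le i
  have hyb : ∀ i, |y i| ≤ C := fun i => H.abs_eig_le i
  have hwy : ∀ i, |w i * y i| ≤ C ^ 2 := fun i => by
    rw [abs_mul, pow_two]
    exact mul_le_mul (hwb i) (hyb i) (abs_nonneg _) hC.le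
  have hR1 : |∑ i, w i * y i * ((s' i - s i) * (s i)⁻¹ * I i)| ≤ 36 * C ^ 10 * e ^ 2 * n ^ 2 := by
    have h1 : ∀ i ∈ Finset.univ, |w i * y i * ((s' i - s i) * (s i)⁻¹ * I i)| ≤
        C ^ 2 * (3 * C ^ 2 * e * n * (2 * C ^ 2 / n) * (6 * C ^ 4 * e * n)) := by
      intro i _
      have h2 := H.abs_row_sum_sub_le i
      have h3 := H.inv_row_sum_le i
      have h4 := H.abs_residual_le i
      have h5 := inv_pos.2 (H.row_sum_pos' i)
      rw [abs_mul (w i * y i), abs_mul (_ * _) (I i), abs_mul (s' i - s i), abs_sub_comm (s' i),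
        abs_of_pos h5]
      have h6 := hwy i
      gcongr
    refine (Finset.abs_sum_le_sum_abs _ _).trans ((Finset.sum_le_sum h1).trans (le_of_eq ?_))
    rw [Finset.sum_const, Finset.card_univ, Fintype.card_fin, nsmul_eq_mul]
    field_simp
    ring
  have hdec : ∀ i, w i * y i * I i =
      ∑ j, w i * y i * Z i j * (w j * (y j - l * y i)) +
      (∑ j, w i * y i * (blockMatrix grp ρ i j * (y j - l * y i)) * (f j - w j) +
      (∑ j, w i * y i * Z i j * ((f j - w j) * y j) -
        ∑ j, l * (w i * y i ^ 2) * Z i j * (f j - w j))) := by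
    intro i
    have hzero : ∑ j, blockMatrix grp ρ i j * (w j * (y j - l * y i)) = 0 := by
      have h1 := H.sum_blockMatrix_mul_eig i
      have h2 := H.row_sum i
      rw [← h2] at h1
      have h3 : ∑ j, blockMatrix grp ρ i j * (w j * (y j - l * y i)) =
        ∑ j, blockMatrix grp ρ i j * (w j * y j) -
          l * ((∑ j, blockMatrix grp ρ i j * w j) * y i) := by
        rw [Finset.sum_mul, Finset.mul_sum, ← Finset.sum_sub_distrib]
        exact Finset.sum_congr rfl fun j _ => by ring
      rw [h3, h1, sub_self]
    have h0 : w i * y i * I i =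
        w i * y i * (I i - ∑ j, blockMatrix grp ρ i j * (w j * (y j - l * y i))) := by
      rw [hzero, sub_zero]
    rw [h0, hI, ← Finset.sum_sub_distrib, ← Finset.sum_sub_distrib, ← Finset.sum_add_distrib,
      ← Finset.sum_add_distrib, Finset.mul_sum]
    refine Finset.sum_congr rfl fun j _ => ?_
    rw [hZ, Matrix.sub_apply]
    ring
  have hfw : ∀ j, |f j - w j| ≤ e * C := fun j =>
    (H.weights j).trans (mul_le_mul_of_nonneg_left (H.blockWeight_le j) he)
  have hQ3 : |∑ i, ∑ j, w i * y i * Z i j * ((f j - w j) * y j)| ≤ C ^ 4 * e ^ 2 * n ^ 2 := by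
    refine (abs_bilin_le Z _ _ (a := C ^ 2) (b := e * C * C) (by positivity) (by positivity)
      hwy fun j => ?_).trans ?_
    · rw [abs_mul]
      exact mul_le_mul (hfw j) (hyb j) (abs_nonneg _) (by positivity)
    · calc _ ≤ e * n * n * (C ^ 2 * (e * C * C)) := by gcongr; exact H.norm_le
        _ = _ := by ring
  have hQ4 : |∑ i, ∑ j, l * (w i * y i ^ 2) * Z i j * (f j - w j)| ≤ C ^ 5 * e ^ 2 * n ^ 2 := by
    refine (abs_bilin_le Z _ _ (a := C * (C * C ^ 2)) (b := e * C) (by positivity) (by positivity)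
      (fun i => ?_) hfw).trans ?_
    · rw [abs_mul, abs_mul, abs_pow]
      have h1 := H.lamB_le
      have h2 := hwb i
      have h3 := hyb i
      gcongr
    · calc _ ≤ e * n * n * (C * (C * C ^ 2) * (e * C)) := by gcongr; exact H.norm_le
        _ = _ := by ring
  have hQ2 : |∑ i, ∑ j, w i * y i * (blockMatrix grp ρ i j * (y j - l * y i)) * (f j - w j)| ≤
      4 * C ^ 7 * e * |x - critPoint m ρ| * n ^ 2 := by
    rw [Finset.sum_comm]
    have h1 : ∀ j ∈ Finset.univ,
        |∑ i, w i * y i * (blockMatrix grp ρ i j * (y j - l * y i)) * (f j - w j)| ≤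
        4 * C ^ 7 * e * |x - critPoint m ρ| * n := by
      intro j _
      rw [← Finset.sum_mul, H.weight_response j, abs_mul, abs_mul, abs_mul]
      have e1 : |eigOne m ρ x ^ 2 - eigTwo m ρ x ^ 2| ≤
          C * (|x - critPoint m ρ| * (2 * C)) * (2 * C) := by
        have h2 : eigOne m ρ x ^ 2 - eigTwo m ρ x ^ 2 =
            ρ * ((critPoint m ρ - x) * (critPoint m ρ + x)) * (eigOne m ρ x - eigTwo m ρ x) := by
          have h3 := H.eigOne_add_eigTwo
          linear_combination (eigOne m ρ x - eigTwo m ρ x) * h3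
        have h4 := H.x_pos
        have h5 := H.x_le
        have h6 := H.critPoint_le
        have h7 : 0 ≤ critPoint m ρ := Real.sqrt_nonneg _
        have h8 := H.ρ_pos
        have h9 := H.ρ_le
        have h10 := H.eigOne_pos
        have h11 := H.eigTwo_neg
        have h12 := H.eigOne_le
        have h13 := H.eigTwo_ge
        rw [h2, abs_mul, abs_mul, abs_mul, abs_of_pos h8, abs_sub_comm (critPoint m ρ) x,
          abs_of_nonneg (show 0 ≤ critPoint m ρ + x by linarith),
          abs_of_pos (show 0 < eigOne m ρ x - eigTwo m ρ x by linarith)]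
        gcongr
        · linarith
        · linarith
        · linarith
      have e2 : |blockVec grp ((m - 1) * n₂) (-(n₂ * x)) j| ≤ C * n := by
        have h1 := H.one_le_m_sub_one
        have h2 := H.n₂_pos'
        have h3 := H.n₂_le_n
        have h4 := H.m_le
        have h5 := H.x_pos
        have h6 := H.x_le
        apply abs_blockVec_le
        · rw [abs_of_nonneg (by nlinarith)]
          exact mul_le_mul (by linarith) h3 h2.le hC.le
        · rw [abs_neg, abs_of_nonneg (by positivity), mul_comm C]
          exact mul_le_mul h3 h6 h5.le hn.le
      have e3 := H.lamB_le
      have e4 := hfw j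
      calc _ ≤ C * (C * (|x - critPoint m ρ| * (2 * C)) * (2 * C)) * (C * n) * (e * C) := by
            gcongr
        _ = 4 * C ^ 6 * e * |x - critPoint m ρ| * n := by ring
        _ ≤ _ := by
            have : C ^ 6 ≤ C ^ 7 := pow_le_pow_right₀ H.one_le (by norm_num)
            gcongr
    refine (Finset.abs_sum_le_sum_abs _ _).trans ((Finset.sum_le_sum h1).trans (le_of_eq ?_))
    rw [Finset.sum_const, Finset.card_univ, Fintype.card_fin, nsmul_eq_mul]
    ring
  have hfinal : ∑ i, revWeight grp n₁ n₂ ρ x i * y i *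
      ((rowNormalized X f - rowNormalized (blockMatrix grp ρ) w) *ᵥ y) i -
        ∑ i, ∑ j, w i * y i * Z i j * (w j * (y j - l * y i)) =
      ∑ i, w i * y i * ((s' i - s i) * (s i)⁻¹ * I i) +
      (∑ i, ∑ j, w i * y i * (blockMatrix grp ρ i j * (y j - l * y i)) * (f j - w j) +
      (∑ i, ∑ j, w i * y i * Z i j * ((f j - w j) * y j) -
        ∑ i, ∑ j, l * (w i * y i ^ 2) * Z i j * (f j - w j))) := by
    rw [Finset.sum_congr rfl fun i _ => hterm i, Finset.sum_add_distrib,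
      Finset.sum_congr rfl fun i _ => hdec i, Finset.sum_add_distrib, Finset.sum_add_distrib,
      Finset.sum_sub_distrib]
    ring
  rw [hfinal]
  have hsum : |∑ i, w i * y i * ((s' i - s i) * (s i)⁻¹ * I i) +
      (∑ i, ∑ j, w i * y i * (blockMatrix grp ρ i j * (y j - l * y i)) * (f j - w j) +
      (∑ i, ∑ j, w i * y i * Z i j * ((f j - w j) * y j) -
        ∑ i, ∑ j, l * (w i * y i ^ 2) * Z i j * (f j - w j)))| ≤
      36 * C ^ 10 * e ^ 2 * n ^ 2 + (4 * C ^ 7 * e * |x - critPoint m ρ| * n ^ 2 +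
        (C ^ 4 * e ^ 2 * n ^ 2 + C ^ 5 * e ^ 2 * n ^ 2)) :=
    (abs_add_le _ _).trans (add_le_add hR1 ((abs_add_le _ _).trans (add_le_add hQ2
      ((abs_sub _ _).trans (add_le_add hQ3 hQ4)))))
  refine hsum.trans ?_
  have h1 := H.eigNorm_ge
  have h2 : C ^ 4 ≤ C ^ 10 := pow_le_pow_right₀ H.one_le (by norm_num)
  have h3 : C ^ 5 ≤ C ^ 10 := pow_le_pow_right₀ H.one_le (by norm_num)
  calc _ = (36 * C ^ 10 * e ^ 2 + 4 * C ^ 7 * e * |x - critPoint m ρ| + C ^ 4 * e ^ 2 +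
        C ^ 5 * e ^ 2) * n ^ 2 := by ring
    _ ≤ (40 * C ^ 10 * e ^ 2 + 4 * C ^ 7 * e * |x - critPoint m ρ|) * n ^ 2 := by
        have h4 := mul_le_mul_of_nonneg_right h2 (sq_nonneg e)
        have h5 := mul_le_mul_of_nonneg_right h3 (sq_nonneg e)
        have h6 : 0 ≤ C ^ 10 * e ^ 2 := by positivity
        refine mul_le_mul_of_nonneg_right ?_ (by positivity)
        linarith
    _ ≤ (40 * C ^ 10 * e ^ 2 + 4 * C ^ 7 * e * |x - critPoint m ρ|) *
        (C ^ 3 * (n₂ ^ 2 * eigNormSq m ρ x)) := by gcongr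
    _ = _ := by ring

end NearBlock

end FirstOrder

/-! ### Uniform bounds on compact parameter sets -/

section Uniform

open Matrix
open scoped Matrix.Norms.L2Operator

/-- Bounds that also keep the densities comparable and apart from each other. -/
structure SeparatedBounds {n m : ℕ} (grp : Fin n → Fin m) (n₁ n₂ : ℕ) (ρ x C : ℝ) : Prop
    extends BlockBounds grp n₁ n₂ ρ x C where
  ρ_ge : 1 ≤ C * ρ
  x_ge : 1 ≤ C * x
  sep : 1 ≤ C * |ρ - 1|

/-- The parameters `(ρ, x)` under consideration. -/
def paramBox (K : ℝ) : Set (ℝ × ℝ) := Set.Icc K⁻¹ K ×ˢ Set.Icc K⁻¹ K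

theorem isCompact_paramBox (K : ℝ) : IsCompact (paramBox K) := isCompact_Icc.prod isCompact_Icc

theorem convex_paramBox (K : ℝ) : Convex ℝ (paramBox K) := (convex_Icc _ _).prod (convex_Icc _ _)

theorem eventually_le_of_continuousOn {K : ℝ} {F : ℝ × ℝ → ℝ} (hF : ContinuousOn F (paramBox K)) :
    ∀ᶠ C in atTop, ∀ v ∈ paramBox K, F v ≤ C := by
  obtain ⟨C₀, hC₀⟩ := (isCompact_paramBox K).bddAbove_image hF
  filter_upwards [eventually_ge_atTop C₀] with C hC v hv
  exact (hC₀ (Set.mem_image_of_mem F hv)).trans hC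

theorem eventually_abs_le_of_continuousOn {K : ℝ} {F : ℝ × ℝ → ℝ}
    (hF : ContinuousOn F (paramBox K)) : ∀ᶠ C in atTop, ∀ v ∈ paramBox K, |F v| ≤ C :=
  eventually_le_of_continuousOn hF.abs

theorem eventually_one_le_mul_of_continuousOn {K : ℝ} {F : ℝ × ℝ → ℝ}
    (hF : ContinuousOn F (paramBox K)) (hpos : ∀ v ∈ paramBox K, 0 < F v) :
    ∀ᶠ C in atTop, ∀ v ∈ paramBox K, 1 ≤ C * F v := by
  filter_upwards [eventually_le_of_continuousOn (hF.inv₀ fun v hv => (hpos v hv).ne')]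
    with C hC v hv
  have h := mul_le_mul_of_nonneg_right (hC v hv) (hpos v hv).le
  rwa [Pi.inv_apply, inv_mul_cancel₀ (hpos v hv).ne'] at h

theorem eventually_lipschitz_of_contDiffOn {K : ℝ} {F : ℝ × ℝ → ℝ}
    (hF : ContDiffOn ℝ 1 F (paramBox K)) :
    ∀ᶠ C in atTop, ∀ ρ x₀ x₁, (ρ, x₀) ∈ paramBox K → (ρ, x₁) ∈ paramBox K →
      |F (ρ, x₀) - F (ρ, x₁)| ≤ C * |x₀ - x₁| := by
  obtain ⟨k, hk⟩ := hF.exists_lipschitzOnWith (by norm_num) (convex_paramBox K)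
    (isCompact_paramBox K)
  filter_upwards [eventually_ge_atTop (k : ℝ)] with C hC ρ x₀ x₁ h₀ h₁
  have h := hk.dist_le_mul _ h₀ _ h₁
  rw [Real.dist_eq, Prod.dist_eq, dist_self, Real.dist_eq, max_eq_right (abs_nonneg _)] at h
  exact h.trans (by gcongr)

variable {m : ℕ} {K : ℝ}

theorem pos_of_mem_paramBox (hK : 0 < K) {v : ℝ × ℝ} (hv : v ∈ paramBox K) : 0 < v.1 ∧ 0 < v.2 :=
  ⟨(inv_pos.2 hK).trans_le hv.1.1, (inv_pos.2 hK).trans_le hv.2.1⟩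

theorem eigNormSq_pos (hm : 2 ≤ m) {ρ x : ℝ} (hρ : 0 < ρ) (hx : 0 < x) : 0 < eigNormSq m ρ x := by
  have hm' : (2 : ℝ) ≤ m := by exact_mod_cast hm
  have h1 := rowOne_pos_of hm hρ hx
  have h2 := rowTwo_pos_of hm hρ hx
  have h3 : (0 : ℝ) < m - 1 := by linarith
  unfold eigNormSq eigOne eigTwo
  positivity

theorem contDiffOn_eigNormSq : ContDiffOn ℝ 1 (fun v : ℝ × ℝ => eigNormSq m v.1 v.2)
    (paramBox K) := by
  unfold eigNormSq eigOne eigTwo rowOne rowTwo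
  fun_prop

theorem contDiffOn_eigOne : ContDiffOn ℝ 1 (fun v : ℝ × ℝ => eigOne m v.1 v.2) (paramBox K) := by
  unfold eigOne rowTwo
  fun_prop

theorem contDiffOn_eigTwo : ContDiffOn ℝ 1 (fun v : ℝ × ℝ => eigTwo m v.1 v.2) (paramBox K) := by
  unfold eigTwo rowOne
  fun_prop

theorem contDiffOn_rowOne : ContDiffOn ℝ 1 (fun v : ℝ × ℝ => rowOne m v.1 v.2) (paramBox K) := by
  unfold rowOne
  fun_prop

theorem contDiffOn_rowTwo : ContDiffOn ℝ 1 (fun v : ℝ × ℝ => rowTwo m v.1 v.2) (paramBox K) := by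
  unfold rowTwo
  fun_prop

theorem contDiffOn_lamB (hm : 2 ≤ m) (hK : 0 < K) :
    ContDiffOn ℝ 1 (fun v : ℝ × ℝ => lamB m v.1 v.2) (paramBox K) := by
  unfold lamB
  refine ContDiffOn.div (by fun_prop) (contDiffOn_rowOne.mul contDiffOn_rowTwo) fun v hv => ?_
  obtain ⟨h1, h2⟩ := pos_of_mem_paramBox hK hv
  exact (mul_pos (rowOne_pos_of hm h1 h2) (rowTwo_pos_of hm h1 h2)).ne'

theorem continuousOn_critPoint (hK : 0 < K) :
    ContinuousOn (fun v : ℝ × ℝ => critPoint m v.1) (paramBox K) := by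
  unfold critPoint
  refine ContinuousOn.sqrt (ContinuousOn.div (by fun_prop) (by fun_prop) fun v hv => ?_)
  exact (pos_of_mem_paramBox hK hv).1.ne'

/-- A single constant serves for all block matrices with parameters in a compact set. -/
theorem eventually_separatedBounds (hm : 2 ≤ m) (hK : 0 < K) : ∀ᶠ C in atTop,
    ∀ {n : ℕ} {grp : Fin n → Fin m} {n₁ n₂ : ℕ} {ρ x : ℝ}, BlockData grp n₁ n₂ ρ x →
      (ρ, x) ∈ paramBox K → K⁻¹ ≤ |ρ - 1| → (n : ℝ) ≤ K * n₁ → (n : ℝ) ≤ K * n₂ →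
      SeparatedBounds grp n₁ n₂ ρ x C := by
  have hpos := fun v hv => pos_of_mem_paramBox (v := v) hK hv
  filter_upwards [eventually_ge_atTop 1, eventually_ge_atTop (m : ℝ), eventually_ge_atTop K,
    eventually_ge_atTop (K * K),
    eventually_le_of_continuousOn (K := K) (contDiffOn_rowOne (m := m)).continuousOn,
    eventually_le_of_continuousOn (K := K) (contDiffOn_rowTwo (m := m)).continuousOn,
    eventually_one_le_mul_of_continuousOn (K := K) (contDiffOn_rowOne (m := m)).continuousOn
      fun v hv => rowOne_pos_of hm (hpos v hv).1 (hpos v hv).2,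
    eventually_one_le_mul_of_continuousOn (K := K) (contDiffOn_rowTwo (m := m)).continuousOn
      fun v hv => rowTwo_pos_of hm (hpos v hv).1 (hpos v hv).2,
    eventually_le_of_continuousOn (K := K) (contDiffOn_eigOne (m := m)).continuousOn,
    eventually_abs_le_of_continuousOn (K := K) (contDiffOn_eigTwo (m := m)).continuousOn,
    eventually_abs_le_of_continuousOn (K := K) (contDiffOn_lamB hm hK).continuousOn,
    eventually_le_of_continuousOn (K := K) (continuousOn_critPoint (m := m) hK),
    eventually_one_le_mul_of_continuousOn (K := K) (contDiffOn_eigNormSq (m := m)).continuousOn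
      fun v hv => eigNormSq_pos hm (hpos v hv).1 (hpos v hv).2]
    with C h1 h2 h3 h4 h5 h6 h7 h8 h9 h10 h11 h12 h13
  intro n grp n₁ n₂ ρ x D hv hsep hn₁ hn₂
  have p1 := D.n₁_pos'
  have p2 := D.n₂_pos'
  have p3 := D.x_pos
  have p4 := D.ρ_pos
  have q1 : (n₂ : ℝ) ≤ n := by
    have h := sum_blockVec D.two_le D.sizes 1 1
    simp only [blockVec, ite_self, Finset.sum_const, Finset.card_univ, Fintype.card_fin,
      nsmul_eq_mul, mul_one] at h
    have := D.one_le_m_sub_one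
    nlinarith
  have q2 : (n₁ : ℝ) ≤ n := by
    have h := sum_blockVec D.two_le D.sizes 1 1
    simp only [blockVec, ite_self, Finset.sum_const, Finset.card_univ, Fintype.card_fin,
      nsmul_eq_mul, mul_one] at h
    have := D.one_le_m_sub_one
    nlinarith
  have q3 : 1 ≤ K * x := by
    have := mul_le_mul_of_nonneg_left hv.2.1 hK.le
    rwa [mul_inv_cancel₀ hK.ne'] at this
  have q4 : 1 ≤ K * ρ := by
    have := mul_le_mul_of_nonneg_left hv.1.1 hK.le
    rwa [mul_inv_cancel₀ hK.ne'] at this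
  have q5 : 1 ≤ K * |ρ - 1| := by
    have := mul_le_mul_of_nonneg_left hsep hK.le
    rwa [mul_inv_cancel₀ hK.ne'] at this
  have hw : (n₂ : ℝ) * x / n₁ ≤ K * K := by
    rw [div_le_iff₀ p1]
    calc (n₂ : ℝ) * x ≤ (K * n₁) * K := by
          have := hv.2.2
          have : (n₂ : ℝ) ≤ K * n₁ := by linarith
          gcongr
      _ = K * K * n₁ := by ring
  have hw' : 1 ≤ (K * K) * (n₂ * x / n₁) := by
    rw [mul_div_assoc', le_div_iff₀ p1]
    calc 1 * (n₁ : ℝ) ≤ 1 * (K * n₂) := by gcongr; linarith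
      _ ≤ (K * x) * (K * n₂) := by gcongr
      _ = K * K * (n₂ * x) := by ring
  refine { D with
    one_le := h1
    m_le := h2
    ρ_le := hv.1.2.trans h3
    x_le := hv.2.2.trans h3
    n_le := hn₂.trans (by gcongr)
    weight_le := hw.trans h4
    weight_ge := hw'.trans (by gcongr)
    rowOne_le := h5 _ hv
    rowTwo_le := h6 _ hv
    rowOne_ge := h7 _ hv
    rowTwo_ge := h8 _ hv
    eigOne_le := h9 _ hv
    eigTwo_ge := (abs_le.1 (h10 _ hv)).1
    lamB_le := h11 _ hv
    critPoint_le := h12 _ hv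
    eigNormSq_ge := h13 _ hv
    ρ_ge := q4.trans (by gcongr)
    x_ge := q3.trans (by gcongr)
    sep := q5.trans (by gcongr) }

/-- Two bilinear forms in vectors that are constant on the groups, for the same matrix. -/
theorem abs_blockBilin_sub_le {n : ℕ} {grp : Fin n → Fin m} (Z : Matrix (Fin n) (Fin n) ℝ)
    {a b c d a' b' c' d' M L : ℝ} (hM : 0 ≤ M) (hL : 0 ≤ L) (ha' : |a'| ≤ M) (hb' : |b'| ≤ M)
    (hc : |c| ≤ M) (hd : |d| ≤ M) (ha : |a - a'| ≤ L) (hb : |b - b'| ≤ L) (hcc : |c - c'| ≤ L)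
    (hdd : |d - d'| ≤ L) :
    |∑ i, ∑ j, blockVec grp a b i * Z i j * blockVec grp c d j -
      ∑ i, ∑ j, blockVec grp a' b' i * Z i j * blockVec grp c' d' j| ≤
    ‖toComplex Z‖ * n * (2 * (M * L)) := by
  have h : ∑ i, ∑ j, blockVec grp a b i * Z i j * blockVec grp c d j -
      ∑ i, ∑ j, blockVec grp a' b' i * Z i j * blockVec grp c' d' j =
      ∑ i, ∑ j, blockVec grp (a - a') (b - b') i * Z i j * blockVec grp c d j +
      ∑ i, ∑ j, blockVec grp a' b' i * Z i j * blockVec grp (c - c') (d - d') j := by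
    simp only [← Finset.sum_add_distrib, ← Finset.sum_sub_distrib]
    refine Finset.sum_congr rfl fun i _ => Finset.sum_congr rfl fun j _ => ?_
    simp only [blockVec]
    split_ifs <;> ring
  rw [h]
  have h1 := abs_bilin_le Z _ _ hL hM (abs_blockVec_le (grp := grp) ha hb)
    (abs_blockVec_le (grp := grp) hc hd)
  have h2 := abs_bilin_le Z _ _ hM hL (abs_blockVec_le (grp := grp) ha' hb')
    (abs_blockVec_le (grp := grp) hcc hdd)
  refine (abs_add_le _ _).trans ((add_le_add h1 h2).trans (le_of_eq ?_))
  ring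

theorem firstOrder_eq {n : ℕ} (grp : Fin n → Fin m) (n₁ n₂ : ℕ) (ρ : ℝ)
    (Z : Matrix (Fin n) (Fin n) ℝ) (x : ℝ) :
    firstOrder grp n₁ n₂ ρ Z x =
      (∑ i, ∑ j, blockVec grp (n₂ / n₁ * (x * eigOne m ρ x / eigNormSq m ρ x))
          (eigTwo m ρ x / eigNormSq m ρ x) i * Z i j *
        blockVec grp (n₂ / n₁ * (x * eigOne m ρ x)) (eigTwo m ρ x) j -
      ∑ i, ∑ j, blockVec grp (n₂ / n₁ * (x * lamB m ρ x * eigOne m ρ x ^ 2 / eigNormSq m ρ x))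
          (lamB m ρ x * eigTwo m ρ x ^ 2 / eigNormSq m ρ x) i * Z i j *
        blockVec grp (n₂ / n₁ * x) 1 j) / n₂ ^ 2 := by
  rw [firstOrder, ← Finset.sum_sub_distrib, mul_comm ((n₂ : ℝ) ^ 2), ← div_div, Finset.sum_div]
  congr 1
  refine Finset.sum_congr rfl fun i _ => ?_
  rw [← Finset.sum_sub_distrib, Finset.sum_div]
  refine Finset.sum_congr rfl fun j _ => ?_
  simp only [blockWeight, blockVec]
  split_ifs <;> ring

/-- The first-order term depends on the weight ratio in a Lipschitz way. -/
theorem eventually_firstOrder_lipschitz (hm : 2 ≤ m) (hK : 0 < K) : ∀ᶠ C in atTop,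
    ∀ {n : ℕ} {grp : Fin n → Fin m} {n₁ n₂ : ℕ} {ρ x₀ x₁ e : ℝ} {Z : Matrix (Fin n) (Fin n) ℝ},
      0 < n₁ → 0 < n₂ → (ρ, x₀) ∈ paramBox K → (ρ, x₁) ∈ paramBox K → (n₂ : ℝ) ≤ K * n₁ →
      (n : ℝ) ≤ K * n₂ → 0 ≤ e → ‖toComplex Z‖ ≤ e * n →
      |firstOrder grp n₁ n₂ ρ Z x₀ - firstOrder grp n₁ n₂ ρ Z x₁| ≤ C * e * |x₀ - x₁| := by
  have hpos := fun v hv => pos_of_mem_paramBox (v := v) hK hv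
  have hE : ∀ v ∈ paramBox K, eigNormSq m v.1 v.2 ≠ 0 := fun v hv =>
    (eigNormSq_pos hm (hpos v hv).1 (hpos v hv).2).ne'
  have c0 : ContDiffOn ℝ 1 (fun v : ℝ × ℝ => v.2) (paramBox K) := by fun_prop
  have c1 := (c0.mul (contDiffOn_eigOne (m := m))).div contDiffOn_eigNormSq hE
  have c2 := (contDiffOn_eigTwo (m := m)).div (contDiffOn_eigNormSq (K := K)) hE
  have c3 := c0.mul (contDiffOn_eigOne (m := m))
  have c4 := contDiffOn_eigTwo (m := m) (K := K)
  have c5 := ((c0.mul (contDiffOn_lamB hm hK)).mul ((contDiffOn_eigOne (m := m)).pow 2)).div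
    contDiffOn_eigNormSq hE
  have c6 := ((contDiffOn_lamB hm hK).mul ((contDiffOn_eigTwo (m := m)).pow 2)).div
    contDiffOn_eigNormSq hE
  obtain ⟨M, hM1, hMK, b1, b2, b3, b4, b5, b6, l1, l2, l3, l4, l5, l6⟩ :=
    ((eventually_ge_atTop 1).and <| (eventually_ge_atTop K).and <|
      (eventually_abs_le_of_continuousOn c1.continuousOn).and <|
      (eventually_abs_le_of_continuousOn c2.continuousOn).and <|
      (eventually_abs_le_of_continuousOn c3.continuousOn).and <|
      (eventually_abs_le_of_continuousOn c4.continuousOn).and <|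
      (eventually_abs_le_of_continuousOn c5.continuousOn).and <|
      (eventually_abs_le_of_continuousOn c6.continuousOn).and <|
      (eventually_lipschitz_of_contDiffOn c1).and <|
      (eventually_lipschitz_of_contDiffOn c2).and <|
      (eventually_lipschitz_of_contDiffOn c3).and <|
      (eventually_lipschitz_of_contDiffOn c4).and <|
      (eventually_lipschitz_of_contDiffOn c5).and
      (eventually_lipschitz_of_contDiffOn c6)).exists
  filter_upwards [eventually_ge_atTop (4 * M ^ 6)] with C hC
  intro n grp n₁ n₂ ρ x₀ x₁ e Z hn₁ hn₂ hv₀ hv₁ hs hn he hZ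
  have hn₁' : (0 : ℝ) < n₁ := by exact_mod_cast hn₁
  have hn₂' : (0 : ℝ) < n₂ := by exact_mod_cast hn₂
  have hM : 0 < M := by linarith
  have hs0 : (0 : ℝ) ≤ n₂ / n₁ := by positivity
  have hs' : (n₂ : ℝ) / n₁ ≤ M := by
    rw [div_le_iff₀ hn₁']; exact hs.trans (by gcongr)
  have hMM : M ≤ M * M := by nlinarith
  have key1 : ∀ t, |t| ≤ M → |(n₂ : ℝ) / n₁ * t| ≤ M * M := fun t ht => by
    rw [abs_mul, abs_of_nonneg hs0]; gcongr
  have key2 : ∀ t t', |t - t'| ≤ M * |x₀ - x₁| →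
      |(n₂ : ℝ) / n₁ * t - n₂ / n₁ * t'| ≤ M * M * |x₀ - x₁| := fun t t' ht => by
    rw [← mul_sub, abs_mul, abs_of_nonneg hs0, mul_assoc]; gcongr
  have key3 : ∀ t, |t| ≤ M → |t| ≤ M * M := fun t ht => ht.trans hMM
  have key4 : ∀ t t', |t - t'| ≤ M * |x₀ - x₁| → |t - t'| ≤ M * M * |x₀ - x₁| := fun t t' ht =>
    ht.trans (by gcongr)
  have hx : |x₀| ≤ M := by
    rw [abs_of_pos (hpos _ hv₀).2]; exact hv₀.2.2.trans hMK
  have hxx : |x₀ - x₁| ≤ M * |x₀ - x₁| := by nlinarith [abs_nonneg (x₀ - x₁)]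
  have B1 := abs_blockBilin_sub_le (grp := grp) Z (M := M * M) (L := M * M * |x₀ - x₁|)
    (by positivity) (by positivity) (key1 _ (b1 _ hv₁)) (key3 _ (b2 _ hv₁)) (key1 _ (b3 _ hv₀))
    (key3 _ (b4 _ hv₀)) (key2 _ _ (l1 _ _ _ hv₀ hv₁)) (key4 _ _ (l2 _ _ _ hv₀ hv₁))
    (key2 _ _ (l3 _ _ _ hv₀ hv₁)) (key4 _ _ (l4 _ _ _ hv₀ hv₁))
  have B2 := abs_blockBilin_sub_le (grp := grp) Z (M := M * M) (L := M * M * |x₀ - x₁|)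
    (d := 1) (d' := 1)
    (by positivity) (by positivity) (key1 _ (b5 _ hv₁)) (key3 _ (b6 _ hv₁)) (key1 _ hx)
    (key3 _ (by rw [abs_one]; exact hM1)) (key2 _ _ (l5 _ _ _ hv₀ hv₁))
    (key4 _ _ (l6 _ _ _ hv₀ hv₁)) (key2 _ _ hxx) (by rw [sub_self, abs_zero]; positivity)
  simp only [Pi.div_apply] at B1 B2
  rw [firstOrder_eq, firstOrder_eq, ← sub_div, abs_div, abs_of_pos (show (0 : ℝ) < n₂ ^ 2 by
    positivity), div_le_iff₀ (by positivity), sub_sub_sub_comm]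
  refine (abs_sub _ _).trans ((add_le_add B1 B2).trans ?_)
  calc _ = ‖toComplex Z‖ * n * (4 * M ^ 4 * |x₀ - x₁|) := by ring
    _ ≤ (e * n) * n * (4 * M ^ 4 * |x₀ - x₁|) := by gcongr
    _ ≤ (e * (M * n₂)) * (M * n₂) * (4 * M ^ 4 * |x₀ - x₁|) := by
        have : (n : ℝ) ≤ M * n₂ := hn.trans (by gcongr)
        gcongr
    _ = (4 * M ^ 6) * (e * |x₀ - x₁| * n₂ ^ 2) := by ring
    _ ≤ C * (e * |x₀ - x₁| * n₂ ^ 2) := by gcongr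
    _ = _ := by ring

end Uniform

/-! ### Comparison of two weightings of the same matrix -/

section Comparison

open Matrix
open scoped Matrix.Norms.L2Operator

variable {n m : ℕ} {grp : Fin n → Fin m} {n₁ n₂ : ℕ} {ρ x x₀ x₁ C e : ℝ}

theorem abs_sign_mul_le (a b : ℝ) : |(SignType.sign a : ℝ) * b| ≤ |b| := by
  rcases lt_trichotomy a 0 with h | h | h
  · rw [sign_neg h, SignType.coe_neg_one, neg_one_mul, abs_neg]
  · rw [h]; simp
  · rw [sign_pos h]; simp

theorem sign_lamB (hm : 2 ≤ m) (hρ : 0 < ρ) (hx : 0 < x) :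
    (SignType.sign (lamB m ρ x) : ℝ) = SignType.sign (ρ - 1) := by
  have hm' : (2 : ℝ) ≤ m := by exact_mod_cast hm
  have h1 := rowOne_pos_of hm hρ hx
  have h2 := rowTwo_pos_of hm hρ hx
  have h3 : 0 < (ρ + (m - 1)) * x / (rowOne m ρ x * rowTwo m ρ x) := by
    have : 0 < ρ + ((m : ℝ) - 1) := by linarith
    positivity
  have h4 : lamB m ρ x = (ρ - 1) * ((ρ + (m - 1)) * x / (rowOne m ρ x * rowTwo m ρ x)) := by
    rw [lamB]; ring
  rw [h4, sign_mul, sign_pos h3, mul_one]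

namespace SeparatedBounds

variable (H : SeparatedBounds grp n₁ n₂ ρ x C) (H₀ : SeparatedBounds grp n₁ n₂ ρ x₀ C)
  (H₁ : SeparatedBounds grp n₁ n₂ ρ x₁ C)

include H in
theorem abs_lamB_ge : 1 ≤ C ^ 4 * |lamB m ρ x| := by
  have hC : 0 < C := one_pos.trans_le H.one_le
  have h1 := H.rowOne_pos
  have h2 := H.rowTwo_pos
  have h3 := H.rowOne_le
  have h4 := H.rowTwo_le
  have h5 := H.one_le_m_sub_one
  have h6 := H.ρ_pos
  have h7 := H.x_pos
  rw [abs_lamB_eq H.two_le H.ρ_pos H.x_pos, mul_div_assoc', le_div_iff₀ (mul_pos h1 h2)]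
  calc 1 * (rowOne m ρ x * rowTwo m ρ x) ≤ 1 * (C * C) := by gcongr
    _ ≤ ((C * |ρ - 1|) * (1 * (C * x))) * (C * C) := by
        have := mul_le_mul H.sep (show 1 ≤ 1 * (C * x) by rw [one_mul]; exact H.x_ge) zero_le_one
          (by positivity)
        rw [one_mul] at this
        gcongr
    _ ≤ ((C * |ρ - 1|) * ((ρ + (m - 1)) * (C * x))) * (C * C) := by
        gcongr; linarith
    _ = _ := by ring

include H in
theorem abs_lamB_sub_ge {t : ℝ} (ht : 0 ≤ t) (htx : t ≤ x - 1) :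
    t ≤ C ^ 3 * (|lamB m ρ x| - |lamA m ρ x|) := by
  have hC : 0 < C := one_pos.trans_le H.one_le
  have h1 := H.rowOne_pos
  have h2 := H.rowTwo_pos
  have h3 := H.rowOne_le
  have h4 := H.rowTwo_le
  have h5 := H.one_le_m_sub_one
  rw [abs_lamB_sub_abs_lamA H.two_le H.ρ_pos H.x_pos, mul_div_assoc', le_div_iff₀ (mul_pos h1 h2)]
  calc t * (rowOne m ρ x * rowTwo m ρ x) ≤ t * (C * C) := by gcongr
    _ = 1 * (1 * t) * (C * C) := by ring
    _ ≤ (C * |ρ - 1|) * ((m - 1) * (x - 1)) * (C * C) := by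
        have h6 := H.sep
        gcongr
    _ = _ := by ring

include H₀ H₁ in
theorem descentA_ge (h01 : x₀ ≤ x₁) :
    x₁ - x₀ ≤ C ^ 3 * (|lamA m ρ x₀| - |lamA m ρ x₁|) := by
  have hC : 0 < C := one_pos.trans_le H₀.one_le
  have h1 := H₀.rowTwo_pos
  have h2 := H₁.rowTwo_pos
  have h3 := H₀.rowTwo_le
  have h4 := H₁.rowTwo_le
  have h5 : 0 ≤ x₁ - x₀ := sub_nonneg.2 h01
  rw [abs_lamA_sub H₀.two_le H₀.ρ_pos H₀.x_pos H₁.x_pos, mul_div_assoc',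
    le_div_iff₀ (mul_pos h1 h2)]
  calc (x₁ - x₀) * (rowTwo m ρ x₀ * rowTwo m ρ x₁) ≤ (x₁ - x₀) * (C * C) := by gcongr
    _ = 1 * (x₁ - x₀) * (C * C) := by ring
    _ ≤ (C * |ρ - 1|) * (x₁ - x₀) * (C * C) := by
        have h6 := H₀.sep
        gcongr
    _ = _ := by ring

include H₀ H₁ in
/-- Near the critical point the decrease is only quadratic in the distances involved. -/
theorem descentB_ge (h : IsDescentB m ρ x₀ x₁) :
    |x₀ - x₁| * (|x₀ - critPoint m ρ| + |x₁ - critPoint m ρ|) ≤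
      C ^ 7 * (|lamB m ρ x₀| - |lamB m ρ x₁|) := by
  have hC : 0 < C := one_pos.trans_le H₀.one_le
  have h1 := H₀.rowTwo_pos
  have h2 := H₁.rowTwo_pos
  have h3 := H₀.rowTwo_le
  have h4 := H₁.rowTwo_le
  have h1' := H₀.rowOne_pos
  have h2' := H₁.rowOne_pos
  have h3' := H₀.rowOne_le
  have h4' := H₁.rowOne_le
  have h5 := H₀.one_le_m_sub_one
  have h6 := H₀.ρ_pos
  have h7 := H₀.sep
  have h8 := H₀.ρ_ge
  set S := |x₀ - x₁| * (|x₀ - critPoint m ρ| + |x₁ - critPoint m ρ|) with hS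
  set P := (x₁ - x₀) * (x₀ * x₁ - critPoint m ρ ^ 2) with hP
  have hinv : C⁻¹ ≤ x₀ := by
    rw [inv_le_iff_one_le_mul₀' hC]; exact H₀.x_ge
  have hcrit : C⁻¹ ≤ critPoint m ρ := (inv_le_one_of_one_le₀ H₀.one_le).trans
    (one_le_critPoint H₀.two_le h6)
  have hSP : S ≤ C * P := by
    have := h.mul_ge hinv hcrit
    rw [abs_sub_comm x₁ x₀, inv_mul_le_iff₀ hC] at this
    exact this
  have hS0 : 0 ≤ S := by positivity
  have hP0 : 0 ≤ P := by
    by_contra hneg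
    rw [not_le] at hneg
    nlinarith
  rw [abs_lamB_sub H₀.two_le H₀.ρ_pos H₀.x_pos H₁.x_pos, mul_div_assoc',
    le_div_iff₀ (by positivity)]
  calc S * (rowOne m ρ x₀ * rowTwo m ρ x₀ * (rowOne m ρ x₁ * rowTwo m ρ x₁))
      ≤ (C * P) * (C * C * (C * C)) := by gcongr
    _ = (1 * 1 * 1 * P) * (C * (C * C * (C * C))) := by ring
    _ ≤ ((C * |ρ - 1|) * (ρ + (m - 1)) * (C * ρ) * P) * (C * (C * C * (C * C))) := by
        gcongr; linarith
    _ = _ := by ring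

end SeparatedBounds

variable {X : Matrix (Fin n) (Fin n) ℝ} {f f₀ f₁ : Fin n → ℝ}

/-- The second-order expansion at a point where `|lamB|` dominates `|lamA|`. -/
theorem NearBlock.abs_absLambdaTwo_sub_le (H : NearBlock grp n₁ n₂ ρ x C e X f)
    (S : SeparatedBounds grp n₁ n₂ ρ x C) (he : 500 * C ^ 15 * e ≤ 1)
    (hx : 3 ≤ m → 6 / 5 ≤ x) :
    |absLambdaTwo (rowNormalized X f) - (|lamB m ρ x| + SignType.sign (ρ - 1) *
      firstOrder grp n₁ n₂ ρ (X - blockMatrix grp ρ) x)| ≤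
    5800 * C ^ 26 * e ^ 2 + 4 * C ^ 10 * e * |x - critPoint m ρ| := by
  have hC := H.C_pos
  have hn := H.n_pos'
  have he0 := H.e_nonneg
  have hB := S.abs_lamB_ge
  have h1 := H.toBlockData.absLambdaTwo_perturb_second_order (a := n / C ^ 3) (κ := C ^ 3)
    (gap := 1 / (5 * C ^ 4)) (by positivity) (by positivity) H.revWeight_bounds
    (T := rowNormalized X f) (rowNormalized_nonneg H.nonneg fun j => (H.weight_pos' j).le)
    (fun i => rowNormalized_row_sum i (H.row_sum_pos' i).ne') H.eta_le (by positivity)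
    (by
      rw [le_div_iff₀ (by positivity)]
      calc _ = 480 * C ^ 15 * e := by ring
        _ ≤ 500 * C ^ 15 * e := by gcongr; norm_num
        _ ≤ 1 := he)
    (by
      rw [div_le_iff₀ (by positivity)]
      nlinarith [abs_nonneg (lamB m ρ x)])
    (fun hm => by
      have h2 := S.abs_lamB_sub_ge (t := 1 / 5) (by norm_num) (by linarith [hx hm])
      have h3 : 1 / (5 * C ^ 4) ≤ |lamB m ρ x| - |lamA m ρ x| := by
        have h4 : 0 ≤ |lamB m ρ x| - |lamA m ρ x| := by
          by_contra hneg
          rw [not_le] at hneg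
          have := mul_neg_of_pos_of_neg (pow_pos hC 3) hneg
          linarith
        rw [div_le_iff₀ (by positivity)]
        have h5 : C ^ 3 ≤ C ^ 4 := pow_le_pow_right₀ H.one_le (by norm_num)
        have := mul_le_mul_of_nonneg_right h5 h4
        linarith
      linarith)
    H.eigNorm_eq.symm
  rw [sign_lamB H.two_le H.ρ_pos H.x_pos] at h1
  have h2 := H.abs_firstOrder_sub_le
  set Q := (∑ i, revWeight grp n₁ n₂ ρ x i * blockVec grp (eigOne m ρ x) (eigTwo m ρ x) i *
        ((rowNormalized X f - rowNormalized (blockMatrix grp ρ) (blockWeight grp n₁ n₂ x)) *ᵥ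
          blockVec grp (eigOne m ρ x) (eigTwo m ρ x)) i) / (n₂ ^ 2 * eigNormSq m ρ x) with hQ
  set F := firstOrder grp n₁ n₂ ρ (X - blockMatrix grp ρ) x with hF
  have h3 : |(SignType.sign (ρ - 1) : ℝ) * (Q - F)| ≤ |Q - F| := abs_sign_mul_le _ _
  have h4 : 8 * (12 * C ^ 11 * e) ^ 2 / (1 / (5 * C ^ 4)) = 5760 * C ^ 26 * e ^ 2 := by
    field_simp
    ring
  rw [h4] at h1
  have h5 : absLambdaTwo (rowNormalized X f) - (|lamB m ρ x| + SignType.sign (ρ - 1) * F) =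
      (absLambdaTwo (rowNormalized X f) - (|lamB m ρ x| + SignType.sign (ρ - 1) * Q)) +
        SignType.sign (ρ - 1) * (Q - F) := by ring
  rw [h5]
  refine (abs_add_le _ _).trans ((add_le_add h1 (h3.trans h2)).trans ?_)
  have h6 : C ^ 13 * e ^ 2 ≤ C ^ 26 * e ^ 2 := by
    gcongr
    · exact H.one_le
    · norm_num
  linarith

/-- Along a descent of `lamTwo`, the second eigenvalue of any sufficiently close matrix decreases,
provided that the weight ratios differ by a large multiple of the error. Away from the critical
point this follows from the stability of eigenvalues. Near it the decrease is of second order, and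
the first-order terms of the two perturbed eigenvalues have to be compared. The powers of `C` are
not optimized. -/
theorem NearBlock.absLambdaTwo_lt (H₀ : NearBlock grp n₁ n₂ ρ x₀ C e X f₀)
    (H₁ : NearBlock grp n₁ n₂ ρ x₁ C e X f₁) (S₀ : SeparatedBounds grp n₁ n₂ ρ x₀ C)
    (S₁ : SeparatedBounds grp n₁ n₂ ρ x₁ C) (he : 500 * C ^ 15 * e ≤ 1)
    (hlip : |firstOrder grp n₁ n₂ ρ (X - blockMatrix grp ρ) x₀ -
      firstOrder grp n₁ n₂ ρ (X - blockMatrix grp ρ) x₁| ≤ C * e * |x₀ - x₁|)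
    (hL : 12000 * C ^ 33 * e ≤ |x₀ - x₁|) (hdesc : IsDescent m ρ x₀ x₁) :
    absLambdaTwo (rowNormalized X f₁) < absLambdaTwo (rowNormalized X f₀) := by
  have hC := H₀.C_pos
  have hC1 := H₀.one_le
  have he0 := H₀.e_nonneg
  have hm := H₀.two_le
  have hρ := H₀.ρ_pos
  have hx₀ := H₀.x_pos
  have hx₁ := H₁.x_pos
  have hsmall : ∀ {x}, SeparatedBounds grp n₁ n₂ ρ x C → 60 * C ^ 11 * e < lamTwo m ρ x := by
    intro x S
    refine lt_of_lt_of_le ?_ (abs_lamB_le_lamTwo m ρ x)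
    have h1 := S.abs_lamB_ge
    have h2 : 0 < C ^ 4 := by positivity
    have h3 : C ^ 4 * (60 * C ^ 11 * e) < C ^ 4 * |lamB m ρ x| := by
      calc C ^ 4 * (60 * C ^ 11 * e) = 60 / 500 * (500 * C ^ 15 * e) := by ring
        _ ≤ 60 / 500 * 1 := by gcongr
        _ < 1 := by norm_num
        _ ≤ _ := h1
    exact lt_of_mul_lt_mul_left h3 h2.le
  have c₀ := (H₀.absLambdaTwo_near (hsmall S₀)).2
  have c₁ := (H₁.absLambdaTwo_near (hsmall S₁)).1
  have hne : x₀ ≠ x₁ := by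
    rcases hdesc with ⟨-, h, -⟩ | ⟨-, h⟩ | ⟨h, -, -⟩
    · exact h.ne
    · exact h.ne
    · exact h.ne'
  have hL0 : 0 < |x₀ - x₁| := abs_pos.2 (sub_ne_zero.2 hne)
  set L := |x₀ - x₁| with hLdef
  have hpow : ∀ k ≤ 33, C ^ k * e ≤ C ^ 33 * e := fun k hk =>
    mul_le_mul_of_nonneg_right (pow_le_pow_right₀ hC1 hk) he0
  rcases hdesc with ⟨hm3, h01, h11⟩ | hB
  · have h1 := S₀.descentA_ge S₁ h01.le
    rw [← lamTwo_eq_lamA hm3 hρ hx₀ (by linarith), ← lamTwo_eq_lamA hm3 hρ hx₁ h11] at h1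
    have h2 : L = x₁ - x₀ := by rw [hLdef, abs_sub_comm, abs_of_pos (sub_pos.2 h01)]
    rw [← h2] at h1
    have h3 := hpow 14 (by norm_num)
    have h4 : C ^ 3 * (60 * C ^ 11 * e) < C ^ 3 * (lamTwo m ρ x₀ - lamTwo m ρ x₁) := by
      calc C ^ 3 * (60 * C ^ 11 * e) = 60 * (C ^ 14 * e) := by ring
        _ < _ := by linarith
    have h5 := lt_of_mul_lt_mul_left h4 (by positivity)
    linarith
  have h1 := S₀.descentB_ge S₁ hB
  obtain ⟨e1, e2⟩ := hB.lamTwo_eq hm hρ hx₀ hx₁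
  set u₀ := |x₀ - critPoint m ρ| with hu₀
  set u₁ := |x₁ - critPoint m ρ| with hu₁
  have hLS : L ≤ u₀ + u₁ := by
    have := abs_sub_le x₀ (critPoint m ρ) x₁
    rw [abs_sub_comm (critPoint m ρ) x₁] at this
    exact this
  rcases le_or_gt (1 / 10) (u₀ + u₁) with hfar | hclose
  · rw [← e1, ← e2] at h1
    have h3 := hpow 18 (by norm_num)
    have h4 : C ^ 7 * (60 * C ^ 11 * e) < C ^ 7 * (lamTwo m ρ x₀ - lamTwo m ρ x₁) := by
      calc C ^ 7 * (60 * C ^ 11 * e) = 60 * (C ^ 18 * e) := by ring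
        _ < L * (1 / 10) := by linarith
        _ ≤ L * (u₀ + u₁) := by gcongr
        _ ≤ _ := h1
    have h5 := lt_of_mul_lt_mul_left h4 (by positivity)
    linarith
  · have hu₀' : 0 ≤ u₀ := abs_nonneg _
    have hu₁' : 0 ≤ u₁ := abs_nonneg _
    -- for `m ≥ 3` the critical point is at least `√2`, away from the crossing of `|lamA|`, `|lamB|`
    have hcrit : 3 ≤ m → 13 / 10 ≤ critPoint m ρ := by
      intro hm3
      have h2 := critPoint_sq_ge hm3 hρ
      have h3 : 0 ≤ critPoint m ρ := Real.sqrt_nonneg _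
      nlinarith
    have g₀ : 3 ≤ m → 6 / 5 ≤ x₀ := fun hm3 => by
      have h2 := hcrit hm3
      have h3 := (abs_le.1 (show |x₀ - critPoint m ρ| ≤ 1 / 10 by linarith)).1
      linarith
    have g₁ : 3 ≤ m → 6 / 5 ≤ x₁ := fun hm3 => by
      have h2 := hcrit hm3
      have h3 := (abs_le.1 (show |x₁ - critPoint m ρ| ≤ 1 / 10 by linarith)).1
      linarith
    have r₀ := (abs_le.1 (H₀.abs_absLambdaTwo_sub_le S₀ he g₀)).1
    have r₁ := (abs_le.1 (H₁.abs_absLambdaTwo_sub_le S₁ he g₁)).2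
    set F₀ := firstOrder grp n₁ n₂ ρ (X - blockMatrix grp ρ) x₀ with hF₀
    set F₁ := firstOrder grp n₁ n₂ ρ (X - blockMatrix grp ρ) x₁ with hF₁
    have hsign : |(SignType.sign (ρ - 1) : ℝ) * (F₀ - F₁)| ≤ C * e * L :=
      (abs_sign_mul_le _ _).trans hlip
    have hsign' := (abs_le.1 hsign).1
    -- multiplied by `C ^ 7`, every error term is dominated by the guaranteed decrease
    have hLS0 : 0 < L * (u₀ + u₁) := mul_pos hL0 (by linarith)
    have b1 : 12000 * (C ^ 33 * e ^ 2) ≤ L * (u₀ + u₁) / 12000 := by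
      have q1 : 12000 * C ^ 33 * e ≤ u₀ + u₁ := hL.trans hLS
      have q2 := mul_le_mul hL q1 (by positivity) hL0.le
      have q3 : C ^ 33 * e ^ 2 ≤ C ^ 66 * e ^ 2 := by
        gcongr
        norm_num
      have q4 : 12000 * C ^ 33 * e * (12000 * C ^ 33 * e) = 144000000 * (C ^ 66 * e ^ 2) := by ring
      rw [q4] at q2
      linarith
    have b2 : C ^ 17 * e * (u₀ + u₁) ≤ L * (u₀ + u₁) / 12000 := by
      have q1 := hpow 17 (by norm_num)
      have q2 : C ^ 17 * e ≤ L / 12000 := by linarith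
      calc _ ≤ L / 12000 * (u₀ + u₁) := by gcongr
        _ = _ := by ring
    have b3 : C ^ 8 * e * L ≤ L * (u₀ + u₁) / 12000 := by
      have q1 := hpow 8 (by norm_num)
      have q2 : C ^ 8 * e ≤ (u₀ + u₁) / 12000 := by linarith
      calc _ ≤ (u₀ + u₁) / 12000 * L := by gcongr
        _ = _ := by ring
    have hC7 : 0 < C ^ 7 := by positivity
    have key : C ^ 7 * (|lamB m ρ x₀| - |lamB m ρ x₁|) ≤
        C ^ 7 * (absLambdaTwo (rowNormalized X f₀) - absLambdaTwo (rowNormalized X f₁)) +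
          (11600 * (C ^ 33 * e ^ 2) + 4 * (C ^ 17 * e * (u₀ + u₁)) + C ^ 8 * e * L) := by
      calc _ ≤ C ^ 7 * ((absLambdaTwo (rowNormalized X f₀) - absLambdaTwo (rowNormalized X f₁)) +
          (11600 * C ^ 26 * e ^ 2 + 4 * C ^ 10 * e * (u₀ + u₁) + C * e * L)) := by
            gcongr
            linarith
        _ = _ := by ring
    have hfin : 0 < C ^ 7 *
        (absLambdaTwo (rowNormalized X f₀) - absLambdaTwo (rowNormalized X f₁)) := by
      have q0 : 0 ≤ C ^ 33 * e ^ 2 := by positivity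
      linarith
    have := pos_of_mul_pos_right hfin hC7.le
    linarith

end Comparison

/-! ### Regularity of the weight function -/

section Weight

namespace IsWeightFunction

variable {φ : ℝ → ℝ → ℝ} (hφ : IsWeightFunction φ)
include hφ

theorem exists_log_lipschitz_at (α : ℝ) : ∃ C D : ℝ, 0 ≤ C ∧ 0 < D ∧
    ∀ d d', D ≤ d → D ≤ d' →
      |Real.log (φ α d) - Real.log (φ α d')| ≤ C * |Real.log d - Real.log d'| := by
  obtain ⟨C, hC⟩ := hφ.growth_first α
  obtain ⟨D, hD⟩ := eventually_atTop.1 hC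
  refine ⟨max C 0, max D 1, le_max_right _ _, by positivity, fun d d' hd hd' => ?_⟩
  have hD0 : 0 < max D 1 := by positivity
  have hder : ∀ t ∈ Set.Ici (Real.log (max D 1)), HasDerivWithinAt
      (fun t => Real.log (φ α (Real.exp t)))
      (deriv (φ α) (Real.exp t) * Real.exp t / φ α (Real.exp t)) (Set.Ici (Real.log (max D 1)))
      t := by
    intro t _
    have h1 := (hφ.differentiableAt_degree α (Real.exp_pos t)).hasDerivAt
    have h2 := h1.comp t (Real.hasDerivAt_exp t)
    exact (h2.log (hφ.pos α _ (Real.exp_pos t)).ne').hasDerivWithinAt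
  have hbound : ∀ t ∈ Set.Ici (Real.log (max D 1)),
      ‖deriv (φ α) (Real.exp t) * Real.exp t / φ α (Real.exp t)‖ ≤ max C 0 := by
    intro t ht
    have h1 : max D 1 ≤ Real.exp t := (Real.log_le_iff_le_exp hD0).1 ht
    have h2 := hD _ ((le_max_left _ _).trans h1)
    have h3 := hφ.pos α _ (Real.exp_pos t)
    rw [Real.norm_eq_abs, abs_div, abs_mul, abs_of_pos (Real.exp_pos t), abs_of_pos h3]
    refine le_trans (le_of_eq ?_) (h2.trans (le_max_left _ _))
    field_simp
  have h := (convex_Ici (Real.log (max D 1))).norm_image_sub_le_of_norm_hasDerivWithin_le hder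
    hbound (Real.log_le_log hD0 hd') (Real.log_le_log hD0 hd)
  simpa [Real.exp_log (hD0.trans_le hd), Real.exp_log (hD0.trans_le hd')] using h

theorem log_sub_mono {d d' : ℝ} (hd' : 0 < d') (h : d' < d) :
    Monotone fun α => Real.log (φ α d) - Real.log (φ α d') := by
  intro a b hab
  have hd := hd'.trans h
  have h1 := (hφ.strictMono_ratio hd' h).monotone hab
  simp only
  rw [← Real.log_div (hφ.pos a d hd).ne' (hφ.pos a d' hd').ne',
    ← Real.log_div (hφ.pos b d hd).ne' (hφ.pos b d' hd').ne']
  exact Real.log_le_log (div_pos (hφ.pos a d hd) (hφ.pos a d' hd')) h1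

/-- The bound on the relative growth in `d` is locally uniform in `α`, because the logarithmic
increments of `φ α` are monotone in `α`. -/
theorem exists_log_lipschitz (α₀ α₁ : ℝ) : ∃ C D : ℝ, 0 ≤ C ∧ 0 < D ∧
    ∀ α ∈ Set.Icc α₀ α₁, ∀ d d', D ≤ d → D ≤ d' →
      |Real.log (φ α d) - Real.log (φ α d')| ≤ C * |Real.log d - Real.log d'| := by
  obtain ⟨C₀, D₀, hC₀, hD₀, h₀⟩ := hφ.exists_log_lipschitz_at α₀
  obtain ⟨C₁, D₁, hC₁, hD₁, h₁⟩ := hφ.exists_log_lipschitz_at α₁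
  refine ⟨max C₀ C₁, max D₀ D₁, hC₀.trans (le_max_left _ _), lt_max_of_lt_left hD₀, ?_⟩
  have key : ∀ α ∈ Set.Icc α₀ α₁, ∀ d d', max D₀ D₁ ≤ d' → d' < d →
      |Real.log (φ α d) - Real.log (φ α d')| ≤ max C₀ C₁ * |Real.log d - Real.log d'| := by
    intro α hα d d' hd' hlt
    have p0 : 0 < d' := hD₀.trans_le ((le_max_left _ _).trans hd')
    have e0 := abs_le.1 (h₀ d d' ((le_max_left _ _).trans (hd'.trans hlt.le))
      ((le_max_left _ _).trans hd'))
    have e1 := abs_le.1 (h₁ d d' ((le_max_right _ _).trans (hd'.trans hlt.le))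
      ((le_max_right _ _).trans hd'))
    have m0 := hφ.log_sub_mono p0 hlt hα.1
    have m1 := hφ.log_sub_mono p0 hlt hα.2
    simp only at m0 m1
    have a0 := mul_le_mul_of_nonneg_right (le_max_left C₀ C₁) (abs_nonneg (Real.log d - Real.log d'))
    have a1 := mul_le_mul_of_nonneg_right (le_max_right C₀ C₁)
      (abs_nonneg (Real.log d - Real.log d'))
    rw [abs_le]
    constructor <;> linarith
  intro α hα d d' hd hd'
  rcases lt_trichotomy d d' with h | h | h
  · rw [abs_sub_comm, abs_sub_comm (Real.log d)]
    exact key α hα d' d hd h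
  · rw [h, sub_self, sub_self, abs_zero, mul_zero]
  · exact key α hα d d' hd' h

theorem hasDerivAt_log_ratio {d₁ d₂ : ℝ} (hd₁ : 0 < d₁) (hd₂ : 0 < d₂) (α : ℝ) :
    HasDerivAt (fun a => Real.log (φ a d₁) - Real.log (φ a d₂)) (logDerivGap φ α d₁ d₂) α :=
  (((hφ.differentiable_param hd₁) α).hasDerivAt.log (hφ.pos α d₁ hd₁).ne').sub
    (((hφ.differentiable_param hd₂) α).hasDerivAt.log (hφ.pos α d₂ hd₂).ne')

theorem logDerivGap_ne_zero {d₁ d₂ : ℝ} (hd₁ : 0 < d₁) (hd₂ : 0 < d₂) (hne : d₁ ≠ d₂) (α : ℝ) :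
    logDerivGap φ α d₁ d₂ ≠ 0 := by
  have key : ∀ {d d' : ℝ}, 0 < d' → d' < d → logDerivGap φ α d' d ≠ 0 := by
    intro d d' hd' h h0
    have hd := hd'.trans h
    have h1 := hφ.ratio_deriv_neg d d' hd' h α
    have p1 := hφ.pos α d hd
    have p2 := hφ.pos α d' hd'
    have h2 := ((hφ.differentiable_param hd') α).hasDerivAt.div
      ((hφ.differentiable_param hd) α).hasDerivAt p1.ne'
    have h3 : deriv (fun a => φ a d' / φ a d) α = logDerivGap φ α d' d * (φ α d' / φ α d) := by
      rw [show (fun a => φ a d' / φ a d) = (fun a => φ a d') / fun a => φ a d from rfl, h2.deriv,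
        logDerivGap]
      field_simp
    rw [h3, h0, zero_mul] at h1
    exact lt_irrefl _ h1
  rcases lt_or_gt_of_ne hne with h | h
  · exact key hd₁ h
  · intro h0
    apply key hd₂ h
    unfold logDerivGap at h0 ⊢
    linarith

/-- The separation of the parameters, measured by `logDerivGap`, passes to the logarithms of the
weight ratios. -/
theorem lt_abs_log_ratio_sub {d₁ d₂ α₀ α₁ c : ℝ} (hd₁ : 0 < d₁) (hd₂ : 0 < d₂) (hne : d₁ ≠ d₂)
    (hα : α₀ < α₁)
    (hgap : ∀ α ∈ Set.Icc α₀ α₁, c * |logDerivGap φ α d₁ d₂|⁻¹ < α₁ - α₀) :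
    c < |(Real.log (φ α₁ d₁) - Real.log (φ α₁ d₂)) -
      (Real.log (φ α₀ d₁) - Real.log (φ α₀ d₂))| := by
  obtain ⟨α, hmem, h⟩ := exists_hasDerivAt_eq_slope
    (fun a => Real.log (φ a d₁) - Real.log (φ a d₂)) (fun a => logDerivGap φ a d₁ d₂) hα
    (fun a _ => (hφ.hasDerivAt_log_ratio hd₁ hd₂ a).continuousAt.continuousWithinAt)
    (fun a _ => hφ.hasDerivAt_log_ratio hd₁ hd₂ a)
  have h1 := hgap α (Set.Ioo_subset_Icc_self hmem)
  have h2 : 0 < |logDerivGap φ α d₁ d₂| := abs_pos.2 (hφ.logDerivGap_ne_zero hd₁ hd₂ hne α)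
  have h3 := sub_pos.2 hα
  rw [eq_div_iff h3.ne'] at h
  rw [← h, abs_mul, abs_of_pos h3]
  have h4 := mul_lt_mul_of_pos_left h1 h2
  rwa [mul_left_comm, mul_inv_cancel₀ h2.ne', mul_one] at h4

end IsWeightFunction

theorem abs_log_sub_le_div {x y b : ℝ} (hb : 0 < b) (hx : b ≤ x) (hy : b ≤ y) :
    |Real.log x - Real.log y| ≤ |x - y| / b := by
  have key : ∀ {x y : ℝ}, b ≤ x → b ≤ y → Real.log x - Real.log y ≤ |x - y| / b := by
    intro x y hx hy
    have hx0 := hb.trans_le hx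
    have hy0 := hb.trans_le hy
    rw [← Real.log_div hx0.ne' hy0.ne']
    calc _ ≤ x / y - 1 := Real.log_le_sub_one_of_pos (div_pos hx0 hy0)
      _ = (x - y) / y := by field_simp
      _ ≤ |x - y| / y := by gcongr; exact le_abs_self _
      _ ≤ _ := by gcongr
  rw [abs_le]
  refine ⟨?_, key hx hy⟩
  have := key hy hx
  rw [abs_sub_comm] at this
  linarith

theorem abs_sub_le_mul_of_abs_log_sub_le {x y t : ℝ} (hx : 0 < x) (hy : 0 < y) (ht : t ≤ 1)
    (h : |Real.log x - Real.log y| ≤ t) : |x - y| ≤ 2 * t * y := by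
  have h1 := Real.abs_exp_sub_one_le (h.trans ht)
  rw [Real.exp_sub, Real.exp_log hx, Real.exp_log hy] at h1
  have h2 : x - y = (x / y - 1) * y := by field_simp
  rw [h2, abs_mul, abs_of_pos hy]
  gcongr
  linarith

end Weight

/-! ### Comparison of two learning matrices of a concentrated network -/

section Concentrated

open Matrix
open scoped Matrix.Norms.L2Operator

/-- The group sizes are of order `n`, and the two densities are comparable. -/
structure BalancedNetwork {n m : ℕ} (grp : Fin n → Fin m) (n₁ n₂ : ℕ) (p q r : ℝ) : Prop where
  two_le : 2 ≤ m
  sizes : HasGroupSizes grp n₁ n₂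
  n_pos : 0 < n
  r_pos : 0 < r
  p_pos : 0 < p
  q_pos : 0 < q
  n₁_ge : n ≤ r * n₁
  n₂_ge : n ≤ r * n₂
  ratio_ge : r⁻¹ ≤ p / q
  ratio_le : p / q ≤ r

/-- The entries of `M` are nonnegative, and `M` deviates from its expectation by at most `t`, in
operator norm and in the number of links from a vertex to a group. -/
structure Concentrated {n m : ℕ} (grp : Fin n → Fin m) (p q : ℝ) (M : Matrix (Fin n) (Fin n) ℝ)
    (t : ℝ) : Prop where
  nonneg : ∀ i j, 0 ≤ M i j
  norm_le : ‖toComplex (M - linkMatrix grp p q)‖ ≤ t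
  row_le : ∀ i k, |∑ j with grp j = k, (M - linkMatrix grp p q) i j| ≤ t

/-- A bound on the ratio of the two expected degrees. -/
def degreeRatioBound (m : ℕ) (r : ℝ) : ℝ := r ^ 2 * (1 + r + m)

variable {n m : ℕ} {grp : Fin n → Fin m} {n₁ n₂ : ℕ} {p q r : ℝ}

namespace BalancedNetwork

variable (N : BalancedNetwork grp n₁ n₂ p q r)
include N

theorem one_le_r : 1 ≤ r := by
  by_contra h
  rw [not_le] at h
  have h1 := N.ratio_ge.trans N.ratio_le
  have h2 := (one_lt_inv₀ N.r_pos).2 h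
  linarith

theorem n_pos' : (0 : ℝ) < n := by exact_mod_cast N.n_pos

theorem n₁_pos : (0 : ℝ) < n₁ :=
  pos_of_mul_pos_right (N.n_pos'.trans_le N.n₁_ge) N.r_pos.le

theorem n₂_pos : (0 : ℝ) < n₂ :=
  pos_of_mul_pos_right (N.n_pos'.trans_le N.n₂_ge) N.r_pos.le

theorem sizes_le : (n₁ : ℝ) ≤ n ∧ (n₂ : ℝ) ≤ n := by
  have h := sum_blockVec N.two_le N.sizes 1 1
  simp only [blockVec, ite_self, Finset.sum_const, Finset.card_univ, Fintype.card_fin,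
    nsmul_eq_mul, mul_one] at h
  have h1 : (2 : ℝ) ≤ m := by exact_mod_cast N.two_le
  have h2 := N.n₁_pos
  have h3 := N.n₂_pos
  constructor <;> nlinarith

theorem p_le : p ≤ r * q := (div_le_iff₀ N.q_pos).1 N.ratio_le

theorem q_le : q ≤ r * p := by
  have h := N.ratio_ge
  rw [le_div_iff₀ N.q_pos, inv_mul_le_iff₀ N.r_pos] at h
  exact h

theorem degree_bounds {d : ℝ} (hd : d = expDegOne m n₁ n₂ p q ∨ d = expDegTwo m n₁ n₂ p q) :
    n * q ≤ r ^ 2 * d ∧ d ≤ n * q * (1 + r + m) := by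
  have h1 : (2 : ℝ) ≤ m := by exact_mod_cast N.two_le
  have hr := N.one_le_r
  have hp := N.p_pos
  have hq := N.q_pos
  have hn := N.n_pos'
  have a1 := N.n₁_pos
  have a2 := N.n₂_pos
  obtain ⟨s1, s2⟩ := N.sizes_le
  have g1 := N.n₁_ge
  have g2 := N.n₂_ge
  have b1 := N.p_le
  have b2 := N.q_le
  have u1 : n₁ * p ≤ n * (r * q) := by gcongr
  have u2 : n₂ * p ≤ n * (r * q) := by gcongr
  have u3 : n₁ * q ≤ n * q := by gcongr
  have u4 : n₂ * q ≤ n * q := by gcongr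
  have hnq : 0 < n * q := by positivity
  rcases hd with rfl | rfl
  · have v1 : n * q ≤ (r * n₁) * (r * p) := by gcongr
    have v2 : 0 ≤ r ^ 2 * (((m : ℝ) - 1) * n₂ * q) := by
      have : (0 : ℝ) ≤ m - 1 := by linarith
      positivity
    have v3 : ((m : ℝ) - 1) * (n₂ * q) ≤ (m - 1) * (n * q) :=
      mul_le_mul_of_nonneg_left u4 (by linarith)
    unfold expDegOne
    constructor <;> nlinarith
  · have v1 : n * q ≤ (r * n₁) * (r * q) := by
      have : n * q ≤ (r * n₁) * (1 * q) := by rw [one_mul]; gcongr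
      exact this.trans (by gcongr)
    have v2 : 0 ≤ r ^ 2 * (((m : ℝ) - 2) * n₂ * q) := by
      have : (0 : ℝ) ≤ m - 2 := by linarith
      positivity
    have v3 : ((m : ℝ) - 2) * (n₂ * q) ≤ (m - 2) * (n * q) :=
      mul_le_mul_of_nonneg_left u4 (by linarith)
    have v4 : 0 ≤ r ^ 2 * (n₂ * p) := by positivity
    unfold expDegTwo
    constructor <;> nlinarith

theorem abs_log_degree_sub_le :
    |Real.log (expDegOne m n₁ n₂ p q) - Real.log (expDegTwo m n₁ n₂ p q)| ≤
      Real.log (degreeRatioBound m r) := by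
  have hr := N.r_pos
  have hnq : 0 < n * q := mul_pos N.n_pos' N.q_pos
  have key : ∀ {d d' : ℝ}, (n * q ≤ r ^ 2 * d ∧ d ≤ n * q * (1 + r + m)) →
      (n * q ≤ r ^ 2 * d' ∧ d' ≤ n * q * (1 + r + m)) →
      Real.log d - Real.log d' ≤ Real.log (degreeRatioBound m r) := by
    intro d d' h h'
    have p1 : 0 < d := pos_of_mul_pos_right (hnq.trans_le h.1) (by positivity)
    have p2 : 0 < d' := pos_of_mul_pos_right (hnq.trans_le h'.1) (by positivity)
    rw [← Real.log_div p1.ne' p2.ne']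
    refine Real.log_le_log (div_pos p1 p2) ?_
    rw [div_le_iff₀ p2, degreeRatioBound]
    calc d ≤ n * q * (1 + r + m) := h.2
      _ ≤ (r ^ 2 * d') * (1 + r + m) := mul_le_mul_of_nonneg_right h'.1 (by positivity)
      _ = _ := by ring
  have h1 := N.degree_bounds (Or.inl rfl)
  have h2 := N.degree_bounds (Or.inr rfl)
  rw [abs_le]
  have := key h1 h2
  have := key h2 h1
  constructor <;> linarith

end BalancedNetwork

variable {φ : ℝ → ℝ → ℝ}

theorem log_weightRatio (hφ : IsWeightFunction φ) (N : BalancedNetwork grp n₁ n₂ p q r) (α : ℝ) :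
    Real.log (weightRatio φ m n₁ n₂ p q α) = Real.log (n₁ / n₂) +
      (Real.log (φ α (expDegOne m n₁ n₂ p q)) - Real.log (φ α (expDegTwo m n₁ n₂ p q))) := by
  have h₁ : 0 < n₁ := by exact_mod_cast N.n₁_pos
  have p1 := hφ.pos α _ (expDegOne_pos (n₂ := n₂) N.two_le h₁ N.p_pos N.q_pos)
  have p2 := hφ.pos α _ (expDegTwo_pos (n₂ := n₂) N.two_le h₁ N.p_pos N.q_pos)
  have p3 : (0 : ℝ) < n₁ / n₂ := div_pos N.n₁_pos N.n₂_pos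
  rw [weightRatio, Real.log_mul p3.ne' (div_pos p1 p2).ne', Real.log_div p1.ne' p2.ne']

theorem weightRatio_mem_Icc (hφ : IsWeightFunction φ) (N : BalancedNetwork grp n₁ n₂ p q r)
    {α c : ℝ} (h : |Real.log (φ α (expDegOne m n₁ n₂ p q)) -
      Real.log (φ α (expDegTwo m n₁ n₂ p q))| ≤ c) :
    weightRatio φ m n₁ n₂ p q α ∈ Set.Icc (r * Real.exp c)⁻¹ (r * Real.exp c) := by
  have h₁ : 0 < n₁ := by exact_mod_cast N.n₁_pos
  have h₂ : 0 < n₂ := by exact_mod_cast N.n₂_pos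
  have hr := N.r_pos
  have hx := weightRatio_pos hφ N.two_le h₁ h₂ N.p_pos N.q_pos α
  have hlog : |Real.log (n₁ / n₂)| ≤ Real.log r := by
    have a1 := N.n₁_pos
    have a2 := N.n₂_pos
    obtain ⟨s1, s2⟩ := N.sizes_le
    rw [Real.log_div a1.ne' a2.ne', abs_le]
    have l1 : Real.log n₁ ≤ Real.log r + Real.log n₂ := by
      rw [← Real.log_mul hr.ne' a2.ne']
      exact Real.log_le_log a1 (s1.trans N.n₂_ge)
    have l2 : Real.log n₂ ≤ Real.log r + Real.log n₁ := by
      rw [← Real.log_mul hr.ne' a1.ne']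
      exact Real.log_le_log a2 (s2.trans N.n₁_ge)
    constructor <;> linarith
  have hl := log_weightRatio hφ N α
  have hK : Real.log (r * Real.exp c) = Real.log r + c := by
    rw [Real.log_mul hr.ne' (Real.exp_pos c).ne', Real.log_exp]
  have hK0 : 0 < r * Real.exp c := by positivity
  have b1 := abs_le.1 hlog
  have b2 := abs_le.1 h
  constructor
  · rw [← Real.log_le_log_iff (inv_pos.2 hK0) hx, Real.log_inv, hK]
    linarith
  · rw [← Real.log_le_log_iff hx hK0, hK]
    linarith

/-- A concentrated network is close, after rescaling, to the block matrix of its expectation, with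
the weights determined by the expected degrees. -/
theorem Concentrated.nearBlock (hφ : IsWeightFunction φ) (N : BalancedNetwork grp n₁ n₂ p q r)
    {α C c D τ κ s : ℝ} {M : Matrix (Fin n) (Fin n) ℝ}
    (hlip : ∀ d d', D ≤ d → D ≤ d' →
      |Real.log (φ α d) - Real.log (φ α d')| ≤ c * |Real.log d - Real.log d'|)
    (hc : 0 ≤ c) (hκ : 0 ≤ κ) (hs : 0 ≤ s) (hD : 0 < D)
    (hB : BlockBounds grp n₁ n₂ (p / q) (weightRatio φ m n₁ n₂ p q α) C)
    (hτ₁ : τ * n ≤ expDegOne m n₁ n₂ p q) (hτ₂ : τ * n ≤ expDegTwo m n₁ n₂ p q)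
    (hτ : 2 * D ≤ τ * n) (hM : Concentrated grp p q M (κ * (τ * n * s)))
    (hs1 : 2 * (m * κ) * s ≤ 1) (hs2 : 2 * (c * (m * κ)) * s ≤ 1)
    (hs3 : 6 * C ^ 4 * ((κ * degreeRatioBound m r + 4 * (c * (m * κ))) * s) ≤ 1) :
    NearBlock grp n₁ n₂ (p / q) (weightRatio φ m n₁ n₂ p q α) C
      ((κ * degreeRatioBound m r + 4 * (c * (m * κ))) * s) (q⁻¹ • M)
      (fun j => (φ α (expDegTwo m n₁ n₂ p q))⁻¹ * φ α (degree M j)) := by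
  have h₁ : 0 < n₁ := by exact_mod_cast N.n₁_pos
  have hq := N.q_pos
  have hr := N.one_le_r
  have hn := N.n_pos'
  have hbd : 0 < degreeRatioBound m r := by unfold degreeRatioBound; positivity
  have hd₁ := expDegOne_pos (n₂ := n₂) N.two_le h₁ N.p_pos N.q_pos
  have hd₂ := expDegTwo_pos (n₂ := n₂) N.two_le h₁ N.p_pos N.q_pos
  have hφ₁ := hφ.pos α _ hd₁
  have hφ₂ := hφ.pos α _ hd₂
  have hτn : 0 < τ * n := by linarith
  have hscale : q⁻¹ • M - blockMatrix grp (p / q) = q⁻¹ • (M - linkMatrix grp p q) := by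
    rw [linkMatrix_eq_smul hq, smul_sub, smul_smul, inv_mul_cancel₀ hq.ne', one_smul]
  -- the scale `q` of the entries is at least of order `τ`
  have ht : q⁻¹ * (κ * (τ * n * s)) ≤
      (κ * degreeRatioBound m r + 4 * (c * (m * κ))) * s * n := by
    have h2 : τ * n ≤ q * n * degreeRatioBound m r := by
      refine (hτ₁.trans (N.degree_bounds (Or.inl rfl)).2).trans ?_
      unfold degreeRatioBound
      calc n * q * (1 + r + m) = q * n * (1 ^ 2 * (1 + r + m)) := by ring
        _ ≤ _ := by gcongr
    rw [inv_mul_le_iff₀ hq]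
    calc κ * (τ * n * s) ≤ κ * (q * n * degreeRatioBound m r * s) := by gcongr
      _ = q * (κ * degreeRatioBound m r * s * n) := by ring
      _ ≤ q * ((κ * degreeRatioBound m r + 4 * (c * (m * κ))) * s * n) := by
          gcongr
          have : 0 ≤ 4 * (c * (m * κ)) := by positivity
          linarith
  refine { hB with
    e_nonneg := by positivity
    e_small := hs3
    nonneg := fun i j => mul_nonneg (inv_nonneg.2 hq.le) (hM.nonneg i j)
    norm_le := ?_
    row_le := fun i k => ?_
    weights := fun j => ?_ }
  · rw [hscale]
    have h1 : toComplex (q⁻¹ • (M - linkMatrix grp p q)) =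
        ((q⁻¹ : ℝ) : ℂ) • toComplex (M - linkMatrix grp p q) := by
      ext i j
      simp only [map_apply, Matrix.smul_apply, smul_eq_mul, Complex.coe_algebraMap]
      push_cast
      rfl
    rw [h1, norm_smul, Complex.norm_real, Real.norm_of_nonneg (inv_nonneg.2 hq.le)]
    exact (mul_le_mul_of_nonneg_left hM.norm_le (inv_nonneg.2 hq.le)).trans ht
  · rw [hscale]
    simp only [Matrix.smul_apply, smul_eq_mul, ← Finset.mul_sum]
    rw [abs_mul, abs_of_pos (inv_pos.2 hq)]
    exact (mul_le_mul_of_nonneg_left (hM.row_le i k) (inv_nonneg.2 hq.le)).trans ht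
  · set d := blockVec grp (expDegOne m n₁ n₂ p q) (expDegTwo m n₁ n₂ p q) j with hd
    have hdpos : 0 < d := blockVec_pos hd₁ hd₂ j
    have hτd : τ * n ≤ d := by rw [hd]; unfold blockVec; split_ifs <;> assumption
    have hw : blockWeight grp n₁ n₂ (weightRatio φ m n₁ n₂ p q α) j =
        (φ α (expDegTwo m n₁ n₂ p q))⁻¹ * φ α d := by
      have a1 := N.n₁_pos.ne'
      have a2 := N.n₂_pos.ne'
      simp only [blockWeight, hd, blockVec, weightRatio]
      split_ifs
      · field_simp
      · field_simp
    have hdev : |degree M j - d| ≤ m * κ * s * d := by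
      have h1 : degree M j - d =
          ∑ k, ∑ l with grp l = k, (M - linkMatrix grp p q) j l := by
        rw [hd, ← degree_linkMatrix N.two_le N.sizes hq, degree, degree, ← Finset.sum_sub_distrib,
          ← Finset.sum_fiberwise Finset.univ grp]
        rfl
      rw [h1]
      refine (Finset.abs_sum_le_sum_abs _ _).trans
        ((Finset.sum_le_sum fun k _ => hM.row_le j k).trans ?_)
      rw [Finset.sum_const, Finset.card_univ, Fintype.card_fin, nsmul_eq_mul]
      calc (m : ℝ) * (κ * (τ * n * s)) ≤ m * (κ * (d * s)) := by gcongr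
        _ = _ := by ring
    have hhalf : |degree M j - d| ≤ d / 2 := by
      refine hdev.trans ?_
      have := mul_le_mul_of_nonneg_right hs1 hdpos.le
      linarith
    have hge : d / 2 ≤ degree M j := by
      have := (abs_le.1 hhalf).1
      linarith
    have hlog : |Real.log (degree M j) - Real.log d| ≤ 2 * (m * κ) * s := by
      refine (abs_log_sub_le_div (b := d / 2) (by positivity) hge (by linarith)).trans ?_
      rw [div_le_iff₀ (by positivity)]
      linarith
    have hlogφ : |Real.log (φ α (degree M j)) - Real.log (φ α d)| ≤ 2 * (c * (m * κ)) * s := by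
      refine (hlip _ _ (by linarith) (by linarith)).trans ?_
      calc c * |Real.log (degree M j) - Real.log d| ≤ c * (2 * (m * κ) * s) := by gcongr
        _ = _ := by ring
    have hφd := hφ.pos α d hdpos
    have h3 := abs_sub_le_mul_of_abs_log_sub_le (hφ.pos α _ (by linarith)) hφd hs2 hlogφ
    rw [hw, ← mul_sub, abs_mul, abs_of_pos (inv_pos.2 hφ₂)]
    calc _ ≤ (φ α (expDegTwo m n₁ n₂ p q))⁻¹ * (2 * (2 * (c * (m * κ)) * s) * φ α d) := by gcongr
      _ = (4 * (c * (m * κ))) * s * ((φ α (expDegTwo m n₁ n₂ p q))⁻¹ * φ α d) := by ring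
      _ ≤ _ := by
          gcongr
          have : 0 ≤ κ * degreeRatioBound m r := by positivity
          linarith

/-- The deterministic part of the comparison: for a concentrated network, the second eigenvalue
decreases between parameters whose separation is a large multiple of the error rate. -/
theorem exists_comparison_constant (hm : 2 ≤ m) (hφ : IsWeightFunction φ) (α₀ αmax : ℝ) {r κ : ℝ}
    (hr : 0 < r) (hκ : 0 < κ) : ∃ C > 0, ∃ s₀ > 0, ∃ D : ℝ,
    ∀ {n : ℕ} {grp : Fin n → Fin m} {n₁ n₂ : ℕ} {p q τ s : ℝ} {M : Matrix (Fin n) (Fin n) ℝ},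
      BalancedNetwork grp n₁ n₂ p q r → n₁ ≠ n₂ → r⁻¹ ≤ |p / q - 1| →
      τ * n ≤ expDegOne m n₁ n₂ p q → τ * n ≤ expDegTwo m n₁ n₂ p q → D ≤ τ * n →
      0 ≤ s → s ≤ s₀ → Concentrated grp p q M (κ * (τ * n * s)) →
      ∀ α₁, α₀ < α₁ → α₁ ≤ αmax → Set.Icc α₀ α₁ ⊆ decreaseRegion φ m n₁ n₂ p q →
      (∀ α ∈ Set.Icc α₀ α₁, C * s *
        |logDerivGap φ α (expDegOne m n₁ n₂ p q) (expDegTwo m n₁ n₂ p q)|⁻¹ < α₁ - α₀) →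
      absLambdaTwo (learningMatrix φ α₁ M) < absLambdaTwo (learningMatrix φ α₀ M) := by
  obtain ⟨c, D, hc, hD, hlip⟩ := hφ.exists_log_lipschitz α₀ αmax
  set b := c * |Real.log (degreeRatioBound m r)| with hb
  have hb0 : 0 ≤ b := by positivity
  set K := r * Real.exp b with hK
  have hK0 : 0 < K := by positivity
  have hrK : r ≤ K := le_mul_of_one_le_right hr.le (Real.one_le_exp hb0)
  obtain ⟨C, hC1, hCB, hCL⟩ := ((eventually_ge_atTop 1).and
    ((eventually_separatedBounds hm hK0).and (eventually_firstOrder_lipschitz hm hK0))).exists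
  have hC : 0 < C := by linarith
  have hbd : 0 < degreeRatioBound m r := by unfold degreeRatioBound; positivity
  have hm0 : (0 : ℝ) < m := by exact_mod_cast (by omega : 0 < m)
  set E := κ * degreeRatioBound m r + 4 * (c * (m * κ)) with hE
  have hE0 : 0 < E := by positivity
  set den := 2 * (m * κ) + 2 * (c * (m * κ)) + 500 * C ^ 15 * E with hden
  have hden0 : 0 < den := by positivity
  refine ⟨K * (12000 * C ^ 33 * E), by positivity, den⁻¹, by positivity, 2 * D, ?_⟩
  intro n grp n₁ n₂ p q τ s M N hne hsep hτ₁ hτ₂ hτ hs hs₀ hM α₁ hα hαmax hsub hgap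
  have hq := N.q_pos
  have h₁ : 0 < n₁ := by exact_mod_cast N.n₁_pos
  have h₂ : 0 < n₂ := by exact_mod_cast N.n₂_pos
  have hd₁ := expDegOne_pos (n₂ := n₂) N.two_le h₁ N.p_pos hq
  have hd₂ := expDegTwo_pos (n₂ := n₂) N.two_le h₁ N.p_pos hq
  have hdne : expDegOne m n₁ n₂ p q ≠ expDegTwo m n₁ n₂ p q := by
    intro h
    have h3 : ((n₁ : ℝ) - n₂) * (p - q) = 0 := by
      unfold expDegOne expDegTwo at h
      linarith
    rcases mul_eq_zero.1 h3 with h4 | h4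
    · exact hne (by exact_mod_cast sub_eq_zero.1 h4)
    · rw [sub_eq_zero.1 h4, div_self hq.ne', sub_self, abs_zero] at hsep
      exact absurd hsep (not_le.2 (inv_pos.2 hr))
  have hden1 : den * s ≤ 1 := by
    calc den * s ≤ den * den⁻¹ := by gcongr
      _ = 1 := mul_inv_cancel₀ hden0.ne'
  have t1 : 0 ≤ 2 * (m * κ) * s := by positivity
  have t2 : 0 ≤ 2 * (c * (m * κ)) * s := by positivity
  have t3 : 0 ≤ 500 * C ^ 15 * E * s := by positivity
  have hexp : den * s = 2 * (m * κ) * s + 2 * (c * (m * κ)) * s + 500 * C ^ 15 * E * s := by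
    rw [hden]; ring
  have hs1 : 2 * (m * κ) * s ≤ 1 := by linarith
  have hs2 : 2 * (c * (m * κ)) * s ≤ 1 := by linarith
  have hs3 : 500 * C ^ 15 * (E * s) ≤ 1 := by rw [← mul_assoc]; linarith
  have hs4 : 6 * C ^ 4 * (E * s) ≤ 1 := by
    refine le_trans ?_ hs3
    gcongr
    · norm_num
    · norm_num
  have hx : ∀ α ∈ Set.Icc α₀ αmax, weightRatio φ m n₁ n₂ p q α ∈ Set.Icc K⁻¹ K := by
    intro α hα
    refine weightRatio_mem_Icc hφ N ((hlip α hα _ _ (by linarith) (by linarith)).trans ?_)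
    exact mul_le_mul_of_nonneg_left (N.abs_log_degree_sub_le.trans (le_abs_self _)) hc
  have hinv : K⁻¹ ≤ r⁻¹ := inv_anti₀ hr hrK
  have hbox : ∀ α ∈ Set.Icc α₀ αmax, (p / q, weightRatio φ m n₁ n₂ p q α) ∈ paramBox K :=
    fun α hα => ⟨⟨hinv.trans N.ratio_ge, N.ratio_le.trans hrK⟩, hx α hα⟩
  have hn₁K : (n : ℝ) ≤ K * n₁ := N.n₁_ge.trans (by gcongr)
  have hn₂K : (n : ℝ) ≤ K * n₂ := N.n₂_ge.trans (by gcongr)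
  have hS : ∀ α ∈ Set.Icc α₀ αmax,
      SeparatedBounds grp n₁ n₂ (p / q) (weightRatio φ m n₁ n₂ p q α) C := fun α hα =>
    hCB ⟨hm, N.sizes, h₁, h₂, div_pos N.p_pos hq, weightRatio_pos hφ hm h₁ h₂ N.p_pos hq α⟩
      (hbox α hα) (hinv.trans hsep) hn₁K hn₂K
  have hnear := fun α hα => hM.nearBlock hφ N (hlip α hα) hc hκ.le hs hD (hS α hα).toBlockBounds
    hτ₁ hτ₂ hτ hs1 hs2 hs4
  have m₀ : α₀ ∈ Set.Icc α₀ αmax := ⟨le_rfl, hα.le.trans hαmax⟩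
  have m₁ : α₁ ∈ Set.Icc α₀ αmax := ⟨hα.le, hαmax⟩
  have hlearn : ∀ α, learningMatrix φ α M = rowNormalized (q⁻¹ • M)
      (fun j => (φ α (expDegTwo m n₁ n₂ p q))⁻¹ * φ α (degree M j)) := fun α => by
    rw [learningMatrix_eq_rowNormalized, rowNormalized_smul_left _ _ (inv_ne_zero hq.ne'),
      rowNormalized_smul_right _ _ (inv_ne_zero (hφ.pos α _ hd₂).ne')]
  rw [hlearn, hlearn]
  refine (hnear α₀ m₀).absLambdaTwo_lt (hnear α₁ m₁) (hS α₀ m₀) (hS α₁ m₁) hs3 ?_ ?_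
    (isDescent_of_subset hφ hm h₁ h₂ N.p_pos hq hdne hα hsub)
  · refine hCL h₁ h₂ (hbox _ m₀) (hbox _ m₁) ?_ hn₂K (by positivity) (hnear α₀ m₀).norm_le
    exact N.sizes_le.2.trans hn₁K
  · have h3 := hφ.lt_abs_log_ratio_sub hd₁ hd₂ hdne hα hgap
    have h4 := abs_log_sub_le_div (inv_pos.2 hK0) (hx _ m₁).1 (hx _ m₀).1
    rw [log_weightRatio hφ N, log_weightRatio hφ N, add_sub_add_left_eq_sub, div_inv_eq_mul,
      abs_sub_comm (weightRatio φ m n₁ n₂ p q α₁)] at h4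
    have h5 : K * (12000 * C ^ 33 * (E * s)) ≤ K * |weightRatio φ m n₁ n₂ p q α₀ -
        weightRatio φ m n₁ n₂ p q α₁| := by
      calc _ = K * (12000 * C ^ 33 * E) * s := by ring
        _ ≤ _ := h3.le.trans (h4.trans (le_of_eq (mul_comm _ _)))
    exact le_of_mul_le_mul_left h5 hK0

end Concentrated

/-! ### Concentration of linear statistics of the network -/

section Concentration

open scoped NNReal

theorem sum_upper_triangle {n : ℕ} (a : Fin n → Fin n → ℝ) :
    ∑ e : {e : Fin n × Fin n // e.1 ≤ e.2},
      (a e.1.1 e.1.2 + if e.1.1 < e.1.2 then a e.1.2 e.1.1 else 0) = ∑ i, ∑ j, a i j := by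
  rw [Finset.sum_add_distrib]
  have h1 : ∑ e : {e : Fin n × Fin n // e.1 ≤ e.2}, a e.1.1 e.1.2 =
      ∑ i, ∑ j, if i ≤ j then a i j else 0 := by
    rw [← Fintype.sum_prod_type', ← Finset.sum_filter]
    exact (Finset.sum_subtype (p := fun e : Fin n × Fin n => e.1 ≤ e.2) _ (by simp)
      (fun e => a e.1 e.2)).symm
  have h2 : ∑ e : {e : Fin n × Fin n // e.1 ≤ e.2},
      (if e.1.1 < e.1.2 then a e.1.2 e.1.1 else 0) = ∑ i, ∑ j, if i < j then a j i else 0 := by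
    have h3 : ∑ i, ∑ j, (if i < j then a j i else 0) =
        ∑ i, ∑ j, if i ≤ j then (if i < j then a j i else 0) else 0 := by
      refine Finset.sum_congr rfl fun i _ => Finset.sum_congr rfl fun j _ => ?_
      by_cases h : i < j
      · rw [if_pos h, if_pos h.le]
      · rw [if_neg h, ite_self]
    rw [h3, ← Fintype.sum_prod_type' (f := fun i j : Fin n => if i ≤ j then
      (if i < j then a j i else 0) else 0)]
    exact (Finset.sum_subtype (p := fun e : Fin n × Fin n => e.1 ≤ e.2)
      (Finset.univ.filter fun e => e.1 ≤ e.2) (by simp)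
      (fun e => if e.1 < e.2 then a e.2 e.1 else 0)).symm.trans (Finset.sum_filter _ _)
  rw [h1, h2, Finset.sum_comm (f := fun i j => if i < j then a j i else 0),
    ← Finset.sum_add_distrib]
  refine Finset.sum_congr rfl fun i _ => ?_
  rw [← Finset.sum_add_distrib]
  refine Finset.sum_congr rfl fun j _ => ?_
  rcases le_or_gt i j with h | h
  · rw [if_pos h, if_neg (not_lt.2 h), add_zero]
  · rw [if_neg (not_le.2 h), if_pos h, zero_add]

/-- Hoeffding's inequality for a weighted sum of independent variables with values in `[0, 1]`. -/
theorem measureReal_weighted_sum_ge_le {Ω ι : Type*} [MeasurableSpace Ω] {μ : Measure Ω}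
    [IsProbabilityMeasure μ] [Fintype ι] {Y : ι → Ω → ℝ} (hind : iIndepFun Y μ)
    (hmeas : ∀ i, Measurable (Y i)) (hY : ∀ i, ∀ᵐ ω ∂μ, Y i ω ∈ Set.Icc (0 : ℝ) 1) (c : ι → ℝ)
    {V t : ℝ} (hV : ∑ i, c i ^ 2 ≤ 2 * V) (hV0 : 0 < V) (ht : 0 ≤ t) :
    μ.real {ω | t ≤ ∑ i, c i * (Y i ω - ∫ ω', Y i ω' ∂μ)} ≤ Real.exp (-t ^ 2 / V) := by
  have hind' : iIndepFun (fun i ω => c i * (Y i ω - ∫ ω', Y i ω' ∂μ)) μ :=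
    hind.comp (fun i x => c i * (x - ∫ ω', Y i ω' ∂μ)) fun i => by fun_prop
  have hsub : ∀ i ∈ (Finset.univ : Finset ι), HasSubgaussianMGF
      (fun ω => c i * (Y i ω - ∫ ω', Y i ω' ∂μ)) ((‖c i‖₊ / 2) ^ 2) μ := by
    intro i _
    have h := (hasSubgaussianMGF_of_mem_Icc (hmeas i).aemeasurable (hY i)).const_mul (c i)
    convert h using 1
    ext
    have h1 : ‖(1 : ℝ) - 0‖ = 1 := by norm_num
    change (‖c i‖ / 2) ^ 2 = c i ^ 2 * (‖(1 : ℝ) - 0‖ / 2) ^ 2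
    rw [h1, div_pow, Real.norm_eq_abs, sq_abs]
    ring
  have h := HasSubgaussianMGF.sum_of_iIndepFun hind' hsub
  have h' : HasSubgaussianMGF (fun ω => ∑ i, c i * (Y i ω - ∫ ω', Y i ω' ∂μ))
      (V / 2).toNNReal μ := by
    refine ⟨h.integrable_exp_mul, fun s => (h.mgf_le s).trans ?_⟩
    apply Real.exp_le_exp.2
    have h2 : ∑ i, (‖c i‖ / 2) ^ 2 ≤ V / 2 := by
      simp only [div_pow, ← Finset.sum_div, Real.norm_eq_abs, sq_abs]
      linarith
    have h3 := mul_le_mul_of_nonneg_right h2 (sq_nonneg s)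
    rw [Real.coe_toNNReal _ (by positivity)]
    push_cast
    linarith
  refine (h'.measure_ge_le ht).trans (le_of_eq ?_)
  rw [Real.coe_toNNReal _ (by positivity)]
  congr 2
  ring

variable {Ω : Type*} [MeasurableSpace Ω] {μ : Measure Ω} [IsProbabilityMeasure μ] {n m : ℕ}
  {grp : Fin n → Fin m} {p q δ : ℝ} {ν : Measure ℝ} {A ε : Ω → Matrix (Fin n) (Fin n) ℝ}

/-- A linear statistic of the perturbed network is concentrated. The deviations of the network and
of the noise are estimated separately, so that their joint law is irrelevant. -/
theorem IsNoisyBlockModel.measureReal_linear_ge_le (hM : IsNoisyBlockModel μ grp p q ν A ε)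
    (hν : ∀ᵐ y ∂ν, y ∈ Set.Icc (0 : ℝ) 1) (hδ₀ : 0 ≤ δ) (hδ₁ : δ ≤ 1) (c : Fin n → Fin n → ℝ)
    {V t : ℝ} (hV : ∑ i, ∑ j, c i j ^ 2 ≤ V) (hV0 : 0 < V) (ht : 0 ≤ t) :
    μ.real {ω | t ≤ ∑ i, ∑ j, c i j * (perturb δ A ε ω -
      linkMatrix grp (perturbedProb δ ν p) (perturbedProb δ ν q)) i j} ≤
        2 * Real.exp (-t ^ 2 / V) := by
  set d : {e : Fin n × Fin n // e.1 ≤ e.2} → ℝ := fun e =>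
    c e.1.1 e.1.2 + if e.1.1 < e.1.2 then c e.1.2 e.1.1 else 0 with hd
  have hdV : ∑ e, d e ^ 2 ≤ 2 * V := by
    have h1 : ∀ e ∈ Finset.univ, d e ^ 2 ≤ 2 * (c e.1.1 e.1.2 ^ 2 +
        if e.1.1 < e.1.2 then c e.1.2 e.1.1 ^ 2 else 0) := by
      intro e _
      simp only [hd]
      split_ifs
      · nlinarith [sq_nonneg (c e.1.1 e.1.2 - c e.1.2 e.1.1)]
      · nlinarith [sq_nonneg (c e.1.1 e.1.2)]
    refine (Finset.sum_le_sum h1).trans ?_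
    rw [← Finset.mul_sum, sum_upper_triangle fun i j => c i j ^ 2]
    linarith
  have hA := measureReal_weighted_sum_ge_le hM.adj_indep (fun e => hM.adj_measurable _ _)
    (fun e => ae_of_all _ fun ω => hM.adj_mem_Icc ω _ _) d hdV hV0 ht
  have hε := measureReal_weighted_sum_ge_le hM.noise_indep (fun e => hM.noise_measurable _ _)
    (fun e => hM.ae_noise_mem_Icc hν _ _) (fun e => c e.1 e.2) (V := V)
    (by rw [Fintype.sum_prod_type]; linarith) hV0 ht
  refine (measureReal_mono ?_).trans ((measureReal_union_le _ _).trans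
    ((add_le_add hA hε).trans (le_of_eq (two_mul _).symm)))
  intro ω hω
  by_contra hnot
  rw [Set.mem_union, not_or, Set.mem_ofPred_eq, Set.mem_ofPred_eq, not_le, not_le] at hnot
  obtain ⟨h1, h2⟩ := hnot
  have hsumA : ∑ e, d e * (A ω e.1.1 e.1.2 - ∫ ω', A ω' e.1.1 e.1.2 ∂μ) =
      ∑ i, ∑ j, c i j * (A ω i j - linkProb p q (grp i) (grp j)) := by
    rw [← sum_upper_triangle]
    refine Finset.sum_congr rfl fun e _ => ?_
    rw [hM.integral_adj]
    simp only [hd]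
    split_ifs
    · rw [hM.adj_symm ω e.1.2 e.1.1]
      have : linkProb p q (grp e.1.2) (grp e.1.1) = linkProb p q (grp e.1.1) (grp e.1.2) := by
        simp only [linkProb, eq_comm]
      rw [this]; ring
    · ring
  have hsumε : ∑ e : Fin n × Fin n, c e.1 e.2 * (ε ω e.1 e.2 - ∫ ω', ε ω' e.1 e.2 ∂μ) =
      ∑ i, ∑ j, c i j * (ε ω i j - ∫ y, y ∂ν) := by
    rw [Fintype.sum_prod_type]
    simp only [hM.integral_noise]
  rw [hsumA] at h1
  rw [hsumε] at h2
  have hdec : ∑ i, ∑ j, c i j * (perturb δ A ε ω -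
      linkMatrix grp (perturbedProb δ ν p) (perturbedProb δ ν q)) i j =
      (1 - δ) * ∑ i, ∑ j, c i j * (A ω i j - linkProb p q (grp i) (grp j)) +
        δ * ∑ i, ∑ j, c i j * (ε ω i j - ∫ y, y ∂ν) := by
    simp only [Finset.mul_sum, ← Finset.sum_add_distrib]
    refine Finset.sum_congr rfl fun i _ => Finset.sum_congr rfl fun j _ => ?_
    simp only [perturb, linkMatrix, Matrix.sub_apply, Matrix.of_apply, linkProb, perturbedProb]
    split_ifs <;> ring
  rw [Set.mem_ofPred_eq, hdec] at hω
  rcases eq_or_lt_of_le hδ₀ with h0 | h0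
  · rw [← h0] at hω
    linarith
  · have h3 := mul_le_mul_of_nonneg_left h1.le (sub_nonneg.2 hδ₁)
    have h4 := mul_lt_mul_of_pos_left h2 h0
    linarith

end Concentration

/-! ### The operator norm of the deviation -/

section Net

open Matrix Module
open scoped Matrix.Norms.L2Operator

/-- A finite-dimensional unit ball has a `1 / 2`-net of at most `5 ^ d` points. -/
theorem exists_half_net (E : Type*) [NormedAddCommGroup E] [NormedSpace ℝ E]
    [FiniteDimensional ℝ E] : ∃ s : Finset E, s.card ≤ 5 ^ finrank ℝ E ∧ (∀ a ∈ s, ‖a‖ ≤ 1) ∧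
      ∀ v : E, ‖v‖ ≤ 1 → ∃ a ∈ s, ‖v - a‖ < 1 / 2 := by
  classical
  set P : Finset E → Prop := fun s => (∀ c ∈ s, ‖c‖ ≤ 2) ∧ ∀ c ∈ s, ∀ d ∈ s, c ≠ d → 1 ≤ ‖c - d‖
    with hP
  have hbound : ∀ s, P s → s.card ≤ 5 ^ finrank ℝ E := fun s hs =>
    Besicovitch.card_le_of_separated s hs.1 hs.2
  -- a separated set of maximal cardinality
  obtain ⟨s, hs, hmax⟩ : ∃ s, P s ∧ ∀ t, P t → t.card ≤ s.card := by
    have hne : ∃ k, ∃ s, P s ∧ s.card = k := ⟨0, ∅, by simp [hP], rfl⟩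
    have hbdd : BddAbove {k | ∃ s, P s ∧ s.card = k} :=
      ⟨5 ^ finrank ℝ E, by rintro _ ⟨s, hs, rfl⟩; exact hbound s hs⟩
    obtain ⟨s, hs, hk⟩ := Nat.sSup_mem hne hbdd
    exact ⟨s, hs, fun t ht => hk ▸ le_csSup hbdd ⟨t, ht, rfl⟩⟩
  refine ⟨s.image fun c => (1 / 2 : ℝ) • c, Finset.card_image_le.trans (hbound s hs), ?_, ?_⟩
  · intro a ha
    obtain ⟨c, hc, rfl⟩ := Finset.mem_image.1 ha
    rw [norm_smul, Real.norm_of_nonneg (by norm_num)]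
    linarith [hs.1 c hc]
  · intro v hv
    by_contra hcon
    push Not at hcon
    have hfar : ∀ c ∈ s, 1 ≤ ‖(2 : ℝ) • v - c‖ := by
      intro c hc
      have h1 := hcon _ (Finset.mem_image_of_mem _ hc)
      have h2 : (2 : ℝ) • v - c = (2 : ℝ) • (v - (1 / 2 : ℝ) • c) := by
        rw [smul_sub, smul_smul]; norm_num
      rw [h2, norm_smul, Real.norm_of_nonneg (by norm_num)]
      linarith
    have hnot : (2 : ℝ) • v ∉ s := fun hmem => by
      have := hfar _ hmem
      rw [sub_self, norm_zero] at this
      linarith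
    have hP' : P (insert ((2 : ℝ) • v) s) := by
      constructor
      · intro c hc
        rcases Finset.mem_insert.1 hc with rfl | hc
        · rw [norm_smul, Real.norm_of_nonneg (by norm_num)]; linarith
        · exact hs.1 c hc
      · intro c hc d hd hcd
        rcases Finset.mem_insert.1 hc with rfl | hc <;> rcases Finset.mem_insert.1 hd with rfl | hd
        · exact absurd rfl hcd
        · exact hfar d hd
        · rw [norm_sub_rev]; exact hfar c hc
        · exact hs.2 c hc d hd hcd
    have := hmax _ hP'
    rw [Finset.card_insert_of_notMem hnot] at this
    omega

/-- The operator norm is controlled by the sesquilinear form on a `1 / 2`-net. -/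
theorem opNorm_le_of_net {E : Type*} [NormedAddCommGroup E] [InnerProductSpace ℂ E] (T : E →L[ℂ] E)
    {s : Finset E} (hs : ∀ v : E, ‖v‖ ≤ 1 → ∃ a ∈ s, ‖v - a‖ < 1 / 2) {t : ℝ} (ht : 0 ≤ t)
    (h : ∀ a ∈ s, ∀ b ∈ s, (inner ℂ a (T b)).re ≤ t) : ‖T‖ ≤ 4 * t := by
  have h1 : ∀ b ∈ s, ‖T b‖ ≤ 2 * t := by
    intro b hb
    rcases eq_or_ne (T b) 0 with h0 | h0
    · rw [h0, norm_zero]; positivity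
    have hpos : 0 < ‖T b‖ := norm_pos_iff.2 h0
    set u : E := ((‖T b‖⁻¹ : ℝ) : ℂ) • T b with hu
    have hu1 : ‖u‖ = 1 := by
      rw [hu, norm_smul, Complex.norm_real, norm_inv, norm_norm, inv_mul_cancel₀ hpos.ne']
    obtain ⟨a, ha, hua⟩ := hs u hu1.le
    have h2 : (inner ℂ u (T b)).re = ‖T b‖ := by
      rw [hu, inner_smul_left, Complex.conj_ofReal, Complex.re_ofReal_mul,
        inner_self_eq_norm_sq_to_K]
      have : (((‖T b‖ : ℝ) : ℂ) ^ 2).re = ‖T b‖ ^ 2 := by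
        rw [← Complex.ofReal_pow, Complex.ofReal_re]
      erw [this]
      field_simp
    have h3 : (inner ℂ u (T b)).re = (inner ℂ a (T b)).re + (inner ℂ (u - a) (T b)).re := by
      rw [← Complex.add_re, ← inner_add_left, add_sub_cancel]
    have h4 : (inner ℂ (u - a) (T b)).re ≤ 1 / 2 * ‖T b‖ :=
      (Complex.re_le_norm _).trans ((norm_inner_le_norm _ _).trans (by gcongr))
    have h5 := h a ha b hb
    linarith
  have h2 : ‖T‖ ≤ 2 * t + ‖T‖ / 2 := by
    refine ContinuousLinearMap.opNorm_le_of_unit_norm (𝕜 := ℂ) (by positivity) fun v hv => ?_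
    obtain ⟨b, hb, hvb⟩ := hs v hv.le
    have h3 : T v = T b + T (v - b) := by rw [← map_add, add_sub_cancel]
    rw [h3]
    refine (norm_add_le _ _).trans (add_le_add (h1 b hb) ?_)
    refine (T.le_opNorm _).trans ?_
    have := mul_le_mul_of_nonneg_left hvb.le (norm_nonneg T)
    linarith
  linarith

variable {Ω : Type*} [MeasurableSpace Ω] {μ : Measure Ω} [IsProbabilityMeasure μ] {n m : ℕ}
  {grp : Fin n → Fin m} {p q δ : ℝ} {ν : Measure ℝ} {A ε : Ω → Matrix (Fin n) (Fin n) ℝ}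

theorem re_inner_mulVec (Z : Matrix (Fin n) (Fin n) ℝ) (a b : EuclideanSpace ℂ (Fin n)) :
    (inner ℂ a (toEuclideanCLM (n := Fin n) (𝕜 := ℂ) (toComplex Z) b)).re =
      ∑ i, ∑ j, (starRingEnd ℂ (a i) * b j).re * Z i j := by
  rw [PiLp.inner_apply, Complex.re_sum]
  refine Finset.sum_congr rfl fun i _ => ?_
  have h1 : (toEuclideanCLM (n := Fin n) (𝕜 := ℂ) (toComplex Z) b).ofLp i =
      ∑ j, (Z i j : ℂ) * b j := by
    rw [ofLp_toEuclideanCLM]; rfl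
  rw [h1, RCLike.inner_apply, Finset.sum_mul, Complex.re_sum]
  refine Finset.sum_congr rfl fun j _ => ?_
  rw [mul_assoc, Complex.re_ofReal_mul, mul_comm, mul_comm (b j)]

theorem sum_re_sq_le {a b : EuclideanSpace ℂ (Fin n)} (ha : ‖a‖ ≤ 1) (hb : ‖b‖ ≤ 1) :
    ∑ i, ∑ j, (starRingEnd ℂ (a i) * b j).re ^ 2 ≤ 1 := by
  have h1 : ∀ i ∈ Finset.univ, ∀ j ∈ Finset.univ, (starRingEnd ℂ (a i) * b j).re ^ 2 ≤
      ‖a i‖ ^ 2 * ‖b j‖ ^ 2 := by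
    intro i _ j _
    rw [← mul_pow, ← sq_abs]
    refine pow_le_pow_left₀ (abs_nonneg _) ((Complex.abs_re_le_norm _).trans (le_of_eq ?_)) 2
    rw [norm_mul, RCLike.norm_conj]
  refine (Finset.sum_le_sum fun i hi => Finset.sum_le_sum (h1 i hi)).trans ?_
  simp only [← Finset.mul_sum, ← Finset.sum_mul]
  rw [← EuclideanSpace.norm_sq_eq, ← EuclideanSpace.norm_sq_eq]
  have h2 : ‖a‖ ^ 2 ≤ 1 := pow_le_one₀ (norm_nonneg _) ha
  have h3 : ‖b‖ ^ 2 ≤ 1 := pow_le_one₀ (norm_nonneg _) hb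
  exact mul_le_one₀ h2 (by positivity) h3

/-- The deviation of the perturbed network has operator norm of order `√n`. -/
theorem IsNoisyBlockModel.measureReal_norm_gt_le (hM : IsNoisyBlockModel μ grp p q ν A ε)
    (hν : ∀ᵐ y ∂ν, y ∈ Set.Icc (0 : ℝ) 1) (hδ₀ : 0 ≤ δ) (hδ₁ : δ ≤ 1) :
    μ.real {ω | 12 * √n < ‖toComplex (perturb δ A ε ω -
      linkMatrix grp (perturbedProb δ ν p) (perturbedProb δ ν q))‖} ≤
        2 * Real.exp (-(2 * n)) := by
  obtain ⟨s, hcard, hs1, hs⟩ := exists_half_net (EuclideanSpace ℂ (Fin n))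
  rw [finrank_real_of_complex, finrank_euclideanSpace_fin] at hcard
  set Z : Ω → Matrix (Fin n) (Fin n) ℝ := fun ω => perturb δ A ε ω -
    linkMatrix grp (perturbedProb δ ν p) (perturbedProb δ ν q) with hZ
  set c : EuclideanSpace ℂ (Fin n) × EuclideanSpace ℂ (Fin n) → Fin n → Fin n → ℝ :=
    fun e i j => (starRingEnd ℂ (e.1 i) * e.2 j).re with hc
  have hsub : {ω | 12 * √n < ‖toComplex (Z ω)‖} ⊆
      ⋃ e ∈ s ×ˢ s, {ω | 3 * √n ≤ ∑ i, ∑ j, c e i j * Z ω i j} := by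
    intro ω hω
    by_contra hnot
    simp only [Set.mem_iUnion, not_exists, Set.mem_ofPred_eq, not_le] at hnot
    refine absurd (show 12 * √n < ‖toComplex (Z ω)‖ from hω) (not_lt.2 ?_)
    rw [cstar_norm_def]
    refine (opNorm_le_of_net _ hs (t := 3 * √n) (by positivity) fun a ha b hb => ?_).trans
      (by linarith)
    rw [re_inner_mulVec]
    exact (hnot (a, b) (Finset.mem_product.2 ⟨ha, hb⟩)).le
  refine (measureReal_mono hsub (measure_ne_top _ _)).trans ((measureReal_biUnion_finset_le _ _).trans ?_)
  have hterm : ∀ e ∈ s ×ˢ s, μ.real {ω | 3 * √n ≤ ∑ i, ∑ j, c e i j * Z ω i j} ≤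
      2 * Real.exp (-(9 * n)) := by
    intro e he
    obtain ⟨h1, h2⟩ := Finset.mem_product.1 he
    have h3 := hM.measureReal_linear_ge_le hν hδ₀ hδ₁ (c e) (V := 1) (t := 3 * √n)
      (sum_re_sq_le (hs1 _ h1) (hs1 _ h2)) one_pos (by positivity)
    rwa [mul_pow, Real.sq_sqrt (Nat.cast_nonneg n), div_one,
      show (-(3 ^ 2 * (n : ℝ))) = -(9 * n) by ring] at h3
  refine (Finset.sum_le_sum hterm).trans ?_
  rw [Finset.sum_const, Finset.card_product, nsmul_eq_mul]
  have h625 : (625 : ℝ) ≤ Real.exp 7 := by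
    have h1 : Real.exp 7 = Real.exp 1 ^ 7 := by rw [← Real.exp_nat_mul]; norm_num
    rw [h1]
    calc (625 : ℝ) ≤ 2.7 ^ 7 := by norm_num
      _ ≤ _ := by
        have := Real.exp_one_gt_d9
        gcongr
        linarith
  have hcard' : ((s.card * s.card : ℕ) : ℝ) ≤ Real.exp (7 * n) := by
    calc ((s.card * s.card : ℕ) : ℝ) ≤ ((5 ^ (2 * n) * 5 ^ (2 * n) : ℕ) : ℝ) := by
          exact_mod_cast Nat.mul_le_mul hcard hcard
      _ = 625 ^ n := by
          push_cast
          rw [← mul_pow, pow_mul]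
          norm_num
      _ ≤ Real.exp 7 ^ n := by gcongr
      _ = _ := by rw [← Real.exp_nat_mul, mul_comm]
  calc _ ≤ Real.exp (7 * n) * (2 * Real.exp (-(9 * n))) := by gcongr
    _ = 2 * (Real.exp (7 * n) * Real.exp (-(9 * n))) := by ring
    _ = _ := by rw [← Real.exp_add]; ring_nf

/-- The number of links from a vertex to a group deviates by at most order `√(n log n)`. -/
theorem IsNoisyBlockModel.measureReal_group_sum_gt_le (hM : IsNoisyBlockModel μ grp p q ν A ε)
    (hν : ∀ᵐ y ∂ν, y ∈ Set.Icc (0 : ℝ) 1) (hδ₀ : 0 ≤ δ) (hδ₁ : δ ≤ 1) (hn : 0 < n) (i : Fin n)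
    (k : Fin m) :
    μ.real {ω | 2 * √(n * Real.log n) < |∑ j with grp j = k, (perturb δ A ε ω -
      linkMatrix grp (perturbedProb δ ν p) (perturbedProb δ ν q)) i j|} ≤ 4 / n ^ 4 := by
  have hn' : (0 : ℝ) < n := by exact_mod_cast hn
  have hlog : 0 ≤ Real.log n := Real.log_natCast_nonneg n
  set Z : Ω → Matrix (Fin n) (Fin n) ℝ := fun ω => perturb δ A ε ω -
    linkMatrix grp (perturbedProb δ ν p) (perturbedProb δ ν q) with hZ
  have hone : ∀ σ : ℝ, σ ^ 2 = 1 →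
      μ.real {ω | 2 * √(n * Real.log n) ≤ σ * ∑ j with grp j = k, Z ω i j} ≤ 2 / n ^ 4 := by
    intro σ hσ
    have h1 := hM.measureReal_linear_ge_le hν hδ₀ hδ₁
      (fun i' j => if i' = i then (if grp j = k then σ else 0) else 0) (V := n)
      (t := 2 * √(n * Real.log n)) (by
        simp only [ite_pow, hσ, ne_eq, OfNat.ofNat_ne_zero, not_false_eq_true, zero_pow]
        rw [Finset.sum_eq_single i (fun b _ hb => by simp [hb]) (by simp)]
        simp only [↓reduceIte]
        rw [← Finset.sum_filter, Finset.sum_const, nsmul_eq_mul, mul_one]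
        exact_mod_cast (Finset.card_le_univ _).trans (le_of_eq (Fintype.card_fin n))) hn'
      (by positivity)
    have h2 : Real.exp (-(2 * √(n * Real.log n)) ^ 2 / n) = 1 / n ^ 4 := by
      rw [mul_pow, Real.sq_sqrt (by positivity)]
      have : -(2 ^ 2 * (n * Real.log n)) / n = -(((4 : ℕ) : ℝ) * Real.log n) := by
        push_cast
        field_simp
        ring
      rw [this, Real.exp_neg, Real.exp_nat_mul, Real.exp_log hn', one_div]
    rw [h2, mul_one_div] at h1
    refine le_trans (le_of_eq ?_) h1
    congr 1
    ext ω
    rw [Set.mem_ofPred_eq, Set.mem_ofPred_eq]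
    have h3 : ∑ i', ∑ j, (if i' = i then (if grp j = k then σ else 0) else 0) * Z ω i' j =
        σ * ∑ j with grp j = k, Z ω i j := by
      rw [Finset.sum_eq_single i (fun b _ hb => by simp [hb]) (by simp), Finset.mul_sum,
        Finset.sum_filter]
      refine Finset.sum_congr rfl fun j _ => ?_
      rw [if_pos rfl]
      split_ifs <;> ring
    rw [← h3]
  have h1 := hone 1 (by norm_num)
  have h2 := hone (-1) (by norm_num)
  refine (measureReal_mono ?_).trans ((measureReal_union_le _ _).trans
    ((add_le_add h1 h2).trans (le_of_eq (by ring))))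
  intro ω hω
  rw [Set.mem_ofPred_eq] at hω
  rcases le_abs'.1 hω.le with h | h
  · right
    rw [Set.mem_ofPred_eq]
    linarith
  · left
    rw [Set.mem_ofPred_eq]
    linarith

end Net

/-! ### Random networks -/

section RandomNetwork

open scoped Matrix.Norms.L2Operator

theorem one_le_log_natCast {n : ℕ} (hn : 3 ≤ n) : 1 ≤ Real.log n := by
  have hn' : (3 : ℝ) ≤ n := by exact_mod_cast hn
  rw [Real.le_log_iff_exp_le (by linarith)]
  linarith [Real.exp_one_lt_d9]

section Probability

variable {Ω : Type*} [MeasurableSpace Ω] {μ : Measure Ω} [IsProbabilityMeasure μ] {n m : ℕ}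
  {grp : Fin n → Fin m} {p q δ : ℝ} {ν : Measure ℝ} {A ε : Ω → Matrix (Fin n) (Fin n) ℝ}

/-- The deviation is of order `√(n log n)` with probability at least `1 - 16 / n²`. -/
theorem IsNoisyBlockModel.measureReal_not_concentrated_le
    (hM : IsNoisyBlockModel μ grp p q ν A ε)
    (hν : ∀ᵐ y ∂ν, y ∈ Set.Icc (0 : ℝ) 1) (hδ₀ : 0 ≤ δ) (hδ₁ : δ ≤ 1) (hn : 3 ≤ n) (hnm : m ≤ n) :
    μ.real {ω | ¬ Concentrated grp (perturbedProb δ ν p) (perturbedProb δ ν q)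
      (perturb δ A ε ω) (12 * √(n * Real.log n))} ≤ 16 / n ^ 2 := by
  have hn0 : 0 < n := by omega
  have hn' : (0 : ℝ) < n := by exact_mod_cast hn0
  have hlog := one_le_log_natCast hn
  have hsqrt : √n ≤ √(n * Real.log n) := Real.sqrt_le_sqrt (le_mul_of_one_le_right hn'.le hlog)
  have hnull : μ.real {ω | ¬ ∀ i j, ε ω i j ∈ Set.Icc (0 : ℝ) 1} = 0 := by
    have h : ∀ᵐ ω ∂μ, ∀ i j, ε ω i j ∈ Set.Icc (0 : ℝ) 1 :=
      ae_all_iff.2 fun i => ae_all_iff.2 fun j => hM.ae_noise_mem_Icc hν i j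
    rw [measureReal_def, ae_iff.1 h, ENNReal.toReal_zero]
  set N : Set Ω := {ω | 12 * √n < ‖toComplex (perturb δ A ε ω -
      linkMatrix grp (perturbedProb δ ν p) (perturbedProb δ ν q))‖} with hN
  set G : Fin n × Fin m → Set Ω := fun e => {ω | 2 * √(n * Real.log n) <
    |∑ j with grp j = e.2, (perturb δ A ε ω -
      linkMatrix grp (perturbedProb δ ν p) (perturbedProb δ ν q)) e.1 j|} with hG
  have hsub : {ω | ¬ Concentrated grp (perturbedProb δ ν p) (perturbedProb δ ν q)
      (perturb δ A ε ω) (12 * √(n * Real.log n))} ⊆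
      ({ω | ¬ ∀ i j, ε ω i j ∈ Set.Icc (0 : ℝ) 1} ∪ N) ∪ ⋃ e ∈ Finset.univ, G e := by
    intro ω hω
    by_contra hnot
    simp only [Set.mem_union, not_or, Set.mem_iUnion, not_exists, hN, hG, Set.mem_ofPred_eq,
      not_lt, not_not] at hnot
    obtain ⟨⟨h1, h2⟩, h3⟩ := hnot
    refine hω ⟨fun i j => ?_, h2.trans (by gcongr), fun i k =>
      (h3 (i, k) (Finset.mem_univ _)).trans (by gcongr; norm_num)⟩
    exact add_nonneg (mul_nonneg (sub_nonneg.2 hδ₁) (hM.adj_mem_Icc ω i j).1)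
      (mul_nonneg hδ₀ (h1 i j).1)
  have hG' : μ.real (⋃ e ∈ Finset.univ, G e) ≤ n * m * (4 / n ^ 4) := by
    refine (measureReal_biUnion_finset_le _ _).trans ?_
    refine (Finset.sum_le_sum fun e _ =>
      hM.measureReal_group_sum_gt_le hν hδ₀ hδ₁ hn0 e.1 e.2).trans (le_of_eq ?_)
    rw [Finset.sum_const, Finset.card_univ, Fintype.card_prod, Fintype.card_fin, Fintype.card_fin,
      nsmul_eq_mul]
    push_cast
    ring
  have hexp : Real.exp (-(2 * n)) ≤ 1 / n ^ 2 := by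
    rw [Real.exp_neg, ← one_div]
    have h1 : (n : ℝ) ≤ Real.exp n := by linarith [Real.add_one_le_exp (n : ℝ)]
    have h2 : Real.exp (2 * n) = Real.exp n ^ 2 := by rw [← Real.exp_nat_mul]; norm_num
    rw [h2]
    gcongr
  have hm' : (m : ℝ) ≤ n := by exact_mod_cast hnm
  calc _ ≤ _ := measureReal_mono hsub (measure_ne_top _ _)
    _ ≤ (0 + 2 * (1 / (n : ℝ) ^ 2)) + n * n * (4 / n ^ 4) := by
        refine (measureReal_union_le _ _).trans (add_le_add ((measureReal_union_le _ _).trans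
          (add_le_add hnull.le ?_)) (hG'.trans (by gcongr)))
        exact (hM.measureReal_norm_gt_le hν hδ₀ hδ₁).trans (by gcongr)
    _ = 6 / n ^ 2 := by field_simp; ring
    _ ≤ 16 / n ^ 2 := by gcongr; norm_num

end Probability

section Limits

theorem errorRate_eq (n : ℕ) (τ : ℝ) : errorRate n τ = (τ / √(Real.log n / n))⁻¹ := by
  rw [errorRate, Real.sqrt_div' _ (Nat.cast_nonneg n), inv_div, div_div, mul_comm τ]

theorem mul_mul_errorRate {n : ℕ} {τ : ℝ} (hn : 0 < n) (hτ : 0 < τ) :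
    τ * n * errorRate n τ = √(n * Real.log n) := by
  have hn' : (0 : ℝ) < n := by exact_mod_cast hn
  rw [errorRate, Real.sqrt_mul hn'.le]
  have h1 : √(n : ℝ) * √n = n := Real.mul_self_sqrt hn'.le
  have h2 : (0 : ℝ) < √n := Real.sqrt_pos.2 hn'
  rw [mul_div_assoc', div_eq_iff (by positivity)]
  linear_combination -(τ * √(Real.log n)) * h1

theorem sqrt_le_mul_of_le_div {n : ℕ} {τ : ℝ} (hn : 3 ≤ n) (h : 1 ≤ τ / √(Real.log n / n)) :
    0 < τ ∧ √n ≤ τ * n := by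
  have hn' : (0 : ℝ) < n := by exact_mod_cast (by omega : 0 < n)
  have hlog := one_le_log_natCast hn
  have hs : 0 < √(Real.log n / n) := Real.sqrt_pos.2 (by positivity)
  rw [le_div_iff₀ hs, one_mul] at h
  refine ⟨hs.trans_le h, ?_⟩
  have h3 : (√n)⁻¹ ≤ √(Real.log n / n) := by
    rw [← Real.sqrt_inv]
    apply Real.sqrt_le_sqrt
    rw [inv_eq_one_div]
    gcongr
  calc √n = (√n)⁻¹ * n := by rw [inv_mul_eq_div, Real.div_sqrt]
    _ ≤ τ * n := by gcongr; exact h3.trans h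

end Limits

theorem exists_mem_group {n m : ℕ} {grp : Fin n → Fin m} {n₁ n₂ : ℕ}
    (hg : HasGroupSizes grp n₁ n₂) (h₁ : 0 < n₁) (h₂ : 0 < n₂) (k : Fin m) : ∃ i, grp i = k := by
  have h := hg k
  have h3 : 0 < groupSize grp k := by rw [h]; split_ifs <;> assumption
  obtain ⟨i, hi⟩ := Finset.card_pos.1 h3
  exact ⟨i, (Finset.mem_filter.1 hi).2⟩

theorem minDensity_mul_le {n m : ℕ} {grp : Fin n → Fin m} {n₁ n₂ : ℕ} {p q : ℝ} (hm : 2 ≤ m)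
    (hn : 0 < n) (hg : HasGroupSizes grp n₁ n₂) (h₁ : 0 < n₁) (h₂ : 0 < n₂) (hq : 0 < q) :
    minDensity (linkMatrix grp p q) * n ≤ expDegOne m n₁ n₂ p q ∧
      minDensity (linkMatrix grp p q) * n ≤ expDegTwo m n₁ n₂ p q := by
  have hn' : (0 : ℝ) < n := by exact_mod_cast hn
  have hle : ∀ i, minDensity (linkMatrix grp p q) * n ≤ degree (linkMatrix grp p q) i := by
    intro i
    rw [minDensity, div_mul_cancel₀ _ hn'.ne']
    exact ciInf_le (Set.finite_range _).bddBelow i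
  obtain ⟨i, hi⟩ := exists_mem_group hg h₁ h₂ ⟨0, by omega⟩
  obtain ⟨j, hj⟩ := exists_mem_group hg h₁ h₂ ⟨1, by omega⟩
  have hi' := hle i
  have hj' := hle j
  rw [degree_linkMatrix hm hg hq, blockVec, hi, if_pos rfl] at hi'
  rw [degree_linkMatrix hm hg hq, blockVec, hj, if_neg one_ne_zero] at hj'
  exact ⟨hi', hj'⟩

theorem IsNoisyBlockModel.perturbedProb_nonneg {Ω : Type*} [MeasurableSpace Ω] {μ : Measure Ω}
    {n m : ℕ} {grp : Fin n → Fin m} {p q δ : ℝ} {ν : Measure ℝ}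
    {A ε : Ω → Matrix (Fin n) (Fin n) ℝ} (hM : IsNoisyBlockModel μ grp p q ν A ε)
    (hν : ∀ᵐ y ∂ν, y ∈ Set.Icc (0 : ℝ) 1) (hδ₀ : 0 ≤ δ) (hδ₁ : δ ≤ 1) (hm : 2 ≤ m)
    {n₁ n₂ : ℕ} (hg : HasGroupSizes grp n₁ n₂) (h₁ : 0 < n₁) (h₂ : 0 < n₂) :
    0 ≤ perturbedProb δ ν p ∧ 0 ≤ perturbedProb δ ν q := by
  obtain ⟨i, hi⟩ := exists_mem_group hg h₁ h₂ ⟨0, by omega⟩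
  obtain ⟨j, hj⟩ := exists_mem_group hg h₁ h₂ ⟨1, by omega⟩
  have hp : 0 ≤ p := by
    have h := hM.adj_prob i i
    rw [linkProb, if_pos rfl] at h
    rw [← h]; exact measureReal_nonneg
  have hq : 0 ≤ q := by
    have h := hM.adj_prob i j
    rw [linkProb, if_neg (by rw [hi, hj]; simp)] at h
    rw [← h]; exact measureReal_nonneg
  have hmean : 0 ≤ ∫ y, y ∂ν := integral_nonneg_of_ae (hν.mono fun y hy => hy.1)
  have hδ := sub_nonneg.2 hδ₁
  constructor <;> unfold perturbedProb <;> positivity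

end RandomNetwork

/-! ### Monotonicity and comparison of the second eigenvalue -/

theorem proposition4 (m : ℕ) (hm : 2 ≤ m) (φ : ℝ → ℝ → ℝ) (hφ : IsWeightFunction φ) :
    -- monotonicity of `|λ₂|` for the learning matrix of the expected perturbed network
    (∀ (δ : ℝ), 0 ≤ δ → δ ≤ 1 →
      ∀ (ν : Measure ℝ) [IsProbabilityMeasure ν], ν (Set.Icc 0 1) = 1 →
      ∀ (n n₁ n₂ : ℕ) (grp : Fin n → Fin m) (p q : ℝ)
        (Ω : Type u) [MeasurableSpace Ω] (μ : Measure Ω) [IsProbabilityMeasure μ]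
        (A ε : Ω → Matrix (Fin n) (Fin n) ℝ),
        IsNoisyBlockModel μ grp p q ν A ε →
        0 < n₁ → 0 < n₂ → n₁ ≠ n₂ → HasGroupSizes grp n₁ n₂ →
        0 < perturbedProb δ ν p → 0 < perturbedProb δ ν q →
        expDegOne m n₁ n₂ (perturbedProb δ ν p) (perturbedProb δ ν q) ≠
          expDegTwo m n₁ n₂ (perturbedProb δ ν p) (perturbedProb δ ν q) →
        Set.BijOn (gFun φ m n₁ n₂ (perturbedProb δ ν p) (perturbedProb δ ν q))
          Set.univ (Set.Ioi 0) ∧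
        ∀ I : Set ℝ, I.OrdConnected →
          (I ⊆ decreaseRegion φ m n₁ n₂ (perturbedProb δ ν p) (perturbedProb δ ν q) →
            StrictAntiOn (fun α =>
              absLambdaTwo (learningMatrix φ α (expectedMatrix μ (perturb δ A ε)))) I) ∧
          (I ⊆ (decreaseRegion φ m n₁ n₂ (perturbedProb δ ν p) (perturbedProb δ ν q))ᶜ →
            StrictMonoOn (fun α =>
              absLambdaTwo (learningMatrix φ α (expectedMatrix μ (perturb δ A ε)))) I)) ∧
    -- comparison of `|λ₂|` for the random perturbed learning matrix at `α₀ < α₁`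
    (∀ (α₀ αmax r : ℝ), 0 < r → ∃ C : ℝ, 0 < C ∧
      ∀ (δ : ℝ), 0 ≤ δ → δ ≤ 1 →
      ∀ (ν : Measure ℝ) [IsProbabilityMeasure ν], ν (Set.Icc 0 1) = 1 →
      ∀ (n₁ n₂ : ℕ → ℕ) (grp : (n : ℕ) → Fin n → Fin m) (p q : ℕ → ℝ)
        (Ω : ℕ → Type u) [∀ n, MeasurableSpace (Ω n)] (μ : (n : ℕ) → Measure (Ω n))
        [∀ n, IsProbabilityMeasure (μ n)]
        (A ε : (n : ℕ) → Ω n → Matrix (Fin n) (Fin n) ℝ),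
        (∀ n, IsNoisyBlockModel (μ n) (grp n) (p n) (q n) ν (A n) (ε n)) →
        (∀ᶠ n in atTop, HasGroupSizes (grp n) (n₁ n) (n₂ n) ∧ n₁ n ≠ n₂ n) →
        -- density
        Tendsto (fun n : ℕ => minDensity (expectedMatrix (μ n) (perturb δ (A n) (ε n))) /
          Real.sqrt (Real.log n / n)) atTop atTop →
        -- no vanishing groups
        (∀ᶠ n : ℕ in atTop, 1 / r ≤ (n₁ n : ℝ) / n ∧ 1 / r ≤ (n₂ n : ℝ) / n) →
        -- comparable densities, with a ratio that stays away from `1`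
        (∀ᶠ n in atTop,
          1 / r ≤ perturbedProb δ ν (p n) / perturbedProb δ ν (q n) ∧
          perturbedProb δ ν (p n) / perturbedProb δ ν (q n) ≤ r ∧
          1 / r ≤ |perturbedProb δ ν (p n) / perturbedProb δ ν (q n) - 1|) →
        ∃ n₀ : ℕ, ∀ n > n₀, ∀ α₁ : ℝ, α₀ < α₁ → α₁ ≤ αmax →
          Set.Icc α₀ α₁ ⊆ decreaseRegion φ m (n₁ n) (n₂ n)
            (perturbedProb δ ν (p n)) (perturbedProb δ ν (q n)) →
          (∀ α ∈ Set.Icc α₀ α₁,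
            C * errorRate n (minDensity (expectedMatrix (μ n) (perturb δ (A n) (ε n)))) *
              |logDerivGap φ α
                (expDegOne m (n₁ n) (n₂ n) (perturbedProb δ ν (p n)) (perturbedProb δ ν (q n)))
                (expDegTwo m (n₁ n) (n₂ n) (perturbedProb δ ν (p n)) (perturbedProb δ ν (q n)))|⁻¹
              < α₁ - α₀) →
          1 - 16 / (n : ℝ) ^ 2 ≤ (μ n).real {ω |
            0 < absLambdaTwo (learningMatrix φ α₀ (perturb δ (A n) (ε n) ω)) -
              absLambdaTwo (learningMatrix φ α₁ (perturb δ (A n) (ε n) ω))}) := by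
  refine ⟨?_, ?_⟩
  · intro δ hδ₀ hδ₁ ν _ hν n n₁ n₂ grp p q Ω _ μ _ A ε hM h₁ h₂ _ hg hp hq hne
    refine ⟨bijOn_gFun hφ hm h₁ hp hq hne, fun I hI => ?_⟩
    rw [hM.expectedMatrix_perturb (ae_mem_Icc_of_measure_eq_one hν)]
    exact monotonicity_absLambdaTwo_linkMatrix hφ hm hg h₁ h₂ hp hq hne hI
  · intro α₀ αmax r hr
    obtain ⟨C, hC, s₀, hs₀, D, hcomp⟩ :=
      exists_comparison_constant hm hφ α₀ αmax hr (κ := 12) (by norm_num)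
    refine ⟨C, hC, ?_⟩
    intro δ hδ₀ hδ₁ ν _ hν n₁ n₂ grp p q Ω _ μ _ A ε hM hsizes hdense hgroups hratio
    have hν' := ae_mem_Icc_of_measure_eq_one hν
    simp only [fun n => (hM n).expectedMatrix_perturb (δ := δ) hν'] at hdense ⊢
    have hev : ∀ᶠ n : ℕ in atTop,
        1 ≤ minDensity (linkMatrix (grp n) (perturbedProb δ ν (p n)) (perturbedProb δ ν (q n))) /
          √(Real.log n / n) ∧
        s₀⁻¹ ≤ minDensity (linkMatrix (grp n) (perturbedProb δ ν (p n))
          (perturbedProb δ ν (q n))) / √(Real.log n / n) :=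
      (hdense.eventually_ge_atTop 1).and (hdense.eventually_ge_atTop s₀⁻¹)
    have hlarge : ∀ᶠ n : ℕ in atTop, D ≤ √n :=
      (Real.tendsto_sqrt_atTop.comp tendsto_natCast_atTop_atTop).eventually_ge_atTop D
    obtain ⟨n₀, hn₀⟩ := eventually_atTop.1 (hev.and (hlarge.and (hsizes.and (hgroups.and
      (hratio.and ((eventually_ge_atTop 3).and (eventually_ge_atTop m)))))))
    refine ⟨n₀, fun n hn α₁ hα hαmax hsub hgap => ?_⟩
    obtain ⟨⟨hd1, hd2⟩, hD, ⟨hg, hne⟩, ⟨hgr₁, hgr₂⟩, ⟨hr1, hr2, hr3⟩, hn3, hnm⟩ := hn₀ n hn.le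
    have hnpos : 0 < n := by omega
    have hn' : (0 : ℝ) < n := by exact_mod_cast hnpos
    have hn₁ : (n : ℝ) ≤ r * n₁ n := by
      rw [div_le_div_iff₀ hr hn', one_mul] at hgr₁; linarith
    have hn₂ : (n : ℝ) ≤ r * n₂ n := by
      rw [div_le_div_iff₀ hr hn', one_mul] at hgr₂; linarith
    have h₁ : 0 < n₁ n := by
      exact_mod_cast (pos_of_mul_pos_right (hn'.trans_le hn₁) hr.le : (0 : ℝ) < n₁ n)
    have h₂ : 0 < n₂ n := by
      exact_mod_cast (pos_of_mul_pos_right (hn'.trans_le hn₂) hr.le : (0 : ℝ) < n₂ n)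
    obtain ⟨hp0, hq0⟩ := (hM n).perturbedProb_nonneg hν' hδ₀ hδ₁ hm hg h₁ h₂
    have hratio0 : 0 < perturbedProb δ ν (p n) / perturbedProb δ ν (q n) :=
      lt_of_lt_of_le (by positivity) hr1
    have hq : 0 < perturbedProb δ ν (q n) := by
      refine hq0.lt_of_ne fun h => ?_
      rw [← h, div_zero] at hratio0
      exact lt_irrefl _ hratio0
    have hp : 0 < perturbedProb δ ν (p n) := by
      refine hp0.lt_of_ne fun h => ?_
      rw [← h, zero_div] at hratio0
      exact lt_irrefl _ hratio0
    rw [one_div] at hr1 hr3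
    have N : BalancedNetwork (grp n) (n₁ n) (n₂ n) (perturbedProb δ ν (p n))
        (perturbedProb δ ν (q n)) r := ⟨hm, hg, hnpos, hr, hp, hq, hn₁, hn₂, hr1, hr2⟩
    obtain ⟨hτ, hτn⟩ := sqrt_le_mul_of_le_div hn3 hd1
    obtain ⟨hτ₁, hτ₂⟩ := minDensity_mul_le (p := perturbedProb δ ν (p n)) hm hnpos hg h₁ h₂ hq
    set τ := minDensity (linkMatrix (grp n) (perturbedProb δ ν (p n)) (perturbedProb δ ν (q n)))
      with hτdef
    have hs : 0 ≤ errorRate n τ := by unfold errorRate; positivity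
    have hss : errorRate n τ ≤ s₀ := by
      rw [errorRate_eq]
      exact inv_le_of_inv_le₀ hs₀ hd2
    have hbad := (hM n).measureReal_not_concentrated_le hν' hδ₀ hδ₁ hn3 hnm
    have hsubset : {ω | 0 < absLambdaTwo (learningMatrix φ α₀ (perturb δ (A n) (ε n) ω)) -
        absLambdaTwo (learningMatrix φ α₁ (perturb δ (A n) (ε n) ω))}ᶜ ⊆
        {ω | ¬ Concentrated (grp n) (perturbedProb δ ν (p n)) (perturbedProb δ ν (q n))
          (perturb δ (A n) (ε n) ω) (12 * √(n * Real.log n))} := by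
      intro ω hω hconc
      rw [← mul_mul_errorRate hnpos hτ] at hconc
      exact hω (sub_pos.2 (hcomp N hne hr3 hτ₁ hτ₂ (hD.trans hτn) hs hss hconc α₁ hα hαmax hsub
        hgap))
    -- the event need not be measurable, but the measure is subadditive on all sets
    have htotal := measureReal_union_le (μ := μ n)
      {ω | 0 < absLambdaTwo (learningMatrix φ α₀ (perturb δ (A n) (ε n) ω)) -
        absLambdaTwo (learningMatrix φ α₁ (perturb δ (A n) (ε n) ω))}
      {ω | 0 < absLambdaTwo (learningMatrix φ α₀ (perturb δ (A n) (ε n) ω)) -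
        absLambdaTwo (learningMatrix φ α₁ (perturb δ (A n) (ε n) ω))}ᶜ
    rw [Set.union_compl_self, probReal_univ] at htotal
    have := (measureReal_mono hsubset (measure_ne_top _ _)).trans hbad
    linarith
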